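/- Let $n\ge 1$ be an integer, $\hbar>0$, $s\in\mathbb{R}$, and let $y_1,\dots,y_n$ and $x_1,\dots,x_{n-1}$ be complex numbers. Let $\mathscr{C}\subset\mathbb{C}$ be a contour running from $-\infty$ to $+\infty$ inside a horizontal strip, i.e. it admits a Lipschitz, piecewise $C^1$ parametrization $\gamma:\mathbb{R}\to\mathbb{C}$ (with locally finitely many break points) such that $\Im\gamma$ is bounded and, for some $c>0$ and $C\in\mathbb{R}$, $\Re\gamma(t)\ge ct-C$ for $t\ge 0$ and $\Re\gamma(t)\le ct+C$ for $t\le 0$. Assume that $\mathscr{C}$ circumvents from below all the points $y_a+i\hbar k$ ($1\le a\le n$, $k\in\mathbb{N}=\{0,1,2,\dots\}$) and circumvents from above all the points $x_b-i\hbar k$ ($1\le b\le n-1$, $k\in\mathbb{N}$); that is, each of the former (respectively latter) points can be joined by a path in $\mathbb{C}\setminus\mathscr{C}$ to a point lying higher (respectively lower) than all of $\mathscr{C}$. Then the following integral converges absolutely and $$ \int_{\mathscr{C}^n} e^{\frac{s}{i\hbar}\sum_{a=1}^n w_a}\, \frac{\prod_{a=1}^{n}\Big\{\prod_{b=1}^{n}\Gamma\big(\tfrac{y_b-w_a}{i\hbar}\big)\prod_{b=1}^{n-1}\Gamma\big(\tfrac{w_a-x_b}{i\hbar}\big)\Big\}}{\prod_{a\ne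 b}\Gamma\big(\tfrac{w_a-w_b}{i\hbar}\big)}\, \frac{\mathrm{d}^n w}{(2\pi\hbar)^n} = n!\; e^{\frac{s}{i\hbar}\sum_{a=1}^n y_a}\; e^{-e^{s}}\;\prod_{a=1}^{n}\prod_{b=1}^{n-1}\Gamma\Big(\frac{y_a-x_b}{i\hbar}\Big), $$ where the product in the denominator runs over all ordered pairs $(a,b)$ with $1\le a,b\le n$, $a\ne b$, and $1/\Gamma$ denotes the entire reciprocal Gamma function. -/

import Mathlib

/-- A contour in the complex plane that runs from `-∞` to `+∞` inside a horizontal strip, given by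
a piecewise continuously differentiable parametrization (with a locally finite set of break
points) of bounded speed, whose real part goes to `±∞` at least linearly as `t → ±∞`.
Horizontal lines `ℝ + iα` and their deformations on a bounded set are the basic examples. -/
structure IsStripContour (γ : ℝ → ℂ) : Prop where
  lipschitz : ∃ K, LipschitzWith K γ
  piecewise_contDiff : ∃ S : Set ℝ, (∀ a b : ℝ, (S ∩ Set.Icc a b).Finite) ∧
    ∀ t ∉ S, ContDiffAt ℝ 1 γ t
  im_bounded : ∃ M : ℝ, ∀ t, |(γ t).im| ≤ M
  re_growth : ∃ c > (0 : ℝ), ∃ C : ℝ,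
    (∀ t ≥ 0, c * t - C ≤ (γ t).re) ∧ (∀ t ≤ 0, (γ t).re ≤ c * t + C)

/-- The point `p` lies above the contour `γ` (the contour circumvents `p` from below): avoiding
the contour, `p` can be joined to a point that is higher than the whole contour. -/
def LiesAbove (γ : ℝ → ℂ) (p : ℂ) : Prop :=
  ∃ q : ℂ, (∀ t, (γ t).im < q.im) ∧ JoinedIn (Set.range γ)ᶜ p q

/-- The point `p` lies below the contour `γ` (the contour circumvents `p` from above): avoiding
the contour, `p` can be joined to a point that is lower than the whole contour. -/
def LiesBelow (γ : ℝ → ℂ) (p : ℂ) : Prop :=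
  ∃ q : ℂ, (∀ t, q.im < (γ t).im) ∧ JoinedIn (Set.range γ)ᶜ p q

/-- The integrand of the multiple Mellin-Barnes integral. The denominator is the product over all
ordered pairs `(a, b)` with `a ≠ b`. -/
noncomputable def gammaIntegrand {n m : ℕ} (ℏ s : ℝ) (y : Fin n → ℂ) (x : Fin m → ℂ)
    (w : Fin n → ℂ) : ℂ :=
  Complex.exp (s * (∑ a, w a) / (Complex.I * ℏ)) *
    (∏ a, ((∏ b, Complex.Gamma ((y b - w a) / (Complex.I * ℏ))) *
      ∏ b, Complex.Gamma ((w a - x b) / (Complex.I * ℏ)))) /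
    ∏ p ∈ (Finset.univ : Finset (Fin n)).offDiag,
      Complex.Gamma ((w p.1 - w p.2) / (Complex.I * ℏ))

/-- The pull-back to `ℝⁿ` of the form `F(w) dw₁ ⋯ dwₙ` on `γ × ⋯ × γ`. -/
noncomputable def contourPullback {n : ℕ} (γ : ℝ → ℂ) (F : (Fin n → ℂ) → ℂ)
    (t : Fin n → ℝ) : ℂ :=
  F (fun a => γ (t a)) * ∏ a, deriv γ (t a)

/-! Put z = w/(iℏ). By reflection, 1/(Γ(u)Γ(-u)) = -u sin(πu)/π, so the reciprocal of the
denominator is a Vandermonde determinant in the z_a times a product of sines of differences. That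
product is, up to a nonzero constant κ, the determinant of the exponentials e^{iπ(2k-n+1)z_a}
(`inv_prod_offDiag_Gamma`, `exists_sinVandermonde_eq_det`). Andréief's identity then collapses the
n-fold integral to n! κ D, where D is the n × n determinant of one-dimensional Mellin-Barnes moments
(`integral_contourPullback`). Since only one-dimensional integrals remain, the contour may be
deformed freely as long as no pole changes side.

The engine is a contiguity relation. Shifting the contour by iℏ multiplies all the exponentials by
the same sign, and the functional equation of Γ turns the shift into: moment of ∏(z - y_b) = -e^s ·
moment of ∏(z - x_b) (`barnesMoment_prod_X_sub`). It has two consequences.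

On a vertical line in z, differentiating D in s affects only the last row, and the relation gives D'
= (∑ y_b - e^s) D, hence D = K e^{s∑y} e^{-e^s} (`momentDet_mul_exp_eq`). The constant K is read off
as s → -∞: a combination of the exponentials equal to ∏_{b≠k} sin π(y_b - z)/π removes all
right-hand poles except those at y_k + ℕ, and the leading term is governed by the pole at y_k
(`tendsto_sum_barnesMoment`). This needs y_b distinct modulo ℤ; continuity in y removes the
restriction (`momentDet_horizontalLine`).

For a general separating contour, replacing x_b by x_b - 1 multiplies both D and the claimed value
by ∏_a (y_a - x_b) (`momentDet_update`, `prod_Gamma_update`). This factor is nonzero, because no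
point lies both above and below the contour (`LiesAbove.not_liesBelow`). Finitely many shifts bring
all x_b to the left of all y_a, and the contour can be replaced by a horizontal line.

The analytic foundations are a Cauchy theorem for contours in a strip with finitely many poles
there, proved through winding-number integrals (`contourIntegral_eq_of_sameSide`), and the
exponential decay of Γ on vertical strips. -/

open MeasureTheory Filter Topology Set

/-! ### Contour integrals and decay in a horizontal strip -/

/-- The integral of `f` along the contour `γ`. -/
noncomputable def contourIntegral (γ : ℝ → ℂ) (f : ℂ → ℂ) : ℂ := ∫ t, f (γ t) * deriv γ t

/-- `f` decays quadratically at both ends of the open horizontal strip of half-width `L`. -/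
def QuadDecay (L : ℝ) (f : ℂ → ℂ) : Prop :=
  ∃ R C : ℝ, ∀ w : ℂ, |w.im| < L → R ≤ |w.re| → ‖f w‖ ≤ C * (1 + w.re ^ 2)⁻¹

namespace IsStripContour

variable {γ : ℝ → ℂ}

theorem continuous (hγ : IsStripContour γ) : Continuous γ :=
  let ⟨_, hK⟩ := hγ.lipschitz
  hK.continuous

theorem exists_abs_im_lt (hγ : IsStripContour γ) : ∃ M : ℝ, ∀ t, |(γ t).im| < M :=
  let ⟨M, hM⟩ := hγ.im_bounded
  ⟨M + 1, fun t => (hM t).trans_lt (lt_add_one M)⟩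

theorem exists_re_growth (hγ : IsStripContour γ) :
    ∃ c > (0 : ℝ), ∃ T : ℝ, 0 ≤ T ∧ (∀ t, T ≤ t → c * t ≤ (γ t).re) ∧
      ∀ t, t ≤ -T → (γ t).re ≤ c * t := by
  obtain ⟨c, hc, C, h1, h2⟩ := hγ.re_growth
  -- Beyond 2|C|/c the constant C costs at most half of the linear term, so half the slope survives.
  refine ⟨c / 2, by positivity, 2 * |C| / c, by positivity, fun t ht => ?_, fun t ht => ?_⟩
  · have h0 : 0 ≤ t := le_trans (by positivity) ht
    have := h1 t h0
    rw [div_le_iff₀ hc] at ht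
    have := le_abs_self C
    linarith
  · have h0 : t ≤ 0 := by
      have : 0 ≤ 2 * |C| / c := by positivity
      linarith
    have := h2 t h0
    have ht' : 2 * |C| / c ≤ -t := by linarith
    rw [div_le_iff₀ hc] at ht'
    have := le_abs_self C
    linarith

theorem exists_abs_re_growth (hγ : IsStripContour γ) :
    ∃ c > (0 : ℝ), ∃ T : ℝ, 0 ≤ T ∧ ∀ t, T ≤ |t| → c * |t| ≤ |(γ t).re| := by
  obtain ⟨c, hc, T, hT, h1, h2⟩ := hγ.exists_re_growth
  refine ⟨c, hc, T, hT, fun t ht => ?_⟩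
  rcases le_total 0 t with h0 | h0
  · rw [abs_of_nonneg h0] at ht ⊢
    exact (h1 t ht).trans (le_abs_self _)
  · rw [abs_of_nonpos h0] at ht ⊢
    have := h2 t (by linarith)
    have := neg_le_abs (γ t).re
    linarith

theorem isBigO (hγ : IsStripContour γ) {L : ℝ} {f : ℂ → ℂ} (hL : ∀ t, |(γ t).im| < L)
    (hd : QuadDecay L f) :
    (fun t => f (γ t)) =O[cocompact ℝ] fun t => (1 + t ^ 2)⁻¹ := by
  obtain ⟨c, hc, T, hT, h⟩ := hγ.exists_abs_re_growth
  obtain ⟨R, C, hC⟩ := hd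
  refine Asymptotics.IsBigO.of_bound (|C| * (1 + c⁻¹ ^ 2)) ?_
  have h1 : ∀ᶠ t in cocompact ℝ, max T (R / c) ≤ |t| :=
    (tendsto_norm_cocompact_atTop (E := ℝ)).eventually_ge_atTop _
  filter_upwards [h1] with t ht
  have hT' := h t (le_trans (le_max_left _ _) ht)
  have hR : R ≤ c * |t| := by
    have := le_trans (le_max_right _ _) ht
    rw [div_le_iff₀ hc] at this
    linarith
  have hb := hC (γ t) (hL t) (hR.trans hT')
  have hsq : c ^ 2 * t ^ 2 ≤ (γ t).re ^ 2 := by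
    have := pow_le_pow_left₀ (by positivity) hT' 2
    rwa [mul_pow, sq_abs, sq_abs] at this
  have hpos : (0 : ℝ) < 1 + t ^ 2 := by positivity
  have hpos' : (0 : ℝ) < 1 + (γ t).re ^ 2 := by positivity
  have hinv : (1 + (γ t).re ^ 2)⁻¹ ≤ (1 + c⁻¹ ^ 2) * (1 + t ^ 2)⁻¹ := by
    rw [← div_eq_mul_inv, le_div_iff₀ hpos, inv_mul_le_iff₀ hpos']
    have e : c⁻¹ ^ 2 * c ^ 2 = 1 := by
      rw [← mul_pow, inv_mul_cancel₀ hc.ne', one_pow]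
    have e2 : t ^ 2 = c⁻¹ ^ 2 * (c ^ 2 * t ^ 2) := by rw [← mul_assoc, e, one_mul]
    have e3 : t ^ 2 ≤ c⁻¹ ^ 2 * (γ t).re ^ 2 := by
      rw [e2]; exact mul_le_mul_of_nonneg_left hsq (by positivity)
    nlinarith [sq_nonneg c⁻¹, sq_nonneg (γ t).re]
  rw [Real.norm_of_nonneg (by positivity)]
  calc ‖f (γ t)‖ ≤ C * (1 + (γ t).re ^ 2)⁻¹ := hb
    _ ≤ |C| * (1 + (γ t).re ^ 2)⁻¹ := by gcongr; exact le_abs_self C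
    _ ≤ |C| * ((1 + c⁻¹ ^ 2) * (1 + t ^ 2)⁻¹) := by gcongr
    _ = _ := by ring

/-- The Lipschitz constant bounds `deriv γ` everywhere, including break points, where it may take
the default value 0. -/
theorem integrable_comp_mul_deriv (hγ : IsStripContour γ) {f : ℂ → ℂ}
    (hf : Integrable fun t => f (γ t)) : Integrable fun t => f (γ t) * deriv γ t := by
  obtain ⟨K, hK⟩ := hγ.lipschitz
  exact hf.mul_bdd (c := K) (measurable_deriv γ).aestronglyMeasurable
    (Eventually.of_forall fun t => norm_deriv_le_of_lipschitz hK)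

theorem integrable_of_quadDecay (hγ : IsStripContour γ) {L : ℝ} {f : ℂ → ℂ}
    (hL : ∀ t, |(γ t).im| < L) (hf : ContinuousOn f (range γ)) (hd : QuadDecay L f) :
    Integrable fun t => f (γ t) * deriv γ t := by
  apply hγ.integrable_comp_mul_deriv
  have hc : Continuous fun t => f (γ t) :=
    hf.comp_continuous hγ.continuous (fun t => mem_range_self t)
  exact hc.locallyIntegrable.integrable_of_isBigO_cocompact (hγ.isBigO hL hd)
    (integrable_inv_one_add_sq.integrableAtFilter _)

theorem exists_countable_hasDerivAt (hγ : IsStripContour γ) :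
    ∃ S : Set ℝ, S.Countable ∧ ∀ t ∉ S, HasDerivAt γ (deriv γ t) t := by
  obtain ⟨S, hS, hd⟩ := hγ.piecewise_contDiff
  refine ⟨S, ?_, fun t ht => ((hd t ht).differentiableAt (by simp)).hasDerivAt⟩
  have : S = ⋃ n : ℕ, S ∩ Icc (-(n : ℝ)) n := by
    ext t
    simp only [mem_iUnion, mem_inter_iff, mem_Icc]
    refine ⟨fun h => ?_, fun ⟨_, h, _⟩ => h⟩
    obtain ⟨n, hn⟩ := exists_nat_ge |t|
    exact ⟨n, h, (abs_le.1 hn).1, (abs_le.1 hn).2⟩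
  rw [this]
  exact countable_iUnion fun n => (hS _ _).countable

/-- G ∘ γ is continuous and differentiable off the countable set of break points, which is enough
for the fundamental theorem of calculus on [-T, T]; then T → ∞. -/
theorem tendsto_primitive (hγ : IsStripContour γ) {f G : ℂ → ℂ}
    (hG : ∀ t, HasDerivAt G (f (γ t)) (γ t)) (hi : Integrable fun t => f (γ t) * deriv γ t) :
    Tendsto (fun T : ℝ => G (γ T) - G (γ (-T))) atTop (𝓝 (contourIntegral γ f)) := by
  obtain ⟨S, hS, hd⟩ := hγ.exists_countable_hasDerivAt
  have := intervalIntegral_tendsto_integral hi tendsto_neg_atTop_atBot tendsto_id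
  refine this.congr fun T => ?_
  refine MeasureTheory.integral_eq_of_hasDerivAt_off_countable (fun t => G (γ t)) _ hS ?_ ?_
    hi.intervalIntegrable
  · intro t _
    exact ((hG t).continuousAt.comp hγ.continuous.continuousAt).continuousWithinAt
  · intro t ht
    exact (hG t).comp_of_eq t (hd t ht.2) rfl

theorem tendsto_abs_re (hγ : IsStripContour γ) :
    Tendsto (fun t => |(γ t).re|) atTop atTop ∧ Tendsto (fun t => |(γ (-t)).re|) atTop atTop := by
  obtain ⟨c, hc, T, hT, h⟩ := hγ.exists_abs_re_growth
  have hlin : Tendsto (fun t : ℝ => c * t) atTop atTop := tendsto_id.const_mul_atTop hc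
  constructor
  · refine tendsto_atTop_mono' _ ?_ hlin
    filter_upwards [eventually_ge_atTop T] with t ht
    have h0 : |t| = t := abs_of_nonneg (hT.trans ht)
    have := h t (by rwa [h0])
    rwa [h0] at this
  · refine tendsto_atTop_mono' _ ?_ hlin
    filter_upwards [eventually_ge_atTop T] with t ht
    have h0 : |-t| = t := by rw [abs_neg, abs_of_nonneg (hT.trans ht)]
    have := h (-t) (by rwa [h0])
    rwa [h0] at this

end IsStripContour

theorem contourIntegral_congr {γ : ℝ → ℂ} {f g : ℂ → ℂ} (h : ∀ t, f (γ t) = g (γ t)) :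
    contourIntegral γ f = contourIntegral γ g := by
  simp only [contourIntegral, h]

theorem contourIntegral_add {γ : ℝ → ℂ} {f g : ℂ → ℂ}
    (hf : Integrable fun t => f (γ t) * deriv γ t) (hg : Integrable fun t => g (γ t) * deriv γ t) :
    contourIntegral γ (fun w => f w + g w) = contourIntegral γ f + contourIntegral γ g := by
  simp only [contourIntegral, add_mul]
  exact integral_add hf hg

theorem contourIntegral_const_mul (γ : ℝ → ℂ) (c : ℂ) (f : ℂ → ℂ) :
    contourIntegral γ (fun w => c * f w) = c * contourIntegral γ f := by
  simp only [contourIntegral, mul_assoc]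
  exact integral_const_mul _ _

theorem QuadDecay.add {L : ℝ} {f g : ℂ → ℂ} (hf : QuadDecay L f) (hg : QuadDecay L g) :
    QuadDecay L fun w => f w + g w := by
  obtain ⟨R, C, h⟩ := hf
  obtain ⟨R', C', h'⟩ := hg
  refine ⟨max R R', C + C', fun w hw hr => ?_⟩
  refine (norm_add_le _ _).trans ?_
  rw [add_mul]
  exact add_le_add (h w hw (le_trans (le_max_left _ _) hr))
    (h' w hw (le_trans (le_max_right _ _) hr))

theorem QuadDecay.const_mul {L : ℝ} {f : ℂ → ℂ} (c : ℂ) (hf : QuadDecay L f) :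
    QuadDecay L fun w => c * f w := by
  obtain ⟨R, C, h⟩ := hf
  refine ⟨R, ‖c‖ * C, fun w hw hr => ?_⟩
  rw [norm_mul, mul_assoc]
  exact mul_le_mul_of_nonneg_left (h w hw hr) (norm_nonneg c)

theorem quadDecay_inv_mul_inv (L : ℝ) (p q : ℂ) : QuadDecay L fun w => (w - p)⁻¹ * (w - q)⁻¹ := by
  -- Beyond this abscissa |w - p| and |w - q| are at least |Re w|/2 and |Re w| ≥ 1. The constant is
  -- 4 · 2, the 2 coming from 1 + x² ≤ 2x².
  refine ⟨2 * (|p.re| + |q.re|) + 1, 8, fun w _ hr => ?_⟩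
  have key : ∀ a : ℂ, 2 * |a.re| + 1 ≤ |w.re| → ‖(w - a)⁻¹‖ ≤ 2 * |w.re|⁻¹ := by
    intro a ha
    have h1 : |w.re| / 2 ≤ ‖w - a‖ := by
      have h2 := Complex.abs_re_le_norm (w - a)
      rw [Complex.sub_re] at h2
      have h3 := abs_sub_abs_le_abs_sub w.re a.re
      linarith [abs_nonneg a.re]
    have h0 : 0 < |w.re| := by linarith [abs_nonneg a.re]
    rw [norm_inv, show 2 * |w.re|⁻¹ = (|w.re| / 2)⁻¹ by field_simp]
    exact inv_anti₀ (by positivity) h1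
  have hp := key p (by linarith [abs_nonneg q.re])
  have hq := key q (by linarith [abs_nonneg p.re])
  have h1 : 1 ≤ |w.re| := by linarith [abs_nonneg q.re, abs_nonneg p.re]
  rw [norm_mul]
  calc ‖(w - p)⁻¹‖ * ‖(w - q)⁻¹‖ ≤ (2 * |w.re|⁻¹) * (2 * |w.re|⁻¹) := by gcongr
    _ = 4 * (w.re ^ 2)⁻¹ := by rw [← sq_abs]; field_simp; norm_num
    _ ≤ 8 * (1 + w.re ^ 2)⁻¹ := by
      have : 1 ≤ w.re ^ 2 := by rw [← sq_abs]; nlinarith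
      rw [← div_eq_mul_inv, ← div_eq_mul_inv, div_le_div_iff₀ (by positivity) (by positivity)]
      linarith

theorem LiesAbove.notMem_range {γ : ℝ → ℂ} {p : ℂ} (h : LiesAbove γ p) : p ∉ range γ :=
  let ⟨_, _, hj⟩ := h
  hj.source_mem

theorem LiesBelow.notMem_range {γ : ℝ → ℂ} {p : ℂ} (h : LiesBelow γ p) : p ∉ range γ :=
  let ⟨_, _, hj⟩ := h
  hj.source_mem

/-! ### Principal parts and winding numbers -/

theorem quadDecay_inv_pow (L : ℝ) (p : ℂ) (k : ℕ) : QuadDecay L fun w => (w - p)⁻¹ ^ (k + 2) := by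
  induction k with
  | zero => simpa [sq] using quadDecay_inv_mul_inv L p p
  | succ k ih =>
    obtain ⟨R, C, h⟩ := ih
    refine ⟨max R (|p.re| + 1), C, fun w hw hr => ?_⟩
    have h1 : 1 ≤ ‖w - p‖ := by
      have h2 := Complex.abs_re_le_norm (w - p)
      rw [Complex.sub_re] at h2
      have h3 := abs_sub_abs_le_abs_sub w.re p.re
      have h4 := (le_max_right R (|p.re| + 1)).trans hr
      linarith
    have h5 := h w hw ((le_max_left _ _).trans hr)
    change ‖(w - p)⁻¹ ^ (k + 2 + 1)‖ ≤ _
    rw [pow_succ _ (k + 2), norm_mul]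
    refine (mul_le_of_le_one_right (norm_nonneg _) ?_).trans h5
    rw [norm_inv]
    exact inv_le_one_of_one_le₀ h1

namespace IsStripContour

variable {γ : ℝ → ℂ}

theorem tendsto_inv_sub (hγ : IsStripContour γ) (p : ℂ) :
    Tendsto (fun t => (γ t - p)⁻¹) atTop (𝓝 0) ∧
      Tendsto (fun t => (γ (-t) - p)⁻¹) atTop (𝓝 0) := by
  have key : ∀ u : ℝ → ℂ, Tendsto (fun t => |(u t).re|) atTop atTop →
      Tendsto (fun t => (u t - p)⁻¹) atTop (𝓝 0) := by
    intro u hu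
    refine tendsto_inv₀_cobounded.comp (tendsto_norm_atTop_iff_cobounded.1 ?_)
    refine tendsto_atTop_mono (fun t => ?_) (tendsto_atTop_add_const_right _ (-‖p‖) hu)
    have h1 := Complex.abs_re_le_norm (u t)
    have h2 := norm_sub_norm_le (u t) p
    linarith
  exact ⟨key γ hγ.tendsto_abs_re.1, key _ hγ.tendsto_abs_re.2⟩

/-- A pole of order at least two has a single-valued primitive, a multiple of (w - p)^{-(k+1)},
which vanishes at both ends of the contour. -/
theorem contourIntegral_inv_pow (hγ : IsStripContour γ) {p : ℂ} (hp : p ∉ range γ) (k : ℕ) :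
    contourIntegral γ (fun w => (w - p)⁻¹ ^ (k + 2)) = 0 := by
  obtain ⟨M, hM⟩ := hγ.exists_abs_im_lt
  have hne : ∀ t, γ t - p ≠ 0 := fun t h => hp ⟨t, sub_eq_zero.1 h⟩
  have hi : Integrable fun t => (γ t - p)⁻¹ ^ (k + 2) * deriv γ t := by
    refine hγ.integrable_of_quadDecay (f := fun w => (w - p)⁻¹ ^ (k + 2)) hM ?_
      (quadDecay_inv_pow M p k)
    rintro _ ⟨t, rfl⟩
    exact ((continuousAt_id.sub continuousAt_const).inv₀ (hne t)).pow _ |>.continuousWithinAt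
  have hG : ∀ t, HasDerivAt (fun w : ℂ => -((k + 1 : ℂ)⁻¹ * (w - p)⁻¹ ^ (k + 1)))
      ((γ t - p)⁻¹ ^ (k + 2)) (γ t) := by
    intro t
    have h1 : HasDerivAt (fun w : ℂ => (w - p)⁻¹) (-1 / (γ t - p) ^ 2) (γ t) :=
      ((hasDerivAt_id (γ t)).sub_const p).fun_inv (hne t)
    have h2 := ((h1.fun_pow (k + 1)).const_mul (k + 1 : ℂ)⁻¹).fun_neg
    refine h2.congr_deriv ?_
    have h3 : (k + 1 : ℂ) ≠ 0 := by exact_mod_cast k.succ_ne_zero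
    rw [show -1 / (γ t - p) ^ 2 = -(γ t - p)⁻¹ ^ 2 by rw [inv_pow]; ring]
    generalize (γ t - p)⁻¹ = u
    push_cast
    field_simp
    ring
  have h := hγ.tendsto_primitive (f := fun w => (w - p)⁻¹ ^ (k + 2)) hG hi
  have h0 : ∀ u : ℝ → ℂ, Tendsto (fun t => (u t - p)⁻¹) atTop (𝓝 0) →
      Tendsto (fun t => -((k + 1 : ℂ)⁻¹ * (u t - p)⁻¹ ^ (k + 1))) atTop (𝓝 0) := by
    intro u hu
    simpa using ((hu.pow (k + 1)).const_mul (k + 1 : ℂ)⁻¹).neg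
  have h' := (h0 γ (hγ.tendsto_inv_sub p).1).sub (h0 (fun t => γ (-t)) (hγ.tendsto_inv_sub p).2)
  rw [sub_zero] at h'
  exact tendsto_nhds_unique h h'

/-- The real part tends to infinity in absolute value, so γ is proper. Closedness makes the path
components of the complement open, as needed to vary the winding number. -/
theorem isClosed_range (hγ : IsStripContour γ) : IsClosed (range γ) := by
  have : IsProperMap γ := by
    rw [isProperMap_iff_tendsto_cocompact]
    refine ⟨hγ.continuous, ?_⟩
    rw [← Metric.cobounded_eq_cocompact, ← Metric.cobounded_eq_cocompact,
      ← tendsto_norm_atTop_iff_cobounded]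
    obtain ⟨c, hc, T, hT, h⟩ := hγ.exists_abs_re_growth
    refine tendsto_atTop_mono' _ ?_ (tendsto_norm_cobounded_atTop.const_mul_atTop hc)
    filter_upwards [tendsto_norm_cobounded_atTop.eventually_ge_atTop T] with t ht
    exact (h t ht).trans (Complex.abs_re_le_norm _)
  exact this.isClosedMap.isClosed_range

theorem integrable_inv_mul_inv (hγ : IsStripContour γ) {p q : ℂ} (hp : p ∉ range γ)
    (hq : q ∉ range γ) : Integrable fun t => (γ t - p)⁻¹ * (γ t - q)⁻¹ * deriv γ t := by
  obtain ⟨M, hM⟩ := hγ.exists_abs_im_lt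
  refine hγ.integrable_of_quadDecay (f := fun w => (w - p)⁻¹ * (w - q)⁻¹) hM ?_
    (quadDecay_inv_mul_inv M p q)
  rintro _ ⟨t, rfl⟩
  refine (ContinuousAt.mul ?_ ?_).continuousWithinAt
  · exact (continuousAt_id.sub continuousAt_const).inv₀ fun h => hp ⟨t, sub_eq_zero.1 h⟩
  · exact (continuousAt_id.sub continuousAt_const).inv₀ fun h => hq ⟨t, sub_eq_zero.1 h⟩

/-- Two points in the same path component of the complement of the contour have the same winding
number. -/
theorem contourIntegral_of_joinedIn (hγ : IsStripContour γ) {p q : ℂ}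
    (h : JoinedIn (range γ)ᶜ p q) :
    contourIntegral γ (fun w => (p - q) * ((w - p)⁻¹ * (w - q)⁻¹)) = 0 := by
  have hq : q ∉ range γ := h.target_mem
  -- The integrand is 1/(w - p) - 1/(w - q): the winding number of p normalised at q, so that the
  -- integral converges absolutely. The plan is to show D' = 0 off the contour; D(q) = 0 is clear.
  set D : ℂ → ℂ := fun p => contourIntegral γ (fun w => (p - q) * ((w - p)⁻¹ * (w - q)⁻¹)) with hD
  have hU : IsOpen (range γ)ᶜ := hγ.isClosed_range.isOpen_compl
  have hdiff : ∀ a ∉ range γ, ∀ b ∉ range γ,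
      D b - D a = (b - a) ^ 2 * ∫ t, (γ t - b)⁻¹ * ((γ t - a)⁻¹ * (γ t - a)⁻¹ * deriv γ t) := by
    intro a ha b hb
    have e0 := hγ.contourIntegral_inv_pow ha 0
    have hia := (hγ.integrable_inv_mul_inv ha hq).const_mul (a - q)
    have hib := (hγ.integrable_inv_mul_inv hb hq).const_mul (b - q)
    have hiaa := (hγ.integrable_inv_mul_inv ha ha).const_mul (b - a)
    -- Subtracting the first-order term, which vanishes because it is the integral of (w - a)^{-2},
    -- leaves a remainder of order (b - a)².
    have e1 : D b - D a = D b - D a - (b - a) * contourIntegral γ (fun w => (w - a)⁻¹ ^ 2) := by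
      rw [e0]; ring
    rw [e1, ← integral_const_mul]
    simp only [hD, contourIntegral]
    rw [← integral_const_mul, ← integral_sub, ← integral_sub]
    · congr 1
      ext t
      have h1 : γ t - a ≠ 0 := fun h => ha ⟨t, sub_eq_zero.1 h⟩
      have h2 : γ t - b ≠ 0 := fun h => hb ⟨t, sub_eq_zero.1 h⟩
      have h3 : γ t - q ≠ 0 := fun h => hq ⟨t, sub_eq_zero.1 h⟩
      field_simp
      ring
    · exact (hib.sub hia).congr (Eventually.of_forall fun t => by simp [mul_assoc])
    · simpa only [mul_assoc, sq] using hiaa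
    · simpa only [mul_assoc] using hib
    · simpa only [mul_assoc] using hia
  have hder : ∀ a ∉ range γ, HasDerivAt D 0 a := by
    intro a ha
    obtain ⟨δ, hδ, hball⟩ := Metric.isOpen_iff.1 hU a ha
    have hdist : ∀ t, δ ≤ ‖γ t - a‖ := by
      intro t
      by_contra! hlt
      exact hball (show γ t ∈ Metric.ball a δ by simpa [dist_eq_norm] using hlt) ⟨t, rfl⟩
    rw [hasDerivAt_iff_isLittleO]
    simp only [smul_zero, sub_zero]
    have hbig : (fun b => D b - D a) =O[𝓝 a] fun b => (b - a) ^ 2 := by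
      refine Asymptotics.IsBigO.of_bound
        (2 / δ * ∫ t, ‖(γ t - a)⁻¹ * (γ t - a)⁻¹ * deriv γ t‖) ?_
      filter_upwards [Metric.ball_mem_nhds a (half_pos hδ)] with b hb
      have hb' : ‖b - a‖ < δ / 2 := by simpa [dist_eq_norm] using hb
      have hbr : b ∉ range γ := hball (Metric.ball_subset_ball (by linarith) hb)
      rw [hdiff a ha b hbr, norm_mul, mul_comm]
      refine mul_le_mul_of_nonneg_right ?_ (norm_nonneg _)
      rw [← integral_const_mul]
      refine norm_integral_le_of_norm_le
        ((hγ.integrable_inv_mul_inv ha ha).norm.const_mul (2 / δ)) (Eventually.of_forall fun t => ?_)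
      rw [norm_mul]
      refine mul_le_mul_of_nonneg_right ?_ (norm_nonneg _)
      have h1 : δ / 2 ≤ ‖γ t - b‖ := by
        have h2 := norm_sub_le_norm_sub_add_norm_sub (γ t) b a
        linarith [hdist t]
      rw [norm_inv, show 2 / δ = (δ / 2)⁻¹ by rw [inv_div]]
      exact inv_anti₀ (by positivity) h1
    refine hbig.trans_isLittleO ?_
    have h0 : Tendsto (fun b : ℂ => b - a) (𝓝 a) (𝓝 0) := by
      simpa using (continuous_sub_right a).tendsto a
    have := (Asymptotics.isLittleO_one_iff ℂ |>.2 h0).mul_isBigO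
      (Asymptotics.isBigO_refl (fun b : ℂ => b - a) (𝓝 a))
    simpa [sq] using this
  have hopen : IsOpen (pathComponentIn (range γ)ᶜ p) := hU.pathComponentIn p
  have hsub : pathComponentIn (range γ)ᶜ p ⊆ (range γ)ᶜ := pathComponentIn_subset
  have hconn : IsPreconnected (pathComponentIn (range γ)ᶜ p) :=
    (isPathConnected_pathComponentIn h.source_mem).isConnected.isPreconnected
  have hDq : D q = 0 := by simp [hD, contourIntegral]
  rw [← hDq]
  refine hopen.is_const_of_deriv_eq_zero hconn (f := D) ?_ ?_ (mem_pathComponentIn_self h.source_mem)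
    h
  · exact fun a ha => (hder a (hsub ha)).differentiableAt.differentiableWithinAt
  · exact fun a ha => (hder a (hsub ha)).deriv

end IsStripContour

/-- The set of points higher than the whole contour is convex, so the endpoint of the path in
`LiesAbove` can be moved to any such point. -/
theorem LiesAbove.joinedIn {γ : ℝ → ℂ} {p q : ℂ} (h : LiesAbove γ p)
    (hq : ∀ t, (γ t).im < q.im) : JoinedIn (range γ)ᶜ p q := by
  obtain ⟨q₀, h₀, hj⟩ := h
  have hconv : Convex ℝ {z : ℂ | ∀ t, (γ t).im < z.im} := by
    rw [ofPred_forall]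
    exact convex_iInter fun t => convex_halfSpace_im_gt _
  refine hj.trans (((hconv.isPathConnected ⟨q, hq⟩).joinedIn q₀ h₀ q hq).mono ?_)
  rintro z hz ⟨t, rfl⟩
  exact lt_irrefl _ (hz t)

theorem LiesBelow.joinedIn {γ : ℝ → ℂ} {p q : ℂ} (h : LiesBelow γ p)
    (hq : ∀ t, q.im < (γ t).im) : JoinedIn (range γ)ᶜ p q := by
  obtain ⟨q₀, h₀, hj⟩ := h
  have hconv : Convex ℝ {z : ℂ | ∀ t, z.im < (γ t).im} := by
    rw [ofPred_forall]
    exact convex_iInter fun t => convex_halfSpace_im_lt _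
  refine hj.trans (((hconv.isPathConnected ⟨q, hq⟩).joinedIn q₀ h₀ q hq).mono ?_)
  rintro z hz ⟨t, rfl⟩
  exact lt_irrefl _ (hz t)

/-! ### Cauchy's theorem in a strip -/

/-- The open horizontal strip of half-width `L`. -/
def openStrip (L : ℝ) : Set ℂ := {w | |w.im| < L}

theorem isOpen_openStrip (L : ℝ) : IsOpen (openStrip L) :=
  isOpen_lt (continuous_abs.comp Complex.continuous_im) continuous_const

theorem convex_openStrip (L : ℝ) : Convex ℝ (openStrip L) := by
  have : openStrip L = {w | -L < w.im} ∩ {w | w.im < L} := by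
    ext w
    exact abs_lt (a := w.im) (b := L)
  rw [this]
  exact (convex_halfSpace_im_gt _).inter (convex_halfSpace_im_lt _)

/-- Mean value inequality on a convex tail of the strip. It is used to close up two contours at
infinity. -/
theorem norm_primitive_sub_le {L R C r : ℝ} {f G : ℂ → ℂ}
    (hG : ∀ w ∈ openStrip L, HasDerivAt G (f w) w)
    (hC : ∀ w : ℂ, |w.im| < L → R ≤ |w.re| → ‖f w‖ ≤ C * (1 + w.re ^ 2)⁻¹)
    (hr0 : 0 ≤ r) (hr : R ≤ r) {s : Set ℂ} (hs : Convex ℝ s) (hsL : s ⊆ openStrip L)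
    (hsr : ∀ w ∈ s, r ≤ |w.re|) {u v : ℂ} (hu : u ∈ s) (hv : v ∈ s) :
    ‖G v - G u‖ ≤ |C| * (1 + r ^ 2)⁻¹ * ‖v - u‖ := by
  refine hs.norm_image_sub_le_of_norm_hasDerivWithin_le
    (fun w hw => (hG w (hsL hw)).hasDerivWithinAt) (fun w hw => ?_) hu hv
  refine (hC w (hsL hw) (hr.trans (hsr w hw))).trans ?_
  have h1 : r ^ 2 ≤ w.re ^ 2 := by
    rw [← sq_abs w.re]
    exact pow_le_pow_left₀ hr0 (hsr w hw) 2
  gcongr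
  exact le_abs_self C

/-- The endpoints of two Lipschitz contours separate at most linearly in T, which the quadratic
decay of the integrand beats. -/
theorem tendsto_inv_sq_mul_linear {c : ℝ} (hc : 0 < c) (A B : ℝ) :
    Tendsto (fun T : ℝ => (1 + (c * T) ^ 2)⁻¹ * (A + B * T)) atTop (𝓝 0) := by
  have h1 : Tendsto (fun T : ℝ => (|A| + |B|) * (c ^ 2)⁻¹ * T⁻¹) atTop (𝓝 0) := by
    simpa using tendsto_inv_atTop_zero.const_mul ((|A| + |B|) * (c ^ 2)⁻¹)
  refine squeeze_zero_norm' ?_ h1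
  filter_upwards [eventually_ge_atTop 1] with T hT
  have hT0 : 0 < T := by linarith
  rw [norm_mul, Real.norm_of_nonneg (by positivity)]
  have h2 : ‖A + B * T‖ ≤ (|A| + |B|) * T := by
    refine (norm_add_le _ _).trans ?_
    rw [norm_mul, Real.norm_eq_abs, Real.norm_eq_abs, Real.norm_of_nonneg hT0.le, add_mul]
    gcongr
    exact le_mul_of_one_le_right (abs_nonneg A) hT
  have h3 : (1 + (c * T) ^ 2)⁻¹ ≤ ((c * T) ^ 2)⁻¹ :=
    inv_anti₀ (by positivity) (by linarith)
  calc _ ≤ ((c * T) ^ 2)⁻¹ * ((|A| + |B|) * T) := by gcongr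
    _ = _ := by field_simp

/-- Cauchy's theorem for two contours in a strip on which the integrand is holomorphic. -/
theorem contourIntegral_eq_of_differentiableOn {γ γ' : ℝ → ℂ} (hγ : IsStripContour γ)
    (hγ' : IsStripContour γ') {L : ℝ} (hL : ∀ t, |(γ t).im| < L) (hL' : ∀ t, |(γ' t).im| < L)
    {f : ℂ → ℂ} (hf : DifferentiableOn ℂ f (openStrip L)) (hd : QuadDecay L f) :
    contourIntegral γ f = contourIntegral γ' f := by
  -- The strip is convex, so a primitive exists, and both integrals are limits of its increments. It
  -- remains to compare G at the two right ends and at the two left ends.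
  obtain ⟨G, hG'⟩ := (convex_openStrip L).exists_forall_hasDerivWithinAt hf
  have hG : ∀ w ∈ openStrip L, HasDerivAt G (f w) w := fun w hw =>
    (hG' w hw).hasDerivAt ((isOpen_openStrip L).mem_nhds hw)
  have hcont := hf.continuousOn
  have h1 := hγ.tendsto_primitive (fun t => hG _ (hL t))
    (hγ.integrable_of_quadDecay hL (hcont.mono (range_subset_iff.2 hL)) hd)
  have h2 := hγ'.tendsto_primitive (fun t => hG _ (hL' t))
    (hγ'.integrable_of_quadDecay hL' (hcont.mono (range_subset_iff.2 hL')) hd)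
  obtain ⟨R, C, hC⟩ := hd
  obtain ⟨c, hc, T₀, hT₀, ha, hb⟩ := hγ.exists_re_growth
  obtain ⟨c', hc', T₀', hT₀', ha', hb'⟩ := hγ'.exists_re_growth
  obtain ⟨K, hK⟩ := hγ.lipschitz
  obtain ⟨K', hK'⟩ := hγ'.lipschitz
  set m := min c c' with hm
  have hmpos : 0 < m := lt_min hc hc'
  set A := ‖γ 0‖ + ‖γ' 0‖
  set B : ℝ := K + K'
  have hlin : ∀ T, ‖γ' T - γ T‖ ≤ A + B * |T| := by
    intro T
    have e1 := hK.dist_le_mul T 0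
    have e2 := hK'.dist_le_mul T 0
    rw [dist_eq_norm, dist_zero_right, Real.norm_eq_abs] at e1 e2
    have e3 : ‖γ T‖ ≤ ‖γ 0‖ + ‖γ T - γ 0‖ := by
      simpa using norm_add_le (γ 0) (γ T - γ 0)
    have e4 : ‖γ' T‖ ≤ ‖γ' 0‖ + ‖γ' T - γ' 0‖ := by
      simpa using norm_add_le (γ' 0) (γ' T - γ' 0)
    have e5 := norm_sub_le (γ' T) (γ T)
    simp only [A, B, add_mul]
    linarith
  have hlim : Tendsto (fun T : ℝ => |C| * ((1 + (m * T) ^ 2)⁻¹ * (A + B * T))) atTop (𝓝 0) := by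
    simpa using (tendsto_inv_sq_mul_linear hmpos A B).const_mul |C|
  have hev : ∀ᶠ T : ℝ in atTop, T₀ ≤ T ∧ T₀' ≤ T ∧ R / m ≤ T :=
    (eventually_ge_atTop _).and ((eventually_ge_atTop _).and (eventually_ge_atTop _))
  have hright : Tendsto (fun T => G (γ' T) - G (γ T)) atTop (𝓝 0) := by
    refine squeeze_zero_norm' ?_ hlim
    filter_upwards [hev] with T ⟨hT1, hT2, hT3⟩
    have hT : 0 ≤ T := hT₀.trans hT1
    rw [div_le_iff₀ hmpos, mul_comm] at hT3
    have hconv : Convex ℝ (openStrip L ∩ {w | m * T ≤ w.re}) :=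
      (convex_openStrip L).inter (convex_halfSpace_re_ge _)
    refine (norm_primitive_sub_le hG hC (by positivity) hT3 hconv inter_subset_left
      (fun w hw => le_trans hw.2 (le_abs_self _)) (u := γ T) (v := γ' T) ⟨hL T, ?_⟩
      ⟨hL' T, ?_⟩).trans ?_
    · exact le_trans (mul_le_mul_of_nonneg_right (min_le_left _ _) hT) (ha T hT1)
    · exact le_trans (mul_le_mul_of_nonneg_right (min_le_right _ _) hT) (ha' T hT2)
    · rw [mul_assoc]
      have := hlin T
      rw [abs_of_nonneg hT] at this
      gcongr
  have hleft : Tendsto (fun T => G (γ' (-T)) - G (γ (-T))) atTop (𝓝 0) := by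
    refine squeeze_zero_norm' ?_ hlim
    filter_upwards [hev] with T ⟨hT1, hT2, hT3⟩
    have hT : 0 ≤ T := hT₀.trans hT1
    rw [div_le_iff₀ hmpos, mul_comm] at hT3
    have hconv : Convex ℝ (openStrip L ∩ {w | w.re ≤ -(m * T)}) :=
      (convex_openStrip L).inter (convex_halfSpace_re_le _)
    refine (norm_primitive_sub_le hG hC (by positivity) hT3 hconv inter_subset_left
      (fun w hw => ?_) (u := γ (-T)) (v := γ' (-T)) ⟨hL _, ?_⟩
      ⟨hL' _, ?_⟩).trans ?_
    · have h1 : w.re ≤ -(m * T) := hw.2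
      exact le_trans (by linarith) (neg_le_abs _)
    · have e1 := hb (-T) (by linarith)
      have e2 := mul_le_mul_of_nonneg_right (min_le_left c c') hT
      change (γ (-T)).re ≤ -(m * T)
      linarith
    · have e1 := hb' (-T) (by linarith)
      have e2 := mul_le_mul_of_nonneg_right (min_le_right c c') hT
      change (γ' (-T)).re ≤ -(m * T)
      linarith
    · rw [mul_assoc]
      have := hlin (-T)
      rw [abs_neg, abs_of_nonneg hT] at this
      gcongr
  have h3 := (h1.add hright).sub hleft
  rw [add_zero, sub_zero] at h3
  refine tendsto_nhds_unique h3 (h2.congr fun T => ?_)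
  ring

/-- The point `p` lies on the same side of both contours. -/
def SameSide (γ γ' : ℝ → ℂ) (p : ℂ) : Prop :=
  (LiesAbove γ p ∧ LiesAbove γ' p) ∨ (LiesBelow γ p ∧ LiesBelow γ' p)

theorem SameSide.notMem_range {γ γ' : ℝ → ℂ} {p : ℂ} (h : SameSide γ γ' p) :
    p ∉ range γ ∧ p ∉ range γ' := by
  rcases h with h | h
  · exact ⟨h.1.notMem_range, h.2.notMem_range⟩
  · exact ⟨h.1.notMem_range, h.2.notMem_range⟩

/-- Cauchy's theorem for two contours in a strip on which the integrand is meromorphic, if no pole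
separates the contours. -/
theorem contourIntegral_eq_of_sameSide {γ γ' : ℝ → ℂ} (hγ : IsStripContour γ)
    (hγ' : IsStripContour γ') {L : ℝ} (hL : ∀ t, |(γ t).im| < L) (hL' : ∀ t, |(γ' t).im| < L)
    {g : ℂ → ℂ} (hg : DifferentiableOn ℂ g (openStrip L)) {Q : Polynomial ℂ} (hQ : Q ≠ 0)
    (hroots : ∀ p, Q.IsRoot p → SameSide γ γ' p) (hd : QuadDecay L fun w => g w / Q.eval w) :
    contourIntegral γ (fun w => g w / Q.eval w) = contourIntegral γ' fun w => g w / Q.eval w := by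
  -- Induction on the degree: each step removes one factor w - p from Q at the cost of a term with
  -- zero integral along both contours.
  obtain ⟨d, hdeg⟩ : ∃ d, Q.natDegree = d := ⟨_, rfl⟩
  induction d generalizing g Q with
  | zero =>
    rw [Polynomial.natDegree_eq_zero] at hdeg
    obtain ⟨a, rfl⟩ := hdeg
    refine contourIntegral_eq_of_differentiableOn hγ hγ' hL hL' ?_ hd
    simp only [Polynomial.eval_C]
    exact hg.div_const a
  | succ d ih =>
    obtain ⟨p, hp⟩ := IsAlgClosed.exists_root Q (by
      intro h
      rw [Polynomial.degree_eq_natDegree hQ, hdeg] at h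
      exact absurd h (by norm_cast))
    obtain ⟨Q₁, hQ₁⟩ := Polynomial.dvd_iff_isRoot.2 hp
    have hQ₁0 : Q₁ ≠ 0 := by rintro rfl; simp at hQ₁; exact hQ hQ₁
    have hdeg₁ : Q₁.natDegree = d := by
      rw [hQ₁, Polynomial.natDegree_mul (Polynomial.X_sub_C_ne_zero p) hQ₁0,
        Polynomial.natDegree_X_sub_C] at hdeg
      omega
    have hroots₁ : ∀ q, Q₁.IsRoot q → SameSide γ γ' q := fun q hq =>
      hroots q (by rw [hQ₁]; exact Polynomial.root_mul_left_of_isRoot _ hq)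
    have heval : ∀ w, Q.eval w = (w - p) * Q₁.eval w := fun w => by rw [hQ₁]; simp
    have hside := hroots p hp
    -- A root outside the strip is harmless: its factor is absorbed into the holomorphic numerator.
    by_cases hpL : p ∈ openStrip L
    swap
    · have hne : ∀ w ∈ openStrip L, w - p ≠ 0 := by
        intro w hw h0
        rw [sub_eq_zero] at h0
        exact hpL (h0 ▸ hw)
      have e : (fun w => g w / Q.eval w) = fun w => (g w / (w - p)) / Q₁.eval w := by
        ext w
        rw [heval, div_div]
      rw [e] at hd ⊢
      exact ih (hg.div (differentiableOn_id.sub_const p) hne) hQ₁0 hroots₁ hd hdeg₁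
    -- the principal part to be subtracted
    obtain ⟨k, Q₂, hk, hQ₂⟩ : ∃ (k : ℕ) (Q₂ : Polynomial ℂ),
        (∀ w, Q.eval w = (w - p) ^ (k + 1) * Q₂.eval w) ∧ Q₂.eval p ≠ 0 := by
      obtain ⟨Q₂, h1, h2⟩ := Polynomial.exists_eq_pow_rootMultiplicity_mul_and_not_dvd Q hQ p
      have hpos := (Polynomial.rootMultiplicity_pos hQ).2 hp
      refine ⟨Q.rootMultiplicity p - 1, Q₂, fun w => ?_, fun h => h2 ?_⟩
      · rw [Nat.sub_add_cancel hpos]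
        conv_lhs => rw [h1]
        simp
      · exact Polynomial.dvd_iff_isRoot.2 h
    -- For a pole of order at least two, κ = 1 works. The function 1/(w - p) alone neither
    -- integrates to zero nor decays quadratically, so for a simple pole κ = (p - q)/(w - q), with q
    -- outside the strip and joined to p off both contours; the integrals are then differences of
    -- equal winding numbers.
    obtain ⟨κ, hκp, hκd, hκ0, hκq⟩ : ∃ κ : ℂ → ℂ, κ p = 1 ∧ DifferentiableOn ℂ κ (openStrip L) ∧
        (contourIntegral γ (fun w => κ w * (w - p)⁻¹ ^ (k + 1)) = 0 ∧
          contourIntegral γ' (fun w => κ w * (w - p)⁻¹ ^ (k + 1)) = 0) ∧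
        QuadDecay L (fun w => κ w * (w - p)⁻¹ ^ (k + 1)) := by
      rcases Nat.eq_zero_or_pos k with rfl | hkpos
      · obtain ⟨q, hqL, hj, hj'⟩ : ∃ q : ℂ, q ∉ openStrip L ∧ JoinedIn (range γ)ᶜ p q ∧
            JoinedIn (range γ')ᶜ p q := by
          have hL0 : 0 ≤ L := (abs_nonneg _).trans (hL 0).le
          rcases hside with h | h
          -- Height L is just outside the open strip yet above both contours; height -L serves in
          -- the other case.
          · refine ⟨⟨0, L⟩, by simp [openStrip, abs_of_nonneg hL0], h.1.joinedIn fun t => ?_,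
              h.2.joinedIn fun t => ?_⟩
            · exact (le_abs_self _).trans_lt (hL t)
            · exact (le_abs_self _).trans_lt (hL' t)
          · refine ⟨⟨0, -L⟩, by simp [openStrip, abs_of_nonneg hL0], h.1.joinedIn fun t => ?_,
              h.2.joinedIn fun t => ?_⟩
            · exact (abs_lt.1 (hL t)).1
            · exact (abs_lt.1 (hL' t)).1
        have hpq : p - q ≠ 0 := fun h => hqL (sub_eq_zero.1 h ▸ hpL)
        have e : (fun w => (p - q) * (w - q)⁻¹ * (w - p)⁻¹ ^ (0 + 1)) =
            fun w => (p - q) * ((w - p)⁻¹ * (w - q)⁻¹) := by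
          ext w; ring
        refine ⟨fun w => (p - q) * (w - q)⁻¹, mul_inv_cancel₀ hpq, ?_, ?_, ?_⟩
        · refine DifferentiableOn.const_mul (DifferentiableOn.inv
            (differentiableOn_id.sub_const q) fun w hw h => hqL (sub_eq_zero.1 h ▸ hw)) _
        · rw [e]
          exact ⟨hγ.contourIntegral_of_joinedIn hj, hγ'.contourIntegral_of_joinedIn hj'⟩
        · rw [e]
          exact (quadDecay_inv_mul_inv L p q).const_mul _
      · obtain ⟨j, rfl⟩ := Nat.exists_eq_add_of_lt hkpos
        refine ⟨fun _ => 1, rfl, differentiableOn_const _, ?_, ?_⟩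
        · simp only [one_mul]
          rw [show 0 + j + 1 + 1 = j + 2 by ring]
          exact ⟨hγ.contourIntegral_inv_pow hside.notMem_range.1 j,
            hγ'.contourIntegral_inv_pow hside.notMem_range.2 j⟩
        · simp only [one_mul]
          rw [show 0 + j + 1 + 1 = j + 2 by ring]
          exact quadDecay_inv_pow L p j
    -- This c makes h vanish at p, so that h(w)/(w - p) extends holomorphically as `dslope h p`.
    set c : ℂ := g p / Q₂.eval p with hc
    set h : ℂ → ℂ := fun w => g w - c * (Q₂.eval w * κ w) with hh
    have hhp : h p = 0 := by
      simp only [hh, hκp, hc]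
      field_simp
      ring
    have hhd : DifferentiableOn ℂ h (openStrip L) :=
      hg.sub ((Q₂.differentiable.differentiableOn.mul hκd).const_mul c)
    have hnhds : openStrip L ∈ 𝓝 p := (isOpen_openStrip L).mem_nhds hpL
    have hg₁ : DifferentiableOn ℂ (dslope h p) (openStrip L) :=
      (Complex.differentiableOn_dslope hnhds).2 hhd
    have hslope : ∀ w, (w - p) * dslope h p w = h w := fun w => by
      simpa using sub_smul_dslope_of_zero hhp w
    have hsplit : ∀ w, Q.eval w ≠ 0 →
        g w / Q.eval w = dslope h p w / Q₁.eval w + c * (κ w * (w - p)⁻¹ ^ (k + 1)) := by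
      intro w hw
      have hwp : w - p ≠ 0 := by
        intro h0
        rw [heval, h0, zero_mul] at hw
        exact hw rfl
      have hw1 : Q₁.eval w ≠ 0 := by
        intro h0
        rw [heval, h0, mul_zero] at hw
        exact hw rfl
      have hw2 : Q₂.eval w ≠ 0 := by
        intro h0
        rw [hk, h0, mul_zero] at hw
        exact hw rfl
      have e1 : dslope h p w / Q₁.eval w = h w / Q.eval w := by
        rw [heval, ← hslope w, mul_div_mul_left _ _ hwp]
      rw [e1, hk w, inv_pow]
      simp only [hh]
      field_simp
      ring
    have hcontQ : ∀ δ : ℝ → ℂ, (∀ t, |(δ t).im| < L) → ∀ (P : Polynomial ℂ) (g : ℂ → ℂ),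
        DifferentiableOn ℂ g (openStrip L) → (∀ t, P.eval (δ t) ≠ 0) →
        ContinuousOn (fun w => g w / P.eval w) (range δ) := by
      rintro δ hδ P g hg hP _ ⟨t, rfl⟩
      have := (hg.continuousOn.continuousAt ((isOpen_openStrip L).mem_nhds (hδ t)))
      exact (this.div P.continuous.continuousAt (hP t)).continuousWithinAt
    -- The decomposition holds away from the roots of Q. Their real parts are bounded, and only
    -- large |Re w| matters.
    have hd₁ : QuadDecay L fun w => dslope h p w / Q₁.eval w := by
      obtain ⟨R, C, hC⟩ := hd.add (hκq.const_mul (-c))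
      obtain ⟨R', hR'⟩ := (Q.roots.toFinset.image fun z => |z.re|).bddAbove
      refine ⟨max R (R' + 1), C, fun w hw hr => ?_⟩
      have hwQ : Q.eval w ≠ 0 := by
        intro h0
        have : |w.re| ≤ R' := hR' (by
          rw [Finset.mem_coe, Finset.mem_image]
          exact ⟨w, by simpa [hQ] using h0, rfl⟩)
        linarith [(le_max_right R (R' + 1)).trans hr]
      have := hC w hw ((le_max_left _ _).trans hr)
      beta_reduce at this
      rw [hsplit w hwQ] at this
      simpa using this
    have hmain : ∀ δ : ℝ → ℂ, IsStripContour δ → (∀ t, |(δ t).im| < L) →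
        (∀ q, Q.IsRoot q → q ∉ range δ) →
        contourIntegral δ (fun w => κ w * (w - p)⁻¹ ^ (k + 1)) = 0 →
        contourIntegral δ (fun w => g w / Q.eval w) =
          contourIntegral δ fun w => dslope h p w / Q₁.eval w := by
      intro δ hδ hδL hδQ hδ0
      have hQδ : ∀ t, Q.eval (δ t) ≠ 0 := fun t h0 => hδQ _ h0 ⟨t, rfl⟩
      have hQ₁δ : ∀ t, Q₁.eval (δ t) ≠ 0 := fun t h0 => hQδ t (by rw [heval, h0, mul_zero])
      have hpδ : ∀ t, δ t - p ≠ 0 := fun t h0 => hQδ t (by rw [heval, h0, zero_mul])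
      rw [contourIntegral_congr (g := fun w => dslope h p w / Q₁.eval w +
        c * (κ w * (w - p)⁻¹ ^ (k + 1))) (fun t => hsplit (δ t) (hQδ t)), contourIntegral_add,
        contourIntegral_const_mul, hδ0, mul_zero, add_zero]
      · exact hδ.integrable_of_quadDecay hδL (hcontQ δ hδL Q₁ _ hg₁ hQ₁δ) hd₁
      · refine hδ.integrable_of_quadDecay (f := fun w => c * (κ w * (w - p)⁻¹ ^ (k + 1))) hδL ?_
          (hκq.const_mul c)
        rintro _ ⟨t, rfl⟩
        have h1 := hκd.continuousOn.continuousAt ((isOpen_openStrip L).mem_nhds (hδL t))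
        have h2 : ContinuousAt (fun w : ℂ => (w - p)⁻¹ ^ (k + 1)) (δ t) :=
          ((continuousAt_id.sub continuousAt_const).inv₀ (hpδ t)).pow _
        exact (continuousAt_const.mul (h1.mul h2)).continuousWithinAt
    rw [hmain γ hγ hL (fun q hq => (hroots q hq).notMem_range.1) hκ0.1,
      hmain γ' hγ' hL' (fun q hq => (hroots q hq).notMem_range.2) hκ0.2]
    exact ih hg₁ hQ₁0 hroots₁ hd₁ hdeg₁

/-! ### Horizontal lines, translated contours, and the two sides of a contour -/

/-- The horizontal line at height `α`, run through from left to right. -/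
noncomputable def horizontalLine (α : ℝ) (t : ℝ) : ℂ := t + α * Complex.I

theorem horizontalLine_im (α t : ℝ) : (horizontalLine α t).im = α := by simp [horizontalLine]

theorem horizontalLine_re (α t : ℝ) : (horizontalLine α t).re = t := by simp [horizontalLine]

theorem hasDerivAt_horizontalLine (α t : ℝ) : HasDerivAt (horizontalLine α) 1 t :=
  Complex.ofRealCLM.hasDerivAt.add_const _

theorem isStripContour_horizontalLine (α : ℝ) : IsStripContour (horizontalLine α) where
  lipschitz := ⟨1, LipschitzWith.of_dist_le_mul fun a b => by
    simp [horizontalLine, dist_eq_norm, ← Complex.ofReal_sub]⟩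
  piecewise_contDiff := ⟨∅, by simp, fun t _ =>
    (Complex.ofRealCLM.contDiff.add contDiff_const).contDiffAt⟩
  im_bounded := ⟨|α|, fun t => by rw [horizontalLine_im]⟩
  re_growth := ⟨1, one_pos, 0, by simp [horizontalLine_re], by simp [horizontalLine_re]⟩

theorem contourIntegral_horizontalLine (α : ℝ) (f : ℂ → ℂ) :
    contourIntegral (horizontalLine α) f = ∫ t : ℝ, f (t + α * Complex.I) := by
  simp only [contourIntegral, (hasDerivAt_horizontalLine α _).deriv, mul_one]
  rfl

theorem liesAbove_of_forall_lt {γ : ℝ → ℂ} {p : ℂ} (h : ∀ t, (γ t).im < p.im) : LiesAbove γ p :=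
  ⟨p, h, JoinedIn.refl (by rintro ⟨t, rfl⟩; exact lt_irrefl _ (h t))⟩

theorem liesBelow_of_forall_lt {γ : ℝ → ℂ} {p : ℂ} (h : ∀ t, p.im < (γ t).im) : LiesBelow γ p :=
  ⟨p, h, JoinedIn.refl (by rintro ⟨t, rfl⟩; exact lt_irrefl _ (h t))⟩

theorem joinedIn_compl_range_add {γ : ℝ → ℂ} {p q : ℂ} (c : ℂ) (h : JoinedIn (range γ)ᶜ p q) :
    JoinedIn (range fun t => γ t + c)ᶜ (p + c) (q + c) := by
  refine (h.map (continuous_add_const c)).mono ?_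
  rintro _ ⟨z, hz, rfl⟩ ⟨t, ht⟩
  exact hz ⟨t, add_right_cancel ht⟩

theorem LiesAbove.add_const {γ : ℝ → ℂ} {p : ℂ} (h : LiesAbove γ p) (c : ℂ) :
    LiesAbove (fun t => γ t + c) (p + c) :=
  let ⟨q, hq, hj⟩ := h
  ⟨q + c, fun t => by simpa using hq t, joinedIn_compl_range_add c hj⟩

theorem LiesBelow.add_const {γ : ℝ → ℂ} {p : ℂ} (h : LiesBelow γ p) (c : ℂ) :
    LiesBelow (fun t => γ t + c) (p + c) :=
  let ⟨q, hq, hj⟩ := h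
  ⟨q + c, fun t => by simpa using hq t, joinedIn_compl_range_add c hj⟩

theorem IsStripContour.add_const {γ : ℝ → ℂ} (hγ : IsStripContour γ) (c : ℂ) :
    IsStripContour fun t => γ t + c where
  lipschitz := by
    obtain ⟨K, hK⟩ := hγ.lipschitz
    exact ⟨K, LipschitzWith.of_dist_le_mul fun a b => by simpa using hK.dist_le_mul a b⟩
  piecewise_contDiff := by
    obtain ⟨S, hS, hd⟩ := hγ.piecewise_contDiff
    exact ⟨S, hS, fun t ht => (hd t ht).add contDiffAt_const⟩
  im_bounded := by
    obtain ⟨M, hM⟩ := hγ.im_bounded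
    refine ⟨M + |c.im|, fun t => ?_⟩
    rw [Complex.add_im]
    exact (abs_add_le _ _).trans (by linarith [hM t])
  re_growth := by
    obtain ⟨a, ha, C, h1, h2⟩ := hγ.re_growth
    refine ⟨a, ha, C + |c.re|, fun t ht => ?_, fun t ht => ?_⟩
    · rw [Complex.add_re]
      linarith [h1 t ht, neg_abs_le c.re]
    · rw [Complex.add_re]
      linarith [h2 t ht, le_abs_self c.re]

theorem contourIntegral_add_const (γ : ℝ → ℂ) (c : ℂ) (f : ℂ → ℂ) :
    contourIntegral (fun t => γ t + c) f = contourIntegral γ fun w => f (w + c) := by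
  simp only [contourIntegral, deriv_add_const]

/-- No point lies both above and below a strip contour. -/
theorem LiesAbove.not_liesBelow {γ : ℝ → ℂ} (hγ : IsStripContour γ) {p : ℂ}
    (h : LiesAbove γ p) : ¬ LiesBelow γ p := by
  intro h'
  obtain ⟨L, hL⟩ := hγ.exists_abs_im_lt
  have hL0 : 0 < L := (abs_nonneg _).trans_lt (hL 0)
  -- If p were on both sides, it could be joined to iL and to -iL. Subtracting the two vanishing
  -- winding integrals gives a zero integral for a multiple of 1/((w - q)(w + q)). This function is
  -- holomorphic in the strip, so the contour may be replaced by the real line, where 1/(t² + L²)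
  -- has positive integral.
  set q : ℂ := L * Complex.I with hq
  have hqim : q.im = L := by simp [hq]
  have hj := h.joinedIn (q := q) fun t => by rw [hqim]; exact (abs_lt.1 (hL t)).2
  have hj' := h'.joinedIn (q := -q) fun t => by
    rw [Complex.neg_im, hqim]; exact (abs_lt.1 (hL t)).1
  have e1 := hγ.contourIntegral_of_joinedIn hj
  have e2 := hγ.contourIntegral_of_joinedIn hj'
  have i1 := (hγ.integrable_inv_mul_inv hj.source_mem hj.target_mem).const_mul (p - q)
  have i2 := (hγ.integrable_inv_mul_inv hj'.source_mem hj'.target_mem).const_mul (-(p - -q))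
  have hz : contourIntegral γ (fun w => (-2 * q) * ((w - q)⁻¹ * (w - -q)⁻¹)) = 0 := by
    rw [contourIntegral_congr (g := fun w => (p - q) * ((w - p)⁻¹ * (w - q)⁻¹) +
      -1 * ((p - -q) * ((w - p)⁻¹ * (w - -q)⁻¹))), contourIntegral_add, e1,
      contourIntegral_const_mul, e2]
    · simp
    · simpa only [mul_assoc] using i1
    · simpa only [mul_assoc, neg_mul, one_mul] using i2
    · intro t
      have h1 : γ t - p ≠ 0 := fun h => hj.source_mem ⟨t, sub_eq_zero.1 h⟩
      have h2 : γ t - q ≠ 0 := fun h => hj.target_mem ⟨t, sub_eq_zero.1 h⟩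
      have h3 : γ t - -q ≠ 0 := fun h => hj'.target_mem ⟨t, sub_eq_zero.1 h⟩
      field_simp
      ring
  have hstrip : ∀ w ∈ openStrip L, w - q ≠ 0 ∧ w - -q ≠ 0 := by
    intro w hw
    have hw' := abs_lt.1 (show |w.im| < L from hw)
    constructor
    · intro h
      rw [sub_eq_zero.1 h, hqim] at hw'
      exact lt_irrefl _ hw'.2
    · intro h
      rw [sub_eq_zero.1 h, Complex.neg_im, hqim] at hw'
      exact lt_irrefl _ hw'.1
  have hdiff : DifferentiableOn ℂ (fun w => (-2 * q) * ((w - q)⁻¹ * (w - -q)⁻¹)) (openStrip L) :=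
    (((differentiableOn_id.sub_const q).inv fun w hw => (hstrip w hw).1).mul
      ((differentiableOn_id.sub_const (-q)).inv fun w hw => (hstrip w hw).2)).const_mul _
  have hline := contourIntegral_eq_of_differentiableOn hγ (isStripContour_horizontalLine 0) hL
    (fun t => by rw [horizontalLine_im]; simpa using hL0) hdiff
    ((quadDecay_inv_mul_inv L q (-q)).const_mul _)
  rw [hz, contourIntegral_horizontalLine] at hline
  have hreal : ∀ t : ℝ, (-2 * q) * ((t + (0 : ℝ) * Complex.I - q)⁻¹ * (t + (0 : ℝ) * Complex.I - -q)⁻¹)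
      = (-2 * q) * (((t ^ 2 + L ^ 2)⁻¹ : ℝ) : ℂ) := by
    intro t
    rw [← mul_inv]
    congr 1
    rw [Complex.ofReal_inv]
    congr 1
    push_cast
    rw [hq]
    linear_combination (L : ℂ) ^ 2 * -Complex.I_sq
  simp only [hreal] at hline
  rw [integral_const_mul, integral_complex_ofReal] at hline
  have hpos : 0 < ∫ t : ℝ, (t ^ 2 + L ^ 2)⁻¹ := by
    rw [integral_pos_iff_support_of_nonneg (fun t => by positivity)]
    · have : Function.support (fun t : ℝ => (t ^ 2 + L ^ 2)⁻¹) = univ := by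
        ext t
        simp only [Function.mem_support, mem_univ, iff_true]
        positivity
      rw [this]
      simp
    · have hc := integrable_inv_one_add_sq.comp_div hL0.ne'
      refine (hc.const_mul (L ^ 2)⁻¹).congr (Eventually.of_forall fun t => ?_)
      simp only
      rw [← mul_inv]
      congr 1
      field_simp
      ring
  have hq0 : q ≠ 0 := by
    intro h
    rw [h, Complex.zero_im] at hqim
    exact hL0.ne hqim
  have : (-2 * q) * ((∫ t : ℝ, (t ^ 2 + L ^ 2)⁻¹ : ℝ) : ℂ) ≠ 0 :=
    mul_ne_zero (mul_ne_zero (by norm_num) hq0) (by exact_mod_cast hpos.ne')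
  exact this hline.symm

/-! ### Meromorphic functions with finitely many poles in a strip -/

/-- `f` is the quotient, on the open strip of half-width `L`, of a holomorphic function by a
polynomial with roots in `A`. -/
def MeroStrip (L : ℝ) (A : Set ℂ) (f : ℂ → ℂ) : Prop :=
  ∃ (g : ℂ → ℂ) (Q : Polynomial ℂ), DifferentiableOn ℂ g (openStrip L) ∧ Q ≠ 0 ∧
    (∀ p, Q.IsRoot p → p ∈ A) ∧ ∀ w ∈ openStrip L, Q.eval w ≠ 0 → f w = g w / Q.eval w

theorem MeroStrip.of_differentiable {L : ℝ} {A : Set ℂ} {f : ℂ → ℂ} (hf : Differentiable ℂ f) :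
    MeroStrip L A f :=
  ⟨f, 1, hf.differentiableOn, one_ne_zero, by simp [Polynomial.IsRoot], by simp⟩

theorem MeroStrip.mul {L : ℝ} {A : Set ℂ} {f₁ f₂ : ℂ → ℂ} (h₁ : MeroStrip L A f₁)
    (h₂ : MeroStrip L A f₂) : MeroStrip L A fun w => f₁ w * f₂ w := by
  obtain ⟨g₁, Q₁, hg₁, hQ₁, hr₁, he₁⟩ := h₁
  obtain ⟨g₂, Q₂, hg₂, hQ₂, hr₂, he₂⟩ := h₂
  refine ⟨fun w => g₁ w * g₂ w, Q₁ * Q₂, hg₁.mul hg₂, mul_ne_zero hQ₁ hQ₂, fun p hp => ?_,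
    fun w hw hQ => ?_⟩
  · rcases Polynomial.root_mul.1 hp with h | h
    exacts [hr₁ p h, hr₂ p h]
  · beta_reduce
    rw [Polynomial.eval_mul] at hQ ⊢
    rw [he₁ w hw (left_ne_zero_of_mul hQ), he₂ w hw (right_ne_zero_of_mul hQ), div_mul_div_comm]

theorem MeroStrip.prod {ι : Type*} {L : ℝ} {A : Set ℂ} {f : ι → ℂ → ℂ} (S : Finset ι)
    (h : ∀ i, MeroStrip L A (f i)) : MeroStrip L A fun w => ∏ i ∈ S, f i w := by
  classical
  induction S using Finset.induction_on with
  | empty => simpa using MeroStrip.of_differentiable (differentiable_const (1 : ℂ))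
  | insert a S ha ih =>
    simp only [Finset.prod_insert ha]
    exact (h a).mul ih

/-- Repeated use of Γ(u) = Γ(u + 1)/u moves the argument into the right half-plane in N steps. Only
finitely many poles meet the strip, so a polynomial denominator suffices. -/
theorem MeroStrip.gamma {L : ℝ} {A : Set ℂ} {α β : ℂ} (hα : α ≠ 0) (N : ℕ)
    (hN : ∀ w ∈ openStrip L, -(N : ℝ) < (α * w + β).re)
    (hA : ∀ (m : ℕ) (w : ℂ), α * w + β = -m → w ∈ A) :
    MeroStrip L A fun w => Complex.Gamma (α * w + β) := by
  induction N generalizing β with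
  | zero =>
    refine ⟨fun w => Complex.Gamma (α * w + β), 1, fun w hw => ?_, one_ne_zero,
      by simp [Polynomial.IsRoot], by simp⟩
    have hw' : 0 < (α * w + β).re := by simpa using hN w hw
    have h1 : DifferentiableAt ℂ Complex.Gamma (α * w + β) := by
      refine Complex.differentiableAt_Gamma _ fun m hm => ?_
      rw [hm] at hw'
      simp at hw'
      have : (0 : ℝ) ≤ m := m.cast_nonneg
      linarith
    have h2 : DifferentiableAt ℂ (fun w : ℂ => α * w + β) w :=
      (differentiableAt_id.const_mul α).add_const β
    exact (h1.comp w h2).differentiableWithinAt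
  | succ N ih =>
    obtain ⟨g, Q, hg, hQ, hr, he⟩ := ih (β := β + 1) (fun w hw => by
      have := hN w hw
      rw [← add_assoc, Complex.add_re, Complex.one_re]
      push_cast at this
      linarith) fun m w hm => hA (m + 1) w (by push_cast; linear_combination hm)
    have hlin : (Polynomial.C α * Polynomial.X + Polynomial.C β) ≠ 0 := by
      intro h
      have := congrArg (fun P => Polynomial.coeff P 1) h
      simp [Polynomial.coeff_C] at this
      exact hα this
    refine ⟨g, (Polynomial.C α * Polynomial.X + Polynomial.C β) * Q, hg, mul_ne_zero hlin hQ,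
      fun p hp => ?_, fun w hw hw0 => ?_⟩
    · rcases Polynomial.root_mul.1 hp with h | h
      · refine hA 0 p ?_
        simpa [Polynomial.IsRoot] using h
      · exact hr p h
    · beta_reduce at he ⊢
      rw [Polynomial.eval_mul] at hw0 ⊢
      have h1 : α * w + β ≠ 0 := by simpa using left_ne_zero_of_mul hw0
      have h2 := Complex.Gamma_add_one _ h1
      have h3 := he w hw (right_ne_zero_of_mul hw0)
      rw [← add_assoc, h2] at h3
      have h4 : Polynomial.eval w (Polynomial.C α * Polynomial.X + Polynomial.C β) = α * w + β := by
        simp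
      rw [h4, mul_comm (α * w + β) (Q.eval w), ← div_div, ← h3, mul_div_cancel_left₀ _ h1]

/-- At a root of Q the value of f is unconstrained, so f is traded for g/Q. They agree off A, and
beyond the roots the decay carries over. -/
theorem MeroStrip.exists_quadDecay {L : ℝ} {A : Set ℂ} {f : ℂ → ℂ} (h : MeroStrip L A f)
    (hd : QuadDecay L f) : ∃ (g : ℂ → ℂ) (Q : Polynomial ℂ), DifferentiableOn ℂ g (openStrip L) ∧
      Q ≠ 0 ∧ (∀ p, Q.IsRoot p → p ∈ A) ∧ (∀ w ∈ openStrip L, w ∉ A → f w = g w / Q.eval w) ∧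
      QuadDecay L fun w => g w / Q.eval w := by
  obtain ⟨g, Q, hg, hQ, hr, he⟩ := h
  refine ⟨g, Q, hg, hQ, hr, fun w hw hA => he w hw fun h0 => hA (hr w h0), ?_⟩
  obtain ⟨R, C, hC⟩ := hd
  obtain ⟨R', hR'⟩ := (Q.roots.toFinset.image fun z => |z.re|).bddAbove
  refine ⟨max R (R' + 1), C, fun w hw hr => ?_⟩
  have hwQ : Q.eval w ≠ 0 := by
    intro h0
    have : |w.re| ≤ R' := hR' (by
      rw [Finset.mem_coe, Finset.mem_image]
      exact ⟨w, by simpa [hQ] using h0, rfl⟩)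
    linarith [(le_max_right R (R' + 1)).trans hr]
  beta_reduce
  rw [← he w hw hwQ]
  exact hC w hw ((le_max_left _ _).trans hr)

theorem MeroStrip.integrable {γ : ℝ → ℂ} (hγ : IsStripContour γ) {L : ℝ}
    (hL : ∀ t, |(γ t).im| < L) {f : ℂ → ℂ} (h : MeroStrip L (range γ)ᶜ f) (hd : QuadDecay L f) :
    Integrable fun t => f (γ t) * deriv γ t := by
  obtain ⟨g, Q, hg, hQ, hr, he, hq⟩ := h.exists_quadDecay hd
  have h1 := hγ.integrable_of_quadDecay hL (f := fun w => g w / Q.eval w) (by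
    rintro _ ⟨t, rfl⟩
    exact ((hg.continuousOn.continuousAt ((isOpen_openStrip L).mem_nhds (hL t))).div
      Q.continuous.continuousAt fun h0 => hr _ h0 ⟨t, rfl⟩).continuousWithinAt) hq
  refine h1.congr (Eventually.of_forall fun t => ?_)
  beta_reduce
  rw [he (γ t) (hL t) (fun h => h ⟨t, rfl⟩)]

theorem MeroStrip.contourIntegral_eq {γ γ' : ℝ → ℂ} (hγ : IsStripContour γ)
    (hγ' : IsStripContour γ') {L : ℝ} (hL : ∀ t, |(γ t).im| < L) (hL' : ∀ t, |(γ' t).im| < L)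
    {f : ℂ → ℂ} (h : MeroStrip L {p | SameSide γ γ' p} f) (hd : QuadDecay L f) :
    contourIntegral γ f = contourIntegral γ' f := by
  obtain ⟨g, Q, hg, hQ, hr, he, hq⟩ := h.exists_quadDecay hd
  have := contourIntegral_eq_of_sameSide hγ hγ' hL hL' hg hQ hr hq
  rw [contourIntegral_congr (f := f) (g := fun w => g w / Q.eval w) fun t =>
      he (γ t) (hL t) fun h => h.notMem_range.1 ⟨t, rfl⟩,
    contourIntegral_congr (f := f) (g := fun w => g w / Q.eval w) fun t =>
      he (γ' t) (hL' t) fun h => h.notMem_range.2 ⟨t, rfl⟩]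
  exact this

/-! ### Exponential decay of Γ on vertical strips -/

theorem norm_betaIntegral_le {u v : ℂ} (hu : 0 < u.re) (hv : 0 < v.re) :
    ‖Complex.betaIntegral u v‖ ≤ ‖Complex.betaIntegral u.re v.re‖ := by
  have h1 : ∀ (a b : ℂ) (x : ℝ), x ∈ Ioc (0 : ℝ) 1 → a.re ≠ 0 → b.re ≠ 0 →
      ‖(x : ℂ) ^ (a - 1) * (1 - x : ℂ) ^ (b - 1)‖ = x ^ (a.re - 1) * (1 - x) ^ (b.re - 1) ∨
        x = 1 := by
    intro a b x hx _ _
    rcases eq_or_lt_of_le hx.2 with h | h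
    · exact Or.inr h
    · left
      rw [norm_mul, Complex.norm_cpow_eq_rpow_re_of_pos hx.1,
        show (1 - x : ℂ) = ((1 - x : ℝ) : ℂ) by push_cast; ring,
        Complex.norm_cpow_eq_rpow_re_of_pos (by linarith)]
      simp
  have hInt := Complex.betaIntegral_convergent (u := (u.re : ℂ)) (v := (v.re : ℂ))
    (by simpa using hu) (by simpa using hv)
  have hreal : Complex.betaIntegral u.re v.re =
      ((∫ x in (0 : ℝ)..1, x ^ (u.re - 1) * (1 - x) ^ (v.re - 1) : ℝ) : ℂ) := by
    rw [Complex.betaIntegral, ← intervalIntegral.integral_ofReal]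
    refine intervalIntegral.integral_congr fun x hx => ?_
    rw [uIcc_of_le zero_le_one] at hx
    rw [Complex.ofReal_mul, Complex.ofReal_cpow hx.1, Complex.ofReal_cpow (by linarith [hx.2])]
    push_cast
    rfl
  have hnn : 0 ≤ ∫ x in (0 : ℝ)..1, x ^ (u.re - 1) * (1 - x) ^ (v.re - 1) := by
    refine intervalIntegral.integral_nonneg zero_le_one fun x hx => ?_
    exact mul_nonneg (Real.rpow_nonneg hx.1 _) (Real.rpow_nonneg (by linarith [hx.2]) _)
  rw [hreal, Complex.norm_real, Real.norm_of_nonneg hnn]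
  -- At x = 1 the base 1 - x is 0 and the formula for the norm of a complex power can fail; one
  -- point is negligible.
  have hne : ∀ᵐ x : ℝ, x ≠ 1 := by
    simp [ae_iff]
  refine intervalIntegral.norm_integral_le_of_norm_le zero_le_one ?_ ?_
  · filter_upwards [hne] with x hx1 hx
    rcases h1 u v x hx hu.ne' hv.ne' with h | h
    · exact h.le
    · exact absurd h hx1
  · refine hInt.norm.congr_ae ?_
    rw [uIoc_of_le zero_le_one]
    refine (ae_restrict_iff' measurableSet_Ioc).2 ?_
    filter_upwards [hne] with x hx1 hx
    rcases h1 u.re v.re x hx (by simpa using hu.ne') (by simpa using hv.ne') with h | h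
    · simpa using h
    · exact absurd h hx1

/-- From Γ(z)Γ(M - Re z) = Γ(M + i Im z) B(z, M - Re z): the beta integral is at most its value at
Re z, which the same identity evaluates. This transfers a bound on one vertical line to everything
on its left with Re z > 0. -/
theorem norm_Gamma_le_of_lt {z : ℂ} {M : ℝ} (hz : 0 < z.re) (hM : z.re < M) :
    ‖Complex.Gamma z‖ ≤ Real.Gamma z.re / Real.Gamma M * ‖Complex.Gamma (M + z.im * Complex.I)‖ := by
  have ht : 0 < M - z.re := by linarith
  have e1 := Complex.Gamma_mul_Gamma_eq_betaIntegral (s := z) (t := ((M - z.re : ℝ) : ℂ)) hz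
    (by simpa using ht)
  have e2 := Complex.Gamma_mul_Gamma_eq_betaIntegral (s := (z.re : ℂ)) (t := ((M - z.re : ℝ) : ℂ))
    (by simpa using hz) (by simpa using ht)
  have e3 : z + ((M - z.re : ℝ) : ℂ) = M + z.im * Complex.I := by
    push_cast
    linear_combination (-1 : ℂ) * Complex.re_add_im z
  have e4 : (z.re : ℂ) + ((M - z.re : ℝ) : ℂ) = (M : ℝ) := by
    push_cast
    ring
  have hb := norm_betaIntegral_le (u := z) (v := ((M - z.re : ℝ) : ℂ)) hz (by simpa using ht)
  rw [Complex.ofReal_re] at hb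
  rw [e3] at e1
  rw [e4, Complex.Gamma_ofReal, Complex.Gamma_ofReal, Complex.Gamma_ofReal] at e2
  have hG1 := Real.Gamma_pos_of_pos ht
  have hG2 := Real.Gamma_pos_of_pos hz
  have hG3 := Real.Gamma_pos_of_pos (hz.trans hM)
  have n1 := congrArg norm e1
  have n2 := congrArg norm e2
  rw [norm_mul, norm_mul, Complex.Gamma_ofReal, Complex.norm_real, Real.norm_of_nonneg hG1.le] at n1
  rw [norm_mul, norm_mul, Complex.norm_real, Complex.norm_real, Complex.norm_real,
    Real.norm_of_nonneg hG1.le, Real.norm_of_nonneg hG2.le, Real.norm_of_nonneg hG3.le] at n2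
  have h5 : ‖Complex.Gamma z‖ * Real.Gamma (M - z.re) * Real.Gamma M ≤
      ‖Complex.Gamma (M + z.im * Complex.I)‖ * (Real.Gamma z.re * Real.Gamma (M - z.re)) := by
    rw [n1, n2, mul_assoc, mul_comm _ (Real.Gamma M)]
    gcongr
  rw [div_mul_eq_mul_div, le_div_iff₀ hG3]
  refine le_of_mul_le_mul_right ?_ hG1
  calc _ = ‖Complex.Gamma z‖ * Real.Gamma (M - z.re) * Real.Gamma M := by ring
    _ ≤ _ := h5
    _ = _ := by ring

/-- On the line Re z = 1/2 the point 1 - z is the conjugate of z, so reflection gives |Γ|² = π /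
cosh(πτ) exactly. -/
theorem norm_Gamma_half_add_I_le (τ : ℝ) :
    ‖Complex.Gamma (1 / 2 + τ * Complex.I)‖ ≤
      √(2 * Real.pi) * Real.exp (-(Real.pi / 2) * |τ|) := by
  have h1 := Complex.Gamma_mul_Gamma_one_sub (1 / 2 + τ * Complex.I)
  have h2 : (1 - (1 / 2 + τ * Complex.I) : ℂ) = (starRingEnd ℂ) (1 / 2 + τ * Complex.I) := by
    simp only [map_add, map_mul, Complex.conj_ofReal, Complex.conj_I, map_div₀, map_one, map_ofNat]
    ring
  have h3 : Complex.sin (Real.pi * (1 / 2 + τ * Complex.I)) = (Real.cosh (Real.pi * τ) : ℝ) := by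
    rw [show (Real.pi * (1 / 2 + τ * Complex.I) : ℂ) =
      (Real.pi * τ : ℝ) * Complex.I + Real.pi / 2 by push_cast; ring, Complex.sin_add_pi_div_two,
      Complex.cos_mul_I, Complex.ofReal_cosh]
  rw [h2, Complex.Gamma_conj, Complex.mul_conj, h3] at h1
  have h4 : Complex.normSq (Complex.Gamma (1 / 2 + τ * Complex.I)) =
      Real.pi / Real.cosh (Real.pi * τ) := by
    exact_mod_cast h1
  rw [Complex.normSq_eq_norm_sq] at h4
  refine le_of_sq_le_sq ?_ (by positivity)
  rw [h4, mul_pow, Real.sq_sqrt (by positivity), ← Real.exp_nat_mul, ← Real.cosh_abs, abs_mul,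
    abs_of_pos Real.pi_pos, Real.cosh_eq]
  have h5 : Real.pi / ((Real.exp (Real.pi * |τ|) + Real.exp (-(Real.pi * |τ|))) / 2) ≤
      Real.pi / (Real.exp (Real.pi * |τ|) / 2) := by
    gcongr
    linarith [Real.exp_pos (-(Real.pi * |τ|))]
  refine h5.trans (le_of_eq ?_)
  rw [show ((2 : ℕ) : ℝ) * (-(Real.pi / 2) * |τ|) = -(Real.pi * |τ|) by push_cast; ring,
    Real.exp_neg]
  field_simp

theorem exists_norm_Gamma_half_add_nat_le (N : ℕ) : ∃ C : ℝ, 0 ≤ C ∧ ∀ τ : ℝ,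
    ‖Complex.Gamma ((N + 1 / 2 : ℝ) + τ * Complex.I)‖ ≤
      C * (1 + |τ|) ^ N * Real.exp (-(Real.pi / 2) * |τ|) := by
  induction N with
  | zero =>
    refine ⟨√(2 * Real.pi), by positivity, fun τ => ?_⟩
    simpa using norm_Gamma_half_add_I_le τ
  | succ N ih =>
    obtain ⟨C, hC, h⟩ := ih
    refine ⟨(N + 1) * C, by positivity, fun τ => ?_⟩
    set u : ℂ := (N + 1 / 2 : ℝ) + τ * Complex.I with hu
    have hre : u.re = N + 1 / 2 := by simp [hu]
    have hpos : (0 : ℝ) < N + 1 / 2 := by positivity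
    have hu0 : u ≠ 0 := by
      intro h0
      rw [h0, Complex.zero_re] at hre
      linarith
    have e : (((N + 1 : ℕ) + 1 / 2 : ℝ) : ℂ) + τ * Complex.I = u + 1 := by
      rw [hu]; push_cast; ring
    rw [e, Complex.Gamma_add_one u hu0, norm_mul]
    have hn : ‖u‖ ≤ (N + 1) * (1 + |τ|) := by
      refine (norm_add_le _ _).trans ?_
      rw [norm_mul, Complex.norm_I, mul_one, Complex.norm_real, Complex.norm_real,
        Real.norm_of_nonneg hpos.le, Real.norm_eq_abs]
      nlinarith [abs_nonneg τ, mul_nonneg (N.cast_nonneg : (0 : ℝ) ≤ N) (abs_nonneg τ)]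
    calc ‖u‖ * ‖Complex.Gamma u‖ ≤ ((N + 1) * (1 + |τ|)) *
          (C * (1 + |τ|) ^ N * Real.exp (-(Real.pi / 2) * |τ|)) := by
          gcongr
          exact h τ
      _ = _ := by ring

/-- Exponential decay of the Gamma function on vertical strips in the right half-plane. -/
theorem exists_norm_Gamma_le_of_pos {a b : ℝ} (ha : 0 < a) : ∃ (C : ℝ) (N : ℕ), 0 ≤ C ∧ ∀ z : ℂ,
    a ≤ z.re → z.re ≤ b →
      ‖Complex.Gamma z‖ ≤ C * (1 + |z.im|) ^ N * Real.exp (-(Real.pi / 2) * |z.im|) := by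
  obtain ⟨N, hN⟩ := exists_nat_gt b
  obtain ⟨C, hC, h⟩ := exists_norm_Gamma_half_add_nat_le N
  have hcont : ContinuousOn Real.Gamma (Icc a b) := fun x hx =>
    (Real.differentiableOn_Gamma_Ioi.continuousOn.mono
      (fun x hx => ha.trans_le hx.1)) x hx
  obtain ⟨K, hK⟩ := isCompact_Icc.exists_bound_of_continuousOn hcont
  have hM : (0 : ℝ) < N + 1 / 2 := by positivity
  refine ⟨|K| / Real.Gamma (N + 1 / 2) * C, N,
    by have := Real.Gamma_pos_of_pos hM; positivity, fun z h1 h2 => ?_⟩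
  refine (norm_Gamma_le_of_lt (M := N + 1 / 2) (ha.trans_le h1) (by linarith)).trans ?_
  have hG := Real.Gamma_pos_of_pos hM
  have hKz := hK z.re ⟨h1, h2⟩
  rw [Real.norm_of_nonneg (Real.Gamma_pos_of_pos (ha.trans_le h1)).le] at hKz
  have := h z.im
  calc _ ≤ |K| / Real.Gamma (N + 1 / 2) *
        (C * (1 + |z.im|) ^ N * Real.exp (-(Real.pi / 2) * |z.im|)) := by
        gcongr
        exact hKz.trans (le_abs_self K)
    _ = _ := by ring

/-- Γ(z) = Γ(z + 1)/z extends the bound to the left. Since |z| ≥ |Im z| ≥ 1, the division costs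
nothing and the poles are avoided. -/
theorem exists_norm_Gamma_le (a b : ℝ) : ∃ (C : ℝ) (N : ℕ), 0 ≤ C ∧ ∀ z : ℂ,
    a ≤ z.re → z.re ≤ b → 1 ≤ |z.im| →
      ‖Complex.Gamma z‖ ≤ C * (1 + |z.im|) ^ N * Real.exp (-(Real.pi / 2) * |z.im|) := by
  obtain ⟨k, hk⟩ := exists_nat_gt (-a)
  induction k generalizing a b with
  | zero =>
    obtain ⟨C, N, hC, h⟩ := exists_norm_Gamma_le_of_pos (a := a) (b := b) (by simpa using hk)
    exact ⟨C, N, hC, fun z h1 h2 _ => h z h1 h2⟩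
  | succ k ih =>
    obtain ⟨C, N, hC, h⟩ := ih (a + 1) (b + 1) (by push_cast at hk; linarith)
    refine ⟨C, N, hC, fun z h1 h2 h3 => ?_⟩
    have hz : 1 ≤ ‖z‖ := h3.trans (Complex.abs_im_le_norm z)
    have hz0 : z ≠ 0 := by
      rintro rfl
      simp at hz
      linarith
    have h4 := h (z + 1) (by simpa using h1) (by simpa using h2) (by simpa using h3)
    rw [Complex.Gamma_add_one z hz0, norm_mul] at h4
    simp only [Complex.add_im, Complex.one_im, add_zero] at h4
    exact (le_mul_of_one_le_left (norm_nonneg _) hz).trans h4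

/-! ### Calculus of growth rates on vertical strips -/

/-- On the vertical strip `|Re z| < a` and far from the real axis, `F` is bounded by
`exp (α |Im z|)` up to a polynomial factor. -/
def VertGrowth (a α : ℝ) (F : ℂ → ℂ) : Prop :=
  ∃ (R C : ℝ) (N : ℕ), ∀ z : ℂ, |z.re| < a → R ≤ |z.im| →
    ‖F z‖ ≤ C * (1 + |z.im|) ^ N * Real.exp (α * |z.im|)

namespace VertGrowth

variable {a α β : ℝ} {F G : ℂ → ℂ}

theorem mul (hF : VertGrowth a α F) (hG : VertGrowth a β G) :
    VertGrowth a (α + β) fun z => F z * G z := by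
  obtain ⟨R, C, N, h⟩ := hF
  obtain ⟨R', C', N', h'⟩ := hG
  refine ⟨max R R', C * C', N + N', fun z hz hR => ?_⟩
  have h1 := h z hz ((le_max_left _ _).trans hR)
  have h2 := h' z hz ((le_max_right _ _).trans hR)
  rw [norm_mul]
  refine (mul_le_mul h1 h2 (norm_nonneg _) ((norm_nonneg _).trans h1)).trans (le_of_eq ?_)
  rw [pow_add, add_mul, Real.exp_add]
  ring

theorem mono (hF : VertGrowth a α F) (h : α ≤ β) : VertGrowth a β F := by
  obtain ⟨R, C, N, hC⟩ := hF
  refine ⟨R, |C|, N, fun z hz hR => (hC z hz hR).trans ?_⟩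
  gcongr
  exact le_abs_self C

theorem add (hF : VertGrowth a α F) (hG : VertGrowth a α G) :
    VertGrowth a α fun z => F z + G z := by
  obtain ⟨R, C, N, h⟩ := hF
  obtain ⟨R', C', N', h'⟩ := hG
  refine ⟨max R R', |C| + |C'|, N + N', fun z hz hR => ?_⟩
  refine (norm_add_le _ _).trans ((add_le_add (h z hz ((le_max_left _ _).trans hR))
    (h' z hz ((le_max_right _ _).trans hR))).trans ?_)
  have h1 : (1 : ℝ) ≤ 1 + |z.im| := by linarith [abs_nonneg z.im]
  rw [add_mul, add_mul]
  have h2 : C * (1 + |z.im|) ^ N ≤ |C| * (1 + |z.im|) ^ (N + N') := by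
    gcongr
    · exact le_abs_self C
    · omega
  have h3 : C' * (1 + |z.im|) ^ N' ≤ |C'| * (1 + |z.im|) ^ (N + N') := by
    gcongr
    · exact le_abs_self C'
    · omega
  gcongr

theorem const (a : ℝ) (c : ℂ) : VertGrowth a 0 fun _ => c :=
  ⟨0, ‖c‖, 0, fun z _ _ => by simp⟩

theorem id (a : ℝ) : VertGrowth a 0 fun z => z := by
  refine ⟨0, 1 + |a|, 1, fun z hz _ => ?_⟩
  rw [zero_mul, Real.exp_zero, mul_one, pow_one]
  have := Complex.norm_le_abs_re_add_abs_im z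
  have h1 := le_abs_self a
  nlinarith [abs_nonneg z.im, abs_nonneg a, mul_nonneg (abs_nonneg a) (abs_nonneg z.im)]

theorem prod {ι : Type*} {F : ι → ℂ → ℂ} (S : Finset ι) (h : ∀ i, VertGrowth a α (F i)) :
    VertGrowth a (S.card * α) fun z => ∏ i ∈ S, F i z := by
  classical
  induction S using Finset.induction_on with
  | empty => simpa using const a 1
  | insert i S hi ih =>
    simp only [Finset.prod_insert hi, Finset.card_insert_of_notMem hi]
    convert! (h i).mul ih using 1
    push_cast
    ring

theorem polynomial (a : ℝ) (p : Polynomial ℂ) : VertGrowth a 0 fun z => p.eval z := by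
  induction p using Polynomial.induction_on' with
  | add p q hp hq => simpa using hp.add hq
  | monomial n c =>
    have h1 : VertGrowth a 0 fun z => ∏ _i ∈ Finset.range n, z := by
      simpa using prod (Finset.range n) fun _ => id a
    simpa using (const a c).mul h1

theorem exp_real (a s : ℝ) : VertGrowth a 0 fun z => Complex.exp (s * z) := by
  refine ⟨0, Real.exp (|s| * |a|), 0, fun z hz _ => ?_⟩
  rw [Complex.norm_exp, Complex.re_ofReal_mul]
  simp only [pow_zero, zero_mul, Real.exp_zero, mul_one]
  refine Real.exp_le_exp.2 ((le_abs_self _).trans ?_)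
  rw [abs_mul]
  exact mul_le_mul_of_nonneg_left (hz.le.trans (le_abs_self a)) (abs_nonneg s)

theorem exp_I (a m : ℝ) : VertGrowth a |m| fun z => Complex.exp (Complex.I * m * z) := by
  refine ⟨0, 1, 0, fun z _ _ => ?_⟩
  rw [Complex.norm_exp]
  have : (Complex.I * m * z).re = -(m * z.im) := by simp
  rw [this, pow_zero, one_mul, one_mul, ← abs_mul]
  exact Real.exp_le_exp.2 (neg_le_abs _)

/-- A translation changes |Im z| by at most |Im c|, which only affects the constant. The sign ε
covers both Γ(z + c) and Γ(c - z). -/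
theorem of_affine {α : ℝ} (ε : ℝ) (hε : |ε| = 1) (c : ℂ) {C : ℝ} {N : ℕ} {H : ℂ → ℂ}
    (hC : 0 ≤ C) (h : ∀ z : ℂ, -(|c.re| + a) ≤ z.re → z.re ≤ |c.re| + a → 1 ≤ |z.im| →
      ‖H z‖ ≤ C * (1 + |z.im|) ^ N * Real.exp (α * |z.im|)) :
    VertGrowth a α fun z => H (ε * z + c) := by
  refine ⟨1 + |c.im|, C * (1 + |c.im|) ^ N * Real.exp (|α| * |c.im|), N, fun z hz hR => ?_⟩
  have him : (ε * z + c).im = ε * z.im + c.im := by simp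
  have hre : (ε * z + c).re = ε * z.re + c.re := by simp
  have e1 : |ε * z.re| < a := by rwa [abs_mul, hε, one_mul]
  have e2 : |ε * z.im| = |z.im| := by rw [abs_mul, hε, one_mul]
  have hup : |(ε * z + c).im| ≤ |z.im| + |c.im| := by
    rw [him, ← e2]
    exact abs_add_le _ _
  have hlow : |z.im| - |c.im| ≤ |(ε * z + c).im| := by
    rw [him, ← e2]
    have := abs_sub_abs_le_abs_sub (ε * z.im) (-c.im)
    rw [abs_neg, sub_neg_eq_add] at this
    exact this
  have h1 := h (ε * z + c) (by
      rw [hre]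
      linarith [(abs_lt.1 e1).1, neg_abs_le c.re]) (by
      rw [hre]
      linarith [(abs_lt.1 e1).2, le_abs_self c.re]) (by linarith)
  refine h1.trans ?_
  have h2 : (1 + |(ε * z + c).im|) ^ N ≤ (1 + |c.im|) ^ N * (1 + |z.im|) ^ N := by
    rw [← mul_pow]
    refine pow_le_pow_left₀ (by positivity) ?_ N
    nlinarith [mul_nonneg (abs_nonneg c.im) (abs_nonneg z.im)]
  have h3 : Real.exp (α * |(ε * z + c).im|) ≤ Real.exp (|α| * |c.im|) * Real.exp (α * |z.im|) := by
    rw [← Real.exp_add]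
    refine Real.exp_le_exp.2 ?_
    have h4 : α * (|(ε * z + c).im| - |z.im|) ≤ |α| * |c.im| := by
      refine (le_abs_self _).trans ?_
      rw [abs_mul]
      refine mul_le_mul_of_nonneg_left ?_ (abs_nonneg α)
      rw [abs_le]
      constructor <;> linarith
    linarith
  calc _ ≤ C * ((1 + |c.im|) ^ N * (1 + |z.im|) ^ N) *
        (Real.exp (|α| * |c.im|) * Real.exp (α * |z.im|)) := by gcongr
    _ = _ := by ring

theorem gamma_add (a : ℝ) (c : ℂ) :
    VertGrowth a (-(Real.pi / 2)) fun z => Complex.Gamma (z + c) := by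
  obtain ⟨C, N, hC, h⟩ := exists_norm_Gamma_le (-(|c.re| + a)) (|c.re| + a)
  simpa using of_affine (a := a) 1 (by simp) c hC h

theorem gamma_sub (a : ℝ) (c : ℂ) :
    VertGrowth a (-(Real.pi / 2)) fun z => Complex.Gamma (c - z) := by
  obtain ⟨C, N, hC, h⟩ := exists_norm_Gamma_le (-(|c.re| + a)) (|c.re| + a)
  have := of_affine (a := a) (-1) (by simp) c hC h
  convert! this using 3
  push_cast
  ring

/-- By reflection 1/Γ(z) = Γ(1 - z) sin(πz)/π, with exponential rate -π/2 + π = π/2. -/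
theorem inv_gamma_add (a : ℝ) (c : ℂ) :
    VertGrowth a (Real.pi / 2) fun z => (Complex.Gamma (z + c))⁻¹ := by
  obtain ⟨C, N, hC, h⟩ := exists_norm_Gamma_le (1 - (|c.re| + a)) (1 + (|c.re| + a))
  have := of_affine (a := a) (α := Real.pi / 2) (H := fun z => (Complex.Gamma z)⁻¹) (N := N) 1
    (by simp) c (C := C / Real.pi) (by positivity) fun z h1 h2 h3 => ?_
  · simpa using this
  have hsin : Complex.sin (Real.pi * z) ≠ 0 := by
    rw [Complex.sin_ne_zero_iff]
    intro k hk
    have hpi : (Real.pi : ℂ) ≠ 0 := by exact_mod_cast Real.pi_ne_zero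
    have : z = k := mul_left_cancel₀ hpi (by rw [hk]; ring)
    rw [this] at h3
    simp at h3
    linarith
  have e := Complex.Gamma_mul_Gamma_one_sub z
  have hpi : (Real.pi : ℂ) ≠ 0 := by exact_mod_cast Real.pi_ne_zero
  have hG : Complex.Gamma z ≠ 0 := by
    intro h0
    rw [h0, zero_mul] at e
    exact (div_ne_zero hpi hsin) e.symm
  have e2 : (Complex.Gamma z)⁻¹ = Complex.Gamma (1 - z) * Complex.sin (Real.pi * z) / Real.pi := by
    rw [eq_div_iff hsin] at e
    rw [eq_div_iff hpi, inv_mul_eq_iff_eq_mul₀ hG]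
    linear_combination -e
  have h4 := h (1 - z) (by simp; linarith) (by simp; linarith) (by simpa using h3)
  have h5 : ‖Complex.sin (Real.pi * z)‖ ≤ Real.exp (Real.pi * |z.im|) := by
    rw [Complex.sin, norm_div, norm_mul, Complex.norm_I, mul_one, Complex.norm_ofNat,
      div_le_iff₀ two_pos]
    refine (norm_sub_le _ _).trans ?_
    rw [Complex.norm_exp, Complex.norm_exp]
    have r1 : (-(Real.pi * z) * Complex.I).re = Real.pi * z.im := by simp
    have r2 : (Real.pi * z * Complex.I).re = -(Real.pi * z.im) := by simp
    rw [r1, r2]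
    have b1 : Real.exp (Real.pi * z.im) ≤ Real.exp (Real.pi * |z.im|) :=
      Real.exp_le_exp.2 (mul_le_mul_of_nonneg_left (le_abs_self _) Real.pi_pos.le)
    have b2 : Real.exp (-(Real.pi * z.im)) ≤ Real.exp (Real.pi * |z.im|) := by
      rw [← mul_neg]
      exact Real.exp_le_exp.2 (mul_le_mul_of_nonneg_left (neg_le_abs _) Real.pi_pos.le)
    linarith
  have h6 : |(1 - z).im| = |z.im| := by simp
  rw [h6] at h4
  rw [e2, norm_div, norm_mul, Complex.norm_real, Real.norm_of_nonneg Real.pi_pos.le]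
  calc _ ≤ C * (1 + |z.im|) ^ N * Real.exp (-(Real.pi / 2) * |z.im|) *
        Real.exp (Real.pi * |z.im|) / Real.pi := by gcongr
    _ = C / Real.pi * (1 + |z.im|) ^ N *
        (Real.exp (-(Real.pi / 2) * |z.im|) * Real.exp (Real.pi * |z.im|)) := by ring
    _ = _ := by
      rw [← Real.exp_add]
      congr 2
      ring

theorem congr (hF : VertGrowth a α F) {R : ℝ}
    (h : ∀ z : ℂ, |z.re| < a → R ≤ |z.im| → G z = F z) : VertGrowth a α G := by
  obtain ⟨R', C, N, hC⟩ := hF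
  refine ⟨max R R', C, N, fun z hz hR => ?_⟩
  rw [h z hz ((le_max_left _ _).trans hR)]
  exact hC z hz ((le_max_right _ _).trans hR)

theorem sub_inv (a : ℝ) (y : ℂ) : VertGrowth a 0 fun z => (z - y)⁻¹ := by
  refine ⟨1 + |y.im|, 1, 0, fun z _ hR => ?_⟩
  simp only [pow_zero, zero_mul, Real.exp_zero, mul_one, norm_inv]
  refine inv_le_one_of_one_le₀ ?_
  have h2 := Complex.abs_im_le_norm (z - y)
  rw [Complex.sub_im] at h2
  linarith [abs_sub_abs_le_abs_sub z.im y.im]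

theorem dslope (hF : VertGrowth a 0 F) (y : ℂ) : VertGrowth a 0 (_root_.dslope F y) := by
  have h1 := (sub_inv a y).mul (hF.add (const a (-F y)))
  rw [add_zero] at h1
  refine h1.congr (R := |y.im| + 1) fun z _ hR => ?_
  have hzy : z ≠ y := by
    rintro rfl
    linarith
  rw [dslope_of_ne _ hzy, slope_def_field]
  field_simp
  ring

theorem exists_inv_sq_bound (N : ℕ) {α : ℝ} (hα : α < 0) :
    ∃ K : ℝ, 0 ≤ K ∧ ∀ x : ℝ, 0 ≤ x → (1 + x) ^ N * Real.exp (α * x) ≤ K * (1 + x ^ 2)⁻¹ := by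
  -- Two spare powers pay for the factor 1 + x². The power (1 + x)^M is beaten by the term of order
  -- M in the series of e^{-α(1 + x)}.
  set M := N + 2
  refine ⟨2 * (Nat.factorial M * (-α)⁻¹ ^ M * Real.exp (-α)), by
    have : 0 < (-α)⁻¹ := inv_pos.2 (by linarith)
    positivity, fun x hx => ?_⟩
  have hβ : 0 < -α := by linarith
  have h1 := Real.pow_div_factorial_le_exp (-α * (1 + x)) (by positivity) M
  have h2 : (1 + x) ^ M * Real.exp (α * x) ≤
      Nat.factorial M * (-α)⁻¹ ^ M * Real.exp (-α) := by
    rw [div_le_iff₀ (by positivity), mul_pow] at h1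
    have h3 : (1 + x) ^ M ≤ (-α)⁻¹ ^ M * (Real.exp (-α * (1 + x)) * Nat.factorial M) := by
      have h4 : (-α)⁻¹ ^ M * ((-α) ^ M * (1 + x) ^ M) = (1 + x) ^ M := by
        rw [← mul_assoc, ← mul_pow, inv_mul_cancel₀ hβ.ne', one_pow, one_mul]
      rw [← h4]
      exact mul_le_mul_of_nonneg_left h1 (by positivity)
    calc _ ≤ (-α)⁻¹ ^ M * (Real.exp (-α * (1 + x)) * Nat.factorial M) * Real.exp (α * x) := by
          gcongr
      _ = Nat.factorial M * (-α)⁻¹ ^ M * (Real.exp (-α * (1 + x)) * Real.exp (α * x)) := by ring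
      _ = _ := by
        rw [← Real.exp_add]
        congr 2
        ring
  have h5 : (1 + x) ^ N * Real.exp (α * x) * (1 + x ^ 2) ≤ (1 + x) ^ M * Real.exp (α * x) := by
    have : (1 + x) ^ M = (1 + x) ^ N * (1 + x) ^ 2 := pow_add _ _ _
    rw [this]
    have h6 : 1 + x ^ 2 ≤ (1 + x) ^ 2 := by nlinarith
    calc _ = (1 + x) ^ N * (1 + x ^ 2) * Real.exp (α * x) := by ring
      _ ≤ _ := by gcongr
  rw [← div_eq_mul_inv, le_div_iff₀ (by positivity)]
  have h7 : 0 ≤ (Nat.factorial M * (-α)⁻¹ ^ M * Real.exp (-α) : ℝ) := by positivity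
  linarith

theorem exists_bound (hF : VertGrowth a α F) (hα : α < 0) : ∃ R C : ℝ, 0 ≤ C ∧ ∀ z : ℂ,
    |z.re| < a → R ≤ |z.im| → ‖F z‖ ≤ C * (1 + z.im ^ 2)⁻¹ := by
  obtain ⟨R, C, N, h⟩ := hF
  obtain ⟨K, hK, hb⟩ := exists_inv_sq_bound N hα
  refine ⟨R, |C| * K, by positivity, fun z hz hR => (h z hz hR).trans ?_⟩
  have h1 := hb |z.im| (abs_nonneg _)
  rw [sq_abs] at h1
  calc _ ≤ |C| * ((1 + |z.im|) ^ N * Real.exp (α * |z.im|)) := by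
        rw [← mul_assoc]
        gcongr
        exact le_abs_self C
    _ ≤ |C| * (K * (1 + z.im ^ 2)⁻¹) := by gcongr
    _ = _ := by ring

/-- Division by iℏ is a rotation and rescaling: Re z = Im w/ℏ and Im z = -Re w/ℏ, so vertical strips
in z are horizontal strips in w. -/
theorem quadDecay (hF : VertGrowth a α F) (hα : α < 0) {ℏ : ℝ} (hℏ : 0 < ℏ) {L : ℝ}
    (hL : L ≤ ℏ * a) : QuadDecay L fun w => F (w / (Complex.I * ℏ)) := by
  obtain ⟨R, C, hC, h⟩ := hF.exists_bound hα
  have e : ∀ w : ℂ, w / (Complex.I * ℏ) = ⟨w.im / ℏ, -(w.re / ℏ)⟩ := by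
    intro w
    have : (Complex.I * ℏ : ℂ) ≠ 0 :=
      mul_ne_zero Complex.I_ne_zero (by exact_mod_cast hℏ.ne')
    rw [div_eq_iff this]
    apply Complex.ext <;> simp <;> field_simp
  refine ⟨ℏ * R, C * (1 + ℏ ^ 2), fun w hw hR => ?_⟩
  have h1 := h (w / (Complex.I * ℏ)) (by
    rw [e, abs_div, abs_of_pos hℏ, div_lt_iff₀ hℏ]
    linarith) (by
    rw [e, abs_neg, abs_div, abs_of_pos hℏ, le_div_iff₀ hℏ]
    linarith)
  refine h1.trans ?_
  rw [e, mul_assoc]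
  refine mul_le_mul_of_nonneg_left ?_ hC
  rw [← div_eq_mul_inv, le_div_iff₀ (by positivity), inv_mul_le_iff₀ (by positivity)]
  simp only [neg_sq, div_pow]
  have : w.re ^ 2 = ℏ ^ 2 * (w.re ^ 2 / ℏ ^ 2) := by field_simp
  have h3 : 0 ≤ w.re ^ 2 / ℏ ^ 2 := by positivity
  nlinarith [sq_nonneg ℏ]

end VertGrowth

/-! ### Determinantal structure of the integrand -/

/-- **Andréief's identity**. -/
theorem integral_det_mul_det {n : ℕ} (f g : Fin n → ℝ → ℂ) (h : ℝ → ℂ)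
    (hInt : ∀ j k, Integrable fun t => f j t * g k t * h t) :
    Integrable (fun t : Fin n → ℝ => (Matrix.of fun j a => f j (t a)).det *
      (Matrix.of fun k a => g k (t a)).det * ∏ a, h (t a)) ∧
    ∫ t : Fin n → ℝ, (Matrix.of fun j a => f j (t a)).det *
      (Matrix.of fun k a => g k (t a)).det * ∏ a, h (t a) =
      n.factorial * (Matrix.of fun j k => ∫ t, f j t * g k t * h t).det := by
  have hexp : ∀ t : Fin n → ℝ, (Matrix.of fun j a => f j (t a)).det *
      (Matrix.of fun k a => g k (t a)).det * ∏ a, h (t a) =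
      ∑ σ : Equiv.Perm (Fin n), ∑ τ : Equiv.Perm (Fin n),
        ((Equiv.Perm.sign σ : ℤ) * (Equiv.Perm.sign τ : ℤ) : ℂ) *
          ∏ a, f (σ a) (t a) * g (τ a) (t a) * h (t a) := by
    intro t
    rw [Matrix.det_apply', Matrix.det_apply', Finset.sum_mul_sum, Finset.sum_mul]
    refine Finset.sum_congr rfl fun σ _ => ?_
    rw [Finset.sum_mul]
    refine Finset.sum_congr rfl fun τ _ => ?_
    simp only [Matrix.of_apply, Finset.prod_mul_distrib]
    ring
  have hterm : ∀ σ τ : Equiv.Perm (Fin n), Integrable fun t : Fin n → ℝ =>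
      ((Equiv.Perm.sign σ : ℤ) * (Equiv.Perm.sign τ : ℤ) : ℂ) *
        ∏ a, f (σ a) (t a) * g (τ a) (t a) * h (t a) := fun σ τ =>
    (Integrable.fintype_prod (f := fun a t => f (σ a) t * g (τ a) t * h t)
      fun a => hInt (σ a) (τ a)).const_mul _
  simp only [hexp]
  refine ⟨integrable_finsetSum _ fun σ _ => integrable_finsetSum _ fun τ _ => hterm σ τ, ?_⟩
  rw [integral_finsetSum _ fun σ _ => integrable_finsetSum _ fun τ _ => hterm σ τ]
  -- For fixed σ, replacing τ by τσ⁻¹ turns the inner sum into the Leibniz expansion of one and the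
  -- same determinant. The n! choices of σ give the factorial.
  have hσ : ∀ σ : Equiv.Perm (Fin n), ∫ t : Fin n → ℝ, ∑ τ : Equiv.Perm (Fin n),
      ((Equiv.Perm.sign σ : ℤ) * (Equiv.Perm.sign τ : ℤ) : ℂ) *
        ∏ a, f (σ a) (t a) * g (τ a) (t a) * h (t a) =
      (Matrix.of fun j k => ∫ t, f j t * g k t * h t).det := by
    intro σ
    rw [integral_finsetSum _ fun τ _ => hterm σ τ, ← Matrix.det_transpose, Matrix.det_apply']
    refine Fintype.sum_equiv (Equiv.mulRight σ⁻¹) _ _ fun τ => ?_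
    rw [integral_const_mul, integral_fintype_prod_volume_eq_prod
      (fun a t => f (σ a) t * g (τ a) t * h t)]
    simp only [Equiv.coe_mulRight, Matrix.transpose_apply, Matrix.of_apply, Equiv.Perm.sign_mul,
      Equiv.Perm.sign_inv]
    congr 1
    · push_cast
      ring
    · refine Fintype.prod_equiv σ _ _ fun a => ?_
      simp
  simp only [hσ, Finset.sum_const, Finset.card_univ, Fintype.card_perm, Fintype.card_fin,
    nsmul_eq_mul]

theorem prod_offDiag_eq_prod_Ioi {n : ℕ} (F : Fin n → Fin n → ℂ) :
    ∏ p ∈ (Finset.univ : Finset (Fin n)).offDiag, F p.1 p.2 =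
      ∏ i, ∏ j ∈ Finset.Ioi i, F i j * F j i := by
  have h1 : ∏ i, ∏ j ∈ Finset.Ioi i, F j i = ∏ i, ∏ j ∈ Finset.Iio i, F i j :=
    Finset.prod_comm' (by simp)
  simp only [Finset.prod_mul_distrib]
  rw [h1, ← Finset.prod_mul_distrib]
  have h2 : ∀ i : Fin n, (∏ j ∈ Finset.Ioi i, F i j) * ∏ j ∈ Finset.Iio i, F i j =
      ∏ j ∈ Finset.univ.erase i, F i j := by
    intro i
    rw [← Finset.prod_union]
    · congr 1
      ext j
      simp only [Finset.mem_union, Finset.mem_Ioi, Finset.mem_Iio, Finset.mem_erase,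
        Finset.mem_univ, and_true]
      rw [or_comm, ← ne_iff_lt_or_gt]
    · rw [Finset.disjoint_left]
      intro j hj hj'
      rw [Finset.mem_Ioi] at hj
      rw [Finset.mem_Iio] at hj'
      exact lt_asymm hj hj'
  simp only [h2]
  rw [Finset.prod_sigma']
  refine Finset.prod_bij' (fun p _ => ⟨p.1, p.2⟩) (fun q _ => (q.1, q.2)) ?_ ?_ ?_ ?_ ?_
  · rintro ⟨i, j⟩ hp
    simp at hp ⊢
    exact fun h => hp h.symm
  · rintro ⟨i, j⟩ hp
    simp at hp ⊢
    exact fun h => hp h.symm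
  · intros; rfl
  · intros; rfl
  · intros; rfl

/-- Every index occurs in n - 1 unordered pairs. -/
theorem prod_Ioi_mul_eq_pow {n : ℕ} (c : Fin n → ℂ) :
    ∏ i, ∏ j ∈ Finset.Ioi i, c i * c j = ∏ i, c i ^ (n - 1) := by
  rw [← prod_offDiag_eq_prod_Ioi fun i _ => c i]
  have h : (Finset.univ : Finset (Fin n)).offDiag =
      (Finset.univ.sigma fun i => Finset.univ.erase i).map
        (Equiv.sigmaEquivProd (Fin n) (Fin n)).toEmbedding := by
    ext ⟨i, j⟩
    simp
    exact ⟨fun h h' => h h'.symm, fun h h' => h h'.symm⟩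
  rw [h, Finset.prod_map, Finset.prod_sigma]
  refine Finset.prod_congr rfl fun i _ => ?_
  simp

/-- The exponentials `exp (iπ(2k-n+1)z)`, `0 ≤ k < n`, which span the products of `n - 1` sines. -/
noncomputable def trigExp (n k : ℕ) (z : ℂ) : ℂ :=
  Complex.exp (Complex.I * (Real.pi * (2 * k - (n - 1)) : ℝ) * z)

/-- The product of the `sin π(zᵢ - zⱼ) / π` over `i < j`. -/
noncomputable def sinVandermonde {n : ℕ} (z : Fin n → ℂ) : ℂ :=
  ∏ i, ∏ j ∈ Finset.Ioi i, Complex.sin (Real.pi * (z i - z j)) / Real.pi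

/-- With u = e^{2πiz}, sin π(z_i - z_j) is a constant times e^{-iπ(z_i + z_j)}(u_j - u_i). The
product is thus a Vandermonde determinant in u, and the prefactors distribute as e^{-iπ(n-1)z_a},
which centres the exponents. The value of κ is irrelevant, since it cancels at the end. -/
theorem exists_sinVandermonde_eq_det (n : ℕ) : ∃ κ : ℂ, κ ≠ 0 ∧ ∀ z : Fin n → ℂ,
    sinVandermonde z = κ * (Matrix.of fun (k a : Fin n) => trigExp n k (z a)).det := by
  have hpi : (Real.pi : ℂ) ≠ 0 := by exact_mod_cast Real.pi_ne_zero
  refine ⟨∏ i : Fin n, ∏ _j ∈ Finset.Ioi i, Complex.I / (2 * Real.pi), ?_, fun z => ?_⟩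
  · refine Finset.prod_ne_zero_iff.2 fun i _ => Finset.prod_ne_zero_iff.2 fun j _ => ?_
    exact div_ne_zero Complex.I_ne_zero (mul_ne_zero two_ne_zero hpi)
  set u : Fin n → ℂ := fun a => Complex.exp (2 * Real.pi * Complex.I * z a) with hu
  set c : Fin n → ℂ := fun a => Complex.exp (-(Complex.I * Real.pi * z a)) with hc
  have hsin : ∀ i j, Complex.sin (Real.pi * (z i - z j)) / Real.pi =
      Complex.I / (2 * Real.pi) * ((c i * c j) * (u j - u i)) := by
    intro i j
    have e1 : c i * c j * u j = Complex.exp (-(Real.pi * (z i - z j)) * Complex.I) := by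
      simp only [hc, hu, ← Complex.exp_add]
      congr 1
      ring
    have e2 : c i * c j * u i = Complex.exp (Real.pi * (z i - z j) * Complex.I) := by
      simp only [hc, hu, ← Complex.exp_add]
      congr 1
      ring
    rw [mul_sub (c i * c j), e1, e2, Complex.sin]
    field_simp
  have hdet : (Matrix.of fun (k a : Fin n) => trigExp n k (z a)).det =
      (∏ a, c a ^ (n - 1)) * ∏ i, ∏ j ∈ Finset.Ioi i, (u j - u i) := by
    rw [← Matrix.det_vandermonde u, ← Matrix.det_mul_column, ← Matrix.det_transpose]
    congr 1
    ext a k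
    simp only [Matrix.transpose_apply, Matrix.of_apply, Matrix.vandermonde_apply, trigExp, hc, hu,
      ← Complex.exp_nat_mul, ← Complex.exp_add]
    congr 1
    have hn : ((n - 1 : ℕ) : ℂ) = n - 1 := by
      rw [Nat.cast_sub (by have := a.2; omega), Nat.cast_one]
    rw [hn]
    push_cast
    ring
  rw [hdet, ← prod_Ioi_mul_eq_pow, sinVandermonde]
  simp only [hsin, Finset.prod_mul_distrib]

/-- Valid at integers too: Γ has the default value 0 at its poles and 0⁻¹ = 0, in agreement with the
zeros of the entire function 1/Γ. -/
theorem inv_Gamma_mul_Gamma_neg (u : ℂ) :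
    (Complex.Gamma u * Complex.Gamma (-u))⁻¹ = -u * (Complex.sin (Real.pi * u) / Real.pi) := by
  rcases eq_or_ne u 0 with rfl | hu
  · simp
  have h1 := Complex.Gamma_mul_Gamma_one_sub u
  have h2 := Complex.Gamma_add_one (-u) (neg_ne_zero.2 hu)
  rw [show -u + 1 = 1 - u by ring] at h2
  rw [h2] at h1
  have h3 : Complex.Gamma u * Complex.Gamma (-u) =
      (-u)⁻¹ * (Real.pi / Complex.sin (Real.pi * u)) := by
    rw [← h1]
    have := neg_ne_zero.2 hu
    field_simp
  rw [h3, mul_inv, inv_inv, inv_div]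

theorem inv_prod_offDiag_Gamma {n : ℕ} (z : Fin n → ℂ) :
    (∏ p ∈ (Finset.univ : Finset (Fin n)).offDiag, Complex.Gamma (z p.1 - z p.2))⁻¹ =
      (Matrix.vandermonde z).det * sinVandermonde z := by
  rw [prod_offDiag_eq_prod_Ioi fun i j => Complex.Gamma (z i - z j), Matrix.det_vandermonde,
    sinVandermonde, ← Finset.prod_inv_distrib, ← Finset.prod_mul_distrib]
  refine Finset.prod_congr rfl fun i _ => ?_
  rw [← Finset.prod_inv_distrib, ← Finset.prod_mul_distrib]
  refine Finset.prod_congr rfl fun j _ => ?_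
  have := inv_Gamma_mul_Gamma_neg (z i - z j)
  rw [neg_sub] at this
  rw [this]

/-! ### Reduction to one-dimensional moments -/

/-- The one-variable factor of the integrand, in the variable `z = w / (iℏ)`. -/
noncomputable def barnesWeight {n m : ℕ} (s : ℝ) (y : Fin n → ℂ) (x : Fin m → ℂ) (z : ℂ) : ℂ :=
  Complex.exp (s * z) * ((∏ b, Complex.Gamma (y b - z)) * ∏ b, Complex.Gamma (z - x b))

/-- The one-dimensional integrals to which the multiple integral reduces. -/
noncomputable def barnesMoment {n m : ℕ} (γ : ℝ → ℂ) (ℏ s : ℝ) (y : Fin n → ℂ) (x : Fin m → ℂ)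
    (p : Polynomial ℂ) (k : ℕ) : ℂ :=
  contourIntegral γ fun w => p.eval (w / (Complex.I * ℏ)) * trigExp n k (w / (Complex.I * ℏ)) *
    barnesWeight s y x (w / (Complex.I * ℏ))

theorem gammaIntegrand_eq {n m : ℕ} (ℏ s : ℝ) (y : Fin n → ℂ) (x : Fin m → ℂ) (w : Fin n → ℂ) :
    gammaIntegrand ℏ s y x w =
      (Matrix.vandermonde fun a => w a / (Complex.I * ℏ)).det *
        sinVandermonde (fun a => w a / (Complex.I * ℏ)) *
        ∏ a, barnesWeight s (fun b => y b / (Complex.I * ℏ)) (fun b => x b / (Complex.I * ℏ))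
          (w a / (Complex.I * ℏ)) := by
  rw [← inv_prod_offDiag_Gamma]
  simp only [gammaIntegrand, barnesWeight, sub_div, Finset.prod_mul_distrib, ← Complex.exp_sum,
    ← Finset.mul_sum, ← Finset.sum_div]
  rw [div_eq_mul_inv, mul_comm, mul_div_assoc]

/-- Any monic polynomials of degrees 0, …, n - 1 produce the same Vandermonde determinant. This
freedom in p is kept because it later replaces row operations on the matrix of moments. The constant
κ depends on n alone. -/
theorem integral_contourPullback {n m : ℕ} : ∃ κ : ℂ, κ ≠ 0 ∧
    (∀ z : Fin n → ℂ, sinVandermonde z =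
      κ * (Matrix.of fun (k a : Fin n) => trigExp n k (z a)).det) ∧
    ∀ (ℏ s : ℝ) (y : Fin n → ℂ) (x : Fin m → ℂ) (γ : ℝ → ℂ) (p : Fin n → Polynomial ℂ),
      (∀ j, (p j).natDegree = j) → (∀ j, (p j).Monic) →
      (∀ j k : Fin n, Integrable fun t => (p j).eval (γ t / (Complex.I * ℏ)) *
        trigExp n k (γ t / (Complex.I * ℏ)) *
        barnesWeight s (fun b => y b / (Complex.I * ℏ)) (fun b => x b / (Complex.I * ℏ))
          (γ t / (Complex.I * ℏ)) * deriv γ t) →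
      Integrable (contourPullback γ (gammaIntegrand ℏ s y x)) ∧
      ∫ t : Fin n → ℝ, contourPullback γ (gammaIntegrand ℏ s y x) t = κ * (n.factorial *
        (Matrix.of fun j k : Fin n => barnesMoment γ ℏ s (fun b => y b / (Complex.I * ℏ))
          (fun b => x b / (Complex.I * ℏ)) (p j) k).det) := by
  obtain ⟨κ, hκ, hdet⟩ := exists_sinVandermonde_eq_det n
  refine ⟨κ, hκ, hdet, fun ℏ s y x γ p hdeg hmon hInt => ?_⟩
  obtain ⟨h1, h2⟩ := integral_det_mul_det
    (fun j t => (p j).eval (γ t / (Complex.I * ℏ)))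
    (fun k t => trigExp n k (γ t / (Complex.I * ℏ)))
    (fun t => barnesWeight s (fun b => y b / (Complex.I * ℏ)) (fun b => x b / (Complex.I * ℏ))
          (γ t / (Complex.I * ℏ)) * deriv γ t)
    (fun j k => (hInt j k).congr (Eventually.of_forall fun t => by simp only [mul_assoc]))
  have e : contourPullback γ (gammaIntegrand ℏ s y x) = fun t => κ *
      ((Matrix.of fun (j a : Fin n) => (p j).eval (γ (t a) / (Complex.I * ℏ))).det *
        (Matrix.of fun (k a : Fin n) => trigExp n k (γ (t a) / (Complex.I * ℏ))).det *
        ∏ a, (barnesWeight s (fun b => y b / (Complex.I * ℏ)) (fun b => x b / (Complex.I * ℏ))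
          (γ (t a) / (Complex.I * ℏ)) * deriv γ (t a))) := by
    ext t
    rw [contourPullback, gammaIntegrand_eq, hdet,
      Matrix.det_eval_matrixOfPolynomials_eq_det_vandermonde _ p hdeg hmon,
      ← Matrix.det_transpose (Matrix.of fun (i j : Fin n) => (p j).eval _),
      Finset.prod_mul_distrib]
    simp only [Matrix.transpose, Matrix.of_apply]
    ring
  rw [e]
  refine ⟨h1.const_mul κ, ?_⟩
  rw [integral_const_mul, h2]
  simp only [barnesMoment, contourIntegral, mul_assoc]

/-! ### Moments: convergence, deformation of the contour, contiguity -/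

/-- The integrand of `barnesMoment`, in the variable `z`. -/
noncomputable def momentIntegrand {n m : ℕ} (s : ℝ) (y : Fin n → ℂ) (x : Fin m → ℂ)
    (p : Polynomial ℂ) (k : ℕ) (z : ℂ) : ℂ :=
  p.eval z * trigExp n k z * barnesWeight s y x z

/-- The contour separates the poles of the Gamma functions of the integrand. -/
structure Separates {n m : ℕ} (γ : ℝ → ℂ) (ℏ : ℝ) (y : Fin n → ℂ) (x : Fin m → ℂ) : Prop where
  above : ∀ (a : Fin n) (k : ℕ), LiesAbove γ (Complex.I * ℏ * (y a + k))
  below : ∀ (b : Fin m) (k : ℕ), LiesBelow γ (Complex.I * ℏ * (x b - k))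

section

variable {m : ℕ} {γ γ' : ℝ → ℂ} {ℏ s : ℝ} {y : Fin (m + 1) → ℂ} {x : Fin m → ℂ}

/-- The 2m + 1 Gamma factors contribute the rate -(2m + 1)π/2, while the exponential `trigExp` grows
at rate at most πm; a net decay of rate π/2 remains. -/
theorem vertGrowth_momentIntegrand (a s : ℝ) (y : Fin (m + 1) → ℂ) (x : Fin m → ℂ)
    (p : Polynomial ℂ) (k : Fin (m + 1)) :
    VertGrowth a (-(Real.pi / 2)) (momentIntegrand s y x p k) := by
  have h1 := VertGrowth.polynomial a p
  have h2 := VertGrowth.exp_I a (Real.pi * (2 * (k : ℕ) - (((m + 1 : ℕ) : ℝ) - 1)))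
  have h3 := VertGrowth.exp_real a s
  have h4 := VertGrowth.prod Finset.univ fun b => VertGrowth.gamma_sub a (y b)
  have h5 := VertGrowth.prod Finset.univ fun b => VertGrowth.gamma_add a (-x b)
  have h := (h1.mul h2).mul (h3.mul (h4.mul h5))
  have hk : |(2 * (k : ℕ) - (((m + 1 : ℕ) : ℝ) - 1))| ≤ m := by
    have : ((k : ℕ) : ℝ) ≤ m := by exact_mod_cast Nat.lt_succ_iff.1 k.2
    have h0 : (0 : ℝ) ≤ ((k : ℕ) : ℝ) := Nat.cast_nonneg _
    push_cast
    rw [abs_le]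
    constructor <;> linarith
  refine VertGrowth.mono (α := 0 + |Real.pi * (2 * (k : ℕ) - (((m + 1 : ℕ) : ℝ) - 1))| +
    (0 + ((Finset.univ : Finset (Fin (m + 1))).card * (-(Real.pi / 2)) +
      (Finset.univ : Finset (Fin m)).card * (-(Real.pi / 2))))) ?_ ?_
  · unfold momentIntegrand trigExp barnesWeight
    simpa only [sub_eq_add_neg] using h
  · rw [abs_mul, abs_of_pos Real.pi_pos, Finset.card_univ, Finset.card_univ, Fintype.card_fin,
      Fintype.card_fin]
    push_cast at hk ⊢
    nlinarith [Real.pi_pos, mul_le_mul_of_nonneg_left hk Real.pi_pos.le]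

theorem quadDecay_momentIntegrand (hℏ : 0 < ℏ) (L s : ℝ) (y : Fin (m + 1) → ℂ) (x : Fin m → ℂ)
    (p : Polynomial ℂ) (k : Fin (m + 1)) :
    QuadDecay L fun w => momentIntegrand s y x p k (w / (Complex.I * ℏ)) :=
  (vertGrowth_momentIntegrand (L / ℏ) s y x p k).quadDecay (by linarith [Real.pi_pos]) hℏ
    (by rw [mul_div_cancel₀ _ hℏ.ne'])

theorem I_mul_ne_zero (hℏ : 0 < ℏ) : (Complex.I * ℏ : ℂ) ≠ 0 :=
  mul_ne_zero Complex.I_ne_zero (by exact_mod_cast hℏ.ne')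

theorem div_I_mul_re (hℏ : 0 < ℏ) (w : ℂ) : (w / (Complex.I * ℏ)).re = w.im / ℏ := by
  have : w / (Complex.I * ℏ) = ⟨w.im / ℏ, -(w.re / ℏ)⟩ := by
    rw [div_eq_iff (I_mul_ne_zero hℏ)]
    apply Complex.ext <;> simp <;> field_simp
  rw [this]

theorem differentiable_trigExp (n k : ℕ) : Differentiable ℂ (trigExp n k) := by
  unfold trigExp
  fun_prop

theorem meroStrip_momentIntegrand (hℏ : 0 < ℏ) (L : ℝ) {A : Set ℂ}
    (hy : ∀ (a : Fin (m + 1)) (k : ℕ), Complex.I * ℏ * (y a + k) ∈ A)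
    (hx : ∀ (b : Fin m) (k : ℕ), Complex.I * ℏ * (x b - k) ∈ A) (p : Polynomial ℂ) (k : ℕ) :
    MeroStrip L A fun w => momentIntegrand s y x p k (w / (Complex.I * ℏ)) := by
  have h0 := I_mul_ne_zero hℏ
  have hlin : Differentiable ℂ fun w : ℂ => w / (Complex.I * ℏ) := differentiable_id.div_const _
  have h1 : MeroStrip L A fun w => p.eval (w / (Complex.I * ℏ)) :=
    .of_differentiable (p.differentiable.comp hlin)
  have h2 : MeroStrip L A fun w => trigExp (m + 1) k (w / (Complex.I * ℏ)) :=
    .of_differentiable ((differentiable_trigExp _ k).comp hlin)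
  have h3 : MeroStrip L A fun w => Complex.exp (s * (w / (Complex.I * ℏ))) :=
    .of_differentiable (Complex.differentiable_exp.comp (hlin.const_mul _))
  have hre : ∀ w ∈ openStrip L, |(w / (Complex.I * ℏ)).re| < L / ℏ := by
    intro w hw
    rw [div_I_mul_re hℏ, abs_div, abs_of_pos hℏ]
    exact div_lt_div_of_pos_right hw hℏ
  have h4 : ∀ b, MeroStrip L A fun w => Complex.Gamma (y b - w / (Complex.I * ℏ)) := by
    intro b
    obtain ⟨N, hN⟩ := exists_nat_gt (L / ℏ - (y b).re)
    have e : ∀ w : ℂ, y b - w / (Complex.I * ℏ) = -(Complex.I * ℏ)⁻¹ * w + y b := by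
      intro w
      rw [div_eq_mul_inv]
      ring
    simp only [e]
    refine MeroStrip.gamma (neg_ne_zero.2 (inv_ne_zero h0)) N (fun w hw => ?_) fun j w hw => ?_
    · rw [← e, Complex.sub_re]
      linarith [(abs_lt.1 (hre w hw)).2]
    · convert! hy b j using 1
      rw [← e] at hw
      have : w = Complex.I * ℏ * (w / (Complex.I * ℏ)) := (mul_div_cancel₀ w h0).symm
      rw [this]
      congr 1
      linear_combination -hw
  have h5 : ∀ b, MeroStrip L A fun w => Complex.Gamma (w / (Complex.I * ℏ) - x b) := by
    intro b
    obtain ⟨N, hN⟩ := exists_nat_gt (L / ℏ + (x b).re)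
    have e : ∀ w : ℂ, w / (Complex.I * ℏ) - x b = (Complex.I * ℏ)⁻¹ * w + -x b := by
      intro w
      rw [div_eq_mul_inv]
      ring
    simp only [e]
    refine MeroStrip.gamma (inv_ne_zero h0) N (fun w hw => ?_) fun j w hw => ?_
    · rw [← e, Complex.sub_re]
      linarith [(abs_lt.1 (hre w hw)).1]
    · convert! hx b j using 1
      rw [← e] at hw
      have : w = Complex.I * ℏ * (w / (Complex.I * ℏ)) := (mul_div_cancel₀ w h0).symm
      rw [this]
      congr 1
      linear_combination hw
  exact (h1.mul h2).mul (h3.mul ((MeroStrip.prod _ h4).mul (MeroStrip.prod _ h5)))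

theorem integrable_momentIntegrand (hγ : IsStripContour γ) (hℏ : 0 < ℏ)
    (hsep : Separates γ ℏ y x) (s : ℝ) (p : Polynomial ℂ) (k : Fin (m + 1)) :
    Integrable fun t => momentIntegrand s y x p k (γ t / (Complex.I * ℏ)) * deriv γ t := by
  obtain ⟨L, hL⟩ := hγ.exists_abs_im_lt
  exact MeroStrip.integrable hγ hL (meroStrip_momentIntegrand hℏ L
    (fun a k => (hsep.above a k).notMem_range) (fun b k => (hsep.below b k).notMem_range) p k)
    (quadDecay_momentIntegrand hℏ L s y x p k)

theorem barnesMoment_eq_of_separates (hγ : IsStripContour γ) (hγ' : IsStripContour γ')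
    (hℏ : 0 < ℏ) (hsep : Separates γ ℏ y x) (hsep' : Separates γ' ℏ y x) (s : ℝ)
    (p : Polynomial ℂ) (k : Fin (m + 1)) :
    barnesMoment γ ℏ s y x p k = barnesMoment γ' ℏ s y x p k := by
  obtain ⟨L, hL⟩ := hγ.exists_abs_im_lt
  obtain ⟨L', hL'⟩ := hγ'.exists_abs_im_lt
  exact MeroStrip.contourIntegral_eq hγ hγ' (L := max L L')
    (fun t => (hL t).trans_le (le_max_left _ _)) (fun t => (hL' t).trans_le (le_max_right _ _))
    (meroStrip_momentIntegrand hℏ _ (fun a k => Or.inl ⟨hsep.above a k, hsep'.above a k⟩)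
      (fun b k => Or.inr ⟨hsep.below b k, hsep'.below b k⟩) p k)
    (quadDecay_momentIntegrand hℏ _ s y x p k)

theorem barnesMoment_add (hγ : IsStripContour γ) (hℏ : 0 < ℏ) (hsep : Separates γ ℏ y x) (s : ℝ)
    (p q : Polynomial ℂ) (k : Fin (m + 1)) :
    barnesMoment γ ℏ s y x (p + q) k =
      barnesMoment γ ℏ s y x p k + barnesMoment γ ℏ s y x q k := by
  refine Eq.trans ?_ (contourIntegral_add (integrable_momentIntegrand hγ hℏ hsep s p k)
    (integrable_momentIntegrand hγ hℏ hsep s q k))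
  refine contourIntegral_congr fun t => ?_
  simp only [Polynomial.eval_add]
  ring

theorem barnesMoment_C_mul (γ : ℝ → ℂ) (ℏ s : ℝ) (y : Fin (m + 1) → ℂ) (x : Fin m → ℂ) (c : ℂ)
    (p : Polynomial ℂ) (k : ℕ) :
    barnesMoment γ ℏ s y x (Polynomial.C c * p) k = c * barnesMoment γ ℏ s y x p k := by
  rw [barnesMoment, barnesMoment, ← contourIntegral_const_mul]
  refine contourIntegral_congr fun t => ?_
  simp only [Polynomial.eval_mul, Polynomial.eval_C]
  ring

/-- Raising each y_b by 1 removes the lowest pole of each upper tower, so the contour can move up by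
iℏ without meeting a pole. The lower towers stay below. -/
theorem Separates.shift (hsep : Separates γ ℏ y x) :
    Separates γ ℏ (fun b => y b + 1) x ∧
      Separates (fun t => γ t + Complex.I * ℏ) ℏ (fun b => y b + 1) x := by
  refine ⟨⟨fun a k => ?_, hsep.below⟩, ⟨fun a k => ?_, fun b k => ?_⟩⟩
  · have := hsep.above a (k + 1)
    push_cast at this
    convert! this using 2
    ring
  · convert! (hsep.above a k).add_const (Complex.I * ℏ) using 1
    ring
  · have := (hsep.below b (k + 1)).add_const (Complex.I * ℏ)
    push_cast at this
    convert! this using 1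
    ring

/-- The sign does not depend on k, so the contiguity relation has the same coefficients in every
column of the moment matrix. -/
theorem trigExp_add_one (m k : ℕ) (z : ℂ) :
    trigExp (m + 1) k (z + 1) = (-1) ^ m * trigExp (m + 1) k z := by
  have h : ((-1 : ℂ)) ^ m = Complex.exp (Complex.I * (Real.pi * (2 * k - ((m + 1 : ℕ) - 1)) : ℝ)) := by
    have e : Complex.I * (Real.pi * (2 * k - ((m + 1 : ℕ) - 1)) : ℝ) =
        (k : ℕ) * (2 * Real.pi * Complex.I) + -((m : ℕ) * (Real.pi * Complex.I)) := by
      push_cast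
      ring
    rw [e, Complex.exp_add, Complex.exp_nat_mul_two_pi_mul_I, Complex.exp_neg, Complex.exp_nat_mul,
      Complex.exp_pi_mul_I, one_mul, ← inv_pow, inv_neg, inv_one]
  rw [trigExp, trigExp, mul_add, Complex.exp_add, mul_one, h]
  ring

theorem Separates.sub_ne_zero (hℏ : 0 < ℏ) (hsep : Separates γ ℏ y x) (t : ℝ) :
    (∀ b, y b - γ t / (Complex.I * ℏ) ≠ 0) ∧ ∀ b, γ t / (Complex.I * ℏ) - x b ≠ 0 := by
  have h0 := I_mul_ne_zero hℏ
  constructor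
  · intro b h
    refine (hsep.above b 0).notMem_range ⟨t, ?_⟩
    rw [_root_.sub_eq_zero] at h
    rw [h, Nat.cast_zero, add_zero, mul_div_cancel₀ _ h0]
  · intro b h
    refine (hsep.below b 0).notMem_range ⟨t, ?_⟩
    rw [_root_.sub_eq_zero] at h
    rw [← h, Nat.cast_zero, sub_zero, mul_div_cancel₀ _ h0]

/-- The contiguity relation between the moments, obtained by a shift of the contour by `iℏ`. -/
theorem barnesMoment_prod_sub (hγ : IsStripContour γ) (hℏ : 0 < ℏ) (hsep : Separates γ ℏ y x)
    (s : ℝ) (k : Fin (m + 1)) :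
    barnesMoment γ ℏ s y x (∏ b, (Polynomial.C (y b) - Polynomial.X)) k =
      (-1) ^ m * Complex.exp s *
        barnesMoment γ ℏ s y x (∏ b, (Polynomial.X - Polynomial.C (x b))) k := by
  have h0 := I_mul_ne_zero hℏ
  -- The factors y_b - z are absorbed into Γ(y_b - z), which becomes Γ(y_b + 1 - z); this makes room
  -- for the shift. After it, Γ(z + 1 - x_b) releases the factors z - x_b.
  have e1 : barnesMoment γ ℏ s y x (∏ b, (Polynomial.C (y b) - Polynomial.X)) k =
      barnesMoment γ ℏ s (fun b => y b + 1) x 1 k := by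
    refine contourIntegral_congr fun t => ?_
    have hne := (hsep.sub_ne_zero hℏ t).1
    generalize γ t / (Complex.I * ℏ) = z at hne
    have e : ∀ b, Complex.Gamma (y b + 1 - z) = (y b - z) * Complex.Gamma (y b - z) := fun b => by
      rw [← Complex.Gamma_add_one _ (hne b)]
      congr 1
      ring
    simp only [barnesWeight, e, Polynomial.eval_prod, Polynomial.eval_sub, Polynomial.eval_C,
      Polynomial.eval_X, Polynomial.eval_one, Finset.prod_mul_distrib]
    ring
  rw [e1, barnesMoment_eq_of_separates hγ (hγ.add_const (Complex.I * ℏ)) hℏ hsep.shift.1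
    hsep.shift.2, barnesMoment, contourIntegral_add_const, barnesMoment,
    ← contourIntegral_const_mul]
  refine contourIntegral_congr fun t => ?_
  have hne := (hsep.sub_ne_zero hℏ t).2
  rw [add_div, div_self h0]
  generalize γ t / (Complex.I * ℏ) = z at hne
  have e : ∀ b, Complex.Gamma (z + 1 - x b) = (z - x b) * Complex.Gamma (z - x b) := fun b => by
    rw [← Complex.Gamma_add_one _ (hne b)]
    congr 1
    ring
  have e' : ∀ b, y b + 1 - (z + 1) = y b - z := fun b => by ring
  have e'' : Complex.exp (s * (z + 1)) = Complex.exp s * Complex.exp (s * z) := by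
    rw [← Complex.exp_add]
    congr 1
    ring
  rw [trigExp_add_one]
  simp only [barnesWeight, e, e', e'', Polynomial.eval_prod, Polynomial.eval_sub, Polynomial.eval_C,
    Polynomial.eval_X, Polynomial.eval_one, Finset.prod_mul_distrib]
  ring

end

/-! ### The determinant of the moments and the shift of one x_b -/

/-- The multiple of a row already present drops out, and moving V from last to first place is a
cycle of n + 2 rows, of sign (-1)^{n+1}. -/
theorem det_snoc_add_smul {n : ℕ} (R : Fin (n + 1) → Fin (n + 2) → ℂ) (V : Fin (n + 2) → ℂ)
    (a c : ℂ) (r : Fin (n + 1)) :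
    (Matrix.of (Fin.snoc R (a • R r + c • V) : Fin (n + 2) → Fin (n + 2) → ℂ)).det =
      c * (-1) ^ (n + 1) * (Matrix.of (Fin.cons V R : Fin (n + 2) → Fin (n + 2) → ℂ)).det := by
  have h1 : ∀ v, (Matrix.of (Fin.snoc R v : Fin (n + 2) → Fin (n + 2) → ℂ)) =
      (Matrix.of (Fin.snoc R V : Fin (n + 2) → Fin (n + 2) → ℂ)).updateRow (Fin.last _) v := by
    intro v
    rw [Matrix.updateRow]
    change _ = Function.update (Fin.snoc R V : Fin (n + 2) → Fin (n + 2) → ℂ) (Fin.last _) v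
    rw [Fin.update_snoc_last]
    rfl
  have h2 : ((Matrix.of (Fin.snoc R V : Fin (n + 2) → Fin (n + 2) → ℂ)).updateRow
      (Fin.last _) (R r)).det = 0 := by
    rw [← h1]
    refine Matrix.det_zero_of_row_eq (i := r.castSucc) (j := Fin.last _) (Fin.castSucc_lt_last r).ne
      ?_
    ext k
    simp
  rw [h1, Matrix.det_updateRow_add, Matrix.det_updateRow_smul, Matrix.det_updateRow_smul, h2,
    mul_zero, zero_add, ← h1]
  have h3 : (Matrix.of (Fin.snoc R V : Fin (n + 2) → Fin (n + 2) → ℂ)) =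
      (Matrix.of (Fin.cons V R : Fin (n + 2) → Fin (n + 2) → ℂ)).submatrix (finRotate (n + 2)) id := by
    ext i k
    simp only [Matrix.submatrix_apply, Matrix.of_apply, id]
    rw [Fin.snoc_eq_cons_rotate]
  rw [h3, Matrix.det_permute, sign_finRotate]
  push_cast
  ring

section

variable {m : ℕ} {γ γ' : ℝ → ℂ} {ℏ s : ℝ} {y : Fin (m + 1) → ℂ} {x : Fin m → ℂ}

/-- The determinant of the moments of a family of polynomials. -/
noncomputable def momentDet (γ : ℝ → ℂ) (ℏ s : ℝ) (y : Fin (m + 1) → ℂ) (x : Fin m → ℂ)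
    (p : Fin (m + 1) → Polynomial ℂ) : ℂ :=
  (Matrix.of fun j k : Fin (m + 1) => barnesMoment γ ℏ s y x (p j) k).det

/-- No row operations are needed: by Andréief both determinants, times κ (m + 1)!, equal the same
multiple integral. -/
theorem momentDet_eq_of_monic (hγ : IsStripContour γ) (hℏ : 0 < ℏ) (hsep : Separates γ ℏ y x)
    (s : ℝ) {p q : Fin (m + 1) → Polynomial ℂ} (hp : ∀ j, (p j).natDegree = j)
    (hp' : ∀ j, (p j).Monic) (hq : ∀ j, (q j).natDegree = j) (hq' : ∀ j, (q j).Monic) :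
    momentDet γ ℏ s y x p = momentDet γ ℏ s y x q := by
  obtain ⟨κ, hκ, -, h⟩ := integral_contourPullback (n := m + 1) (m := m)
  have h0 := I_mul_ne_zero hℏ
  have ey : (fun b => y b * (Complex.I * ℏ) / (Complex.I * ℏ)) = y := by
    ext b; exact mul_div_cancel_right₀ _ h0
  have ex : (fun b => x b * (Complex.I * ℏ) / (Complex.I * ℏ)) = x := by
    ext b; exact mul_div_cancel_right₀ _ h0
  have h1 := (h ℏ s (fun b => y b * (Complex.I * ℏ)) (fun b => x b * (Complex.I * ℏ)) γ p hp hp'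
    fun j k => by
      rw [ey, ex]; exact integrable_momentIntegrand hγ hℏ hsep s (p j) k).2
  have h2 := (h ℏ s (fun b => y b * (Complex.I * ℏ)) (fun b => x b * (Complex.I * ℏ)) γ q hq hq'
    fun j k => by
      rw [ey, ex]; exact integrable_momentIntegrand hγ hℏ hsep s (q j) k).2
  rw [h1, ey, ex] at h2
  have hf : ((m + 1).factorial : ℂ) ≠ 0 := by exact_mod_cast (m + 1).factorial_ne_zero
  exact mul_left_cancel₀ hf (mul_left_cancel₀ hκ h2)

theorem Separates.y_sub_x_ne_zero (hγ : IsStripContour γ) (hsep : Separates γ ℏ y x)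
    (a : Fin (m + 1)) (b : Fin m) : y a - x b ≠ 0 := by
  intro h
  refine (hsep.above a 0).not_liesBelow hγ ?_
  have := hsep.below b 0
  rw [_root_.sub_eq_zero] at h
  simpa [h] using this

theorem Separates.update (hsep : Separates γ ℏ y x) (b : Fin m) :
    Separates γ ℏ y (Function.update x b (x b - 1)) := by
  refine ⟨hsep.above, fun c k => ?_⟩
  rcases eq_or_ne c b with rfl | h
  · have := hsep.below c (k + 1)
    push_cast at this
    rw [Function.update_self]
    convert! this using 2
    ring
  · rw [Function.update_of_ne h]
    exact hsep.below c k

theorem barnesMoment_update (hℏ : 0 < ℏ) (hsep : Separates γ ℏ y x) (s : ℝ) (b : Fin m)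
    (p : Polynomial ℂ) (k : ℕ) :
    barnesMoment γ ℏ s y (Function.update x b (x b - 1)) p k =
      barnesMoment γ ℏ s y x ((Polynomial.X - Polynomial.C (x b)) * p) k := by
  refine contourIntegral_congr fun t => ?_
  have hne := (hsep.sub_ne_zero hℏ t).2
  generalize γ t / (Complex.I * ℏ) = z at hne
  have e : ∏ c, Complex.Gamma (z - Function.update x b (x b - 1) c) =
      (z - x b) * ∏ c, Complex.Gamma (z - x c) := by
    rw [← Finset.mul_prod_erase _ _ (Finset.mem_univ b),
      ← Finset.mul_prod_erase _ (fun c => Complex.Gamma (z - x c)) (Finset.mem_univ b),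
      Function.update_self, ← mul_assoc, ← Complex.Gamma_add_one _ (hne b)]
    congr 1
    · congr 1
      ring
    · refine Finset.prod_congr rfl fun c hc => ?_
      rw [Function.update_of_ne (Finset.ne_of_mem_erase hc)]
  simp only [barnesWeight, e, Polynomial.eval_mul, Polynomial.eval_sub, Polynomial.eval_X,
    Polynomial.eval_C]
  ring

theorem barnesMoment_prod_X_sub (hγ : IsStripContour γ) (hℏ : 0 < ℏ) (hsep : Separates γ ℏ y x)
    (s : ℝ) (k : Fin (m + 1)) :
    barnesMoment γ ℏ s y x (∏ b, (Polynomial.X - Polynomial.C (y b))) k =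
      -Complex.exp s * barnesMoment γ ℏ s y x (∏ b, (Polynomial.X - Polynomial.C (x b))) k := by
  have e : ∏ b, (Polynomial.X - Polynomial.C (y b)) =
      Polynomial.C ((-1) ^ (m + 1)) * ∏ b, (Polynomial.C (y b) - Polynomial.X) := by
    have : ∀ b, Polynomial.X - Polynomial.C (y b) =
        Polynomial.C (-1) * (Polynomial.C (y b) - Polynomial.X) := fun b => by
      rw [Polynomial.C_neg, Polynomial.C_1]; ring
    simp only [this, Finset.prod_mul_distrib, Finset.prod_const, Finset.card_univ,
      Fintype.card_fin, Polynomial.C_pow]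
  rw [e, barnesMoment_C_mul, barnesMoment_prod_sub hγ hℏ hsep, ← mul_assoc, ← mul_assoc, ← pow_add]
  congr 1
  rw [show m + 1 + m = 2 * m + 1 by ring, pow_succ, pow_mul]
  norm_num

end

/-- The determinant of the moments under the shift of one of the `x b`. -/
theorem momentDet_update {m : ℕ} {γ : ℝ → ℂ} {ℏ : ℝ} {y : Fin (m + 2) → ℂ} {x : Fin (m + 1) → ℂ}
    (hγ : IsStripContour γ) (hℏ : 0 < ℏ) (hsep : Separates γ ℏ y x) (s : ℝ) (b : Fin (m + 1)) :
    momentDet γ ℏ s y (Function.update x b (x b - 1)) (fun j => Polynomial.X ^ (j : ℕ)) =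
      (∏ a, (y a - x b)) * momentDet γ ℏ s y x fun j => Polynomial.X ^ (j : ℕ) := by
  set P : Polynomial ℂ := ∏ c ∈ Finset.univ.erase b, (Polynomial.X - Polynomial.C (x c)) with hP
  set Y : Polynomial ℂ := ∏ a, (Polynomial.X - Polynomial.C (y a)) with hY
  set q : Polynomial ℂ := Y /ₘ (Polynomial.X - Polynomial.C (x b)) with hq
  set p₀ : Fin (m + 1) → Polynomial ℂ :=
    Fin.snoc (α := fun _ => Polynomial ℂ) (fun j : Fin m => Polynomial.X ^ (j : ℕ)) P with hp₀
  have hPm : P.Monic := Polynomial.monic_prod_of_monic _ _ fun c _ => Polynomial.monic_X_sub_C _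
  have hPd : P.natDegree = m := by
    rw [hP, Polynomial.natDegree_prod_of_monic _ _ fun c _ => Polynomial.monic_X_sub_C _]
    simp
  have hYm : Y.Monic := Polynomial.monic_prod_of_monic _ _ fun c _ => Polynomial.monic_X_sub_C _
  have hYd : Y.natDegree = m + 2 := by
    rw [hY, Polynomial.natDegree_prod_of_monic _ _ fun c _ => Polynomial.monic_X_sub_C _]
    simp
  have hqd : q.natDegree = m + 1 := by
    rw [hq, Polynomial.natDegree_divByMonic _ (Polynomial.monic_X_sub_C _), hYd,
      Polynomial.natDegree_X_sub_C]
    rfl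
  have hqm : q.Monic := by
    rw [Polynomial.Monic, hq, Polynomial.leadingCoeff_divByMonic_X_sub_C, hYm]
    rw [Polynomial.degree_eq_natDegree hYm.ne_zero, hYd]
    exact_mod_cast (Nat.succ_ne_zero (m + 1))
  -- Division with remainder: (X - x_b) q = Y - Y(x_b).
  have hqY : (Polynomial.X - Polynomial.C (x b)) * q = Y + Polynomial.C (-Y.eval (x b)) * 1 := by
    have := Polynomial.modByMonic_add_div Y (Polynomial.X - Polynomial.C (x b))
    rw [Polynomial.modByMonic_X_sub_C_eq_C_eval] at this
    rw [mul_one, Polynomial.C_neg]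
    linear_combination this
  have hp₀d : ∀ j, (p₀ j).natDegree = j := by
    intro j
    refine Fin.lastCases ?_ (fun i => ?_) j
    · simpa [hp₀] using hPd
    · simp [hp₀]
  have hp₀m : ∀ j, (p₀ j).Monic := by
    intro j
    refine Fin.lastCases ?_ (fun i => ?_) j
    · simpa [hp₀] using hPm
    · simp [hp₀]
  -- Shifting x_b multiplies each polynomial by X - x_b. With the basis p the last row then becomes
  -- that of Y minus Y(x_b) times that of 1, and contiguity makes the row of Y equal to -e^s times
  -- the row of (X - x_b)P, already present. What is left is the matrix for the monic basis p' with
  -- the original x, rotated.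
  set p : Fin (m + 2) → Polynomial ℂ := Fin.snoc (α := fun _ => Polynomial ℂ) p₀ q with hp
  set p' : Fin (m + 2) → Polynomial ℂ := Fin.cons (α := fun _ => Polynomial ℂ) 1
    (fun j => (Polynomial.X - Polynomial.C (x b)) * p₀ j) with hp'
  have h1 : momentDet γ ℏ s y (Function.update x b (x b - 1)) (fun j => Polynomial.X ^ (j : ℕ)) =
      momentDet γ ℏ s y (Function.update x b (x b - 1)) p := by
    refine momentDet_eq_of_monic hγ hℏ (hsep.update b) s (fun j => by simp)
      (fun j => Polynomial.monic_X_pow _) (fun j => ?_) fun j => ?_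
    · refine Fin.lastCases ?_ (fun i => ?_) j
      · simpa [hp] using hqd
      · simpa [hp] using hp₀d i
    · refine Fin.lastCases ?_ (fun i => ?_) j
      · simpa [hp] using hqm
      · simpa [hp] using hp₀m i
  have h2 : (momentDet γ ℏ s y x fun j => Polynomial.X ^ (j : ℕ)) = momentDet γ ℏ s y x p' := by
    refine momentDet_eq_of_monic hγ hℏ hsep s (fun j => by simp)
      (fun j => Polynomial.monic_X_pow _) (fun j => ?_) fun j => ?_
    · refine Fin.cases ?_ (fun i => ?_) j
      · simp [hp']
      · simp only [hp', Fin.cons_succ, Fin.val_succ]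
        rw [(Polynomial.monic_X_sub_C _).natDegree_mul (hp₀m i), hp₀d,
          Polynomial.natDegree_X_sub_C, add_comm]
    · refine Fin.cases ?_ (fun i => ?_) j
      · simp [hp']
      · simpa [hp'] using (Polynomial.monic_X_sub_C (x b)).mul (hp₀m i)
  set R : Fin (m + 1) → Fin (m + 2) → ℂ := fun j k =>
    barnesMoment γ ℏ s y x ((Polynomial.X - Polynomial.C (x b)) * p₀ j) k with hR
  set V : Fin (m + 2) → ℂ := fun k => barnesMoment γ ℏ s y x 1 k with hV
  have h3 : momentDet γ ℏ s y x p' =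
      (Matrix.of (Fin.cons V R : Fin (m + 2) → Fin (m + 2) → ℂ)).det := by
    rw [momentDet]
    congr 1
    ext j k
    refine Fin.cases ?_ (fun i => ?_) j <;> simp [hp', hV, hR]
  have h4 : momentDet γ ℏ s y (Function.update x b (x b - 1)) p =
      (Matrix.of (Fin.snoc R (-Complex.exp s • R (Fin.last m) + -Y.eval (x b) • V) :
        Fin (m + 2) → Fin (m + 2) → ℂ)).det := by
    rw [momentDet]
    congr 1
    ext j k
    rw [Matrix.of_apply, Matrix.of_apply, barnesMoment_update hℏ hsep]
    refine Fin.lastCases ?_ (fun i => ?_) j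
    · have hX : (Polynomial.X - Polynomial.C (x b)) * P =
          ∏ c, (Polynomial.X - Polynomial.C (x c)) :=
        Finset.mul_prod_erase _ (fun c => Polynomial.X - Polynomial.C (x c)) (Finset.mem_univ b)
      simp only [hp, Fin.snoc_last, Pi.add_apply, Pi.smul_apply, smul_eq_mul, hR, hV, hp₀]
      rw [hqY, barnesMoment_add hγ hℏ hsep, barnesMoment_C_mul, hX,
        barnesMoment_prod_X_sub hγ hℏ hsep]
    · simp [hp, hR]
  rw [h1, h2, h3, h4, det_snoc_add_smul]
  congr 1
  rw [hY, Polynomial.eval_prod]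
  simp only [Polynomial.eval_sub, Polynomial.eval_X, Polynomial.eval_C]
  -- The signs from -Y(x_b), from the rotation and from reversing m + 2 differences cancel.
  have : ∀ a, y a - x b = -1 * (x b - y a) := fun a => by ring
  simp only [this, Finset.prod_mul_distrib, Finset.prod_const, Finset.card_univ, Fintype.card_fin]
  ring

/-! ### Integrals over vertical lines and Mellin inversion -/

theorem div_I_mul_one (t c : ℝ) :
    ((t : ℂ) + c * Complex.I) / (Complex.I * (1 : ℝ)) = c + (-t : ℝ) * Complex.I := by
  rw [Complex.ofReal_one, mul_one, Complex.div_I]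
  push_cast
  linear_combination (-c : ℂ) * Complex.I_sq

theorem integral_vertical_eq {a₀ b₀ α A : ℝ} {F : ℂ → ℂ}
    (hF : DifferentiableOn ℂ F {z | a₀ < z.re ∧ z.re < b₀}) (hA : ∀ c ∈ Icc a₀ b₀, |c| ≤ A)
    (hg : VertGrowth A α F) (hα : α < 0) {a : ℝ} (ha : a ∈ Ioo a₀ b₀) :
    Integrable (fun τ : ℝ => F (a + τ * Complex.I)) ∧ ∀ b ∈ Ioo a₀ b₀,
      ∫ τ : ℝ, F (a + τ * Complex.I) = ∫ τ : ℝ, F (b + τ * Complex.I) := by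
  -- Centre and half-width of the vertical strip: after recentring and a quarter turn it becomes
  -- `openStrip L`, where Cauchy's theorem applies.
  set c : ℝ := (a₀ + b₀) / 2 with hc
  set L : ℝ := (b₀ - a₀) / 2 with hL
  have hline : ∀ b ∈ Ioo a₀ b₀, ∀ t, |(horizontalLine (b - c) t).im| < L := by
    intro b hb t
    rw [horizontalLine_im, abs_lt]
    constructor <;> simp only [hc, hL] <;> linarith [hb.1, hb.2]
  set f : ℂ → ℂ := fun w => F (w / (Complex.I * (1 : ℝ)) + c) with hf
  have hre : ∀ w : ℂ, (w / (Complex.I * (1 : ℝ)) + c).re = w.im + c := fun w => by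
    rw [Complex.add_re, div_I_mul_re one_pos, Complex.ofReal_re, div_one]
  have him : ∀ w : ℂ, (w / (Complex.I * (1 : ℝ)) + c).im = -w.re := fun w => by
    rw [← Complex.re_add_im w, div_I_mul_one]
    simp
  have hmem : ∀ w ∈ openStrip L, a₀ < w.im + c ∧ w.im + c < b₀ := by
    intro w hw
    have := abs_lt.1 (show |w.im| < L from hw)
    constructor <;> simp only [hc, hL] at this ⊢ <;> linarith [this.1, this.2]
  have hfd : DifferentiableOn ℂ f (openStrip L) := by
    refine hF.comp ((differentiable_id.div_const _).add_const _).differentiableOn fun w hw => ?_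
    change a₀ < (w / (Complex.I * (1 : ℝ)) + c).re ∧ (w / (Complex.I * (1 : ℝ)) + c).re < b₀
    rw [hre]
    exact hmem w hw
  have hq : QuadDecay L f := by
    obtain ⟨R, C, hC, h⟩ := hg.exists_bound hα
    refine ⟨R, C, fun w hw hR => ?_⟩
    have h1 := h (w / (Complex.I * (1 : ℝ)) + c) ?_ (by rw [him, abs_neg]; exact hR)
    · rwa [him, neg_sq] at h1
    rw [hre]
    obtain ⟨h2, h3⟩ := hmem w hw
    have h4 := (le_abs_self _).trans (hA b₀ ⟨by linarith, le_rfl⟩)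
    have h5 := (neg_le_abs _).trans (hA a₀ ⟨le_rfl, by linarith⟩)
    rw [abs_lt]
    constructor <;> linarith
  have hval : ∀ (b t : ℝ), f (t + (b - c : ℝ) * Complex.I) = F (b + (-t : ℝ) * Complex.I) := by
    intro b t
    simp only [hf]
    rw [div_I_mul_one]
    congr 1
    push_cast
    ring
  have hInt : ∀ b, contourIntegral (horizontalLine (b - c)) f =
      ∫ τ : ℝ, F (b + τ * Complex.I) := by
    intro b
    rw [contourIntegral_horizontalLine]
    simp only [hval]
    exact integral_neg_eq_self (fun τ : ℝ => F (b + τ * Complex.I)) volume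
  refine ⟨?_, fun b hb => ?_⟩
  · have h1 := (isStripContour_horizontalLine (a - c)).integrable_of_quadDecay (hline a ha)
      (hfd.continuousOn.mono (range_subset_iff.2 (hline a ha))) hq
    simp only [(hasDerivAt_horizontalLine _ _).deriv, mul_one, horizontalLine, hval] at h1
    simpa using h1.comp_neg
  · rw [← hInt, ← hInt]
    exact contourIntegral_eq_of_differentiableOn (isStripContour_horizontalLine _)
      (isStripContour_horizontalLine _) (hline a ha) (hline b hb) hfd hq

theorem differentiableAt_Gamma_of_re_pos {z : ℂ} (hz : 0 < z.re) :
    DifferentiableAt ℂ Complex.Gamma z := by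
  refine Complex.differentiableAt_Gamma _ fun m hm => ?_
  rw [hm] at hz
  simp at hz
  linarith [(m.cast_nonneg : (0 : ℝ) ≤ m)]

/-- The Mellin inversion formula for the exponential. -/
theorem integral_Gamma_mul_exp (y : ℂ) {a : ℝ} (ha : a < y.re) (s : ℝ) :
    ∫ τ : ℝ, Complex.Gamma (y - (a + τ * Complex.I)) * Complex.exp (s * (a + τ * Complex.I)) =
      2 * Real.pi * (Complex.exp (s * y) * Complex.exp (-Complex.exp s)) := by
  set σ : ℝ := y.re - a with hσ
  have hσ0 : 0 < σ := by linarith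
  set f : ℝ → ℂ := fun x => (Real.exp (-x) : ℂ) with hf
  have hmel : ∀ z : ℂ, 0 < z.re → mellin f z = Complex.Gamma z := fun z hz => by
    rw [Complex.Gamma_eq_integral hz, Complex.GammaIntegral_eq_mellin]
  have hre : ∀ v : ℝ, 0 < ((σ : ℂ) + v * Complex.I).re := fun v => by simpa using hσ0
  have hconv : MellinConvergent f σ := by
    have := Complex.GammaIntegral_convergent (s := (σ : ℂ)) (by simpa using hσ0)
    refine this.congr_fun (fun x _ => ?_) measurableSet_Ioi
    simp only [hf, smul_eq_mul]
    rw [mul_comm]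
  have hvert : Complex.VerticalIntegrable (mellin f) σ := by
    have h1 := (integral_vertical_eq (a₀ := 0) (b₀ := σ + 1) (A := σ + 1) (a := σ)
      (F := fun z => Complex.Gamma (z + 0)) (fun z hz => ?_) (fun c hc => ?_)
      (VertGrowth.gamma_add _ 0) (by linarith [Real.pi_pos]) ⟨hσ0, by linarith⟩).1
    · refine h1.congr (Eventually.of_forall fun v => ?_)
      beta_reduce
      rw [add_zero, hmel _ (hre v)]
    · simp only [add_zero]
      exact (differentiableAt_Gamma_of_re_pos hz.1).differentiableWithinAt
    · rw [abs_of_nonneg hc.1]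
      exact hc.2
  have hinv := mellinInv_mellin_eq σ f (Real.exp_pos s) hconv hvert
    (by simp only [hf]; fun_prop)
  rw [mellinInv] at hinv
  have hpi : (Real.pi : ℂ) ≠ 0 := by exact_mod_cast Real.pi_ne_zero
  have e1 : ∫ v : ℝ, ((Real.exp s : ℝ) : ℂ) ^ (-((σ : ℂ) + v * Complex.I)) •
      mellin f ((σ : ℂ) + v * Complex.I) = Complex.exp (-(s * y)) *
      ∫ τ : ℝ, Complex.Gamma (y - (a + τ * Complex.I)) * Complex.exp (s * (a + τ * Complex.I)) := by
    -- The substitution v = Im y - τ turns σ + iv into y - (a + iτ).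
    rw [← integral_sub_left_eq_self _ volume y.im, ← integral_const_mul]
    congr 1
    ext τ
    have e2 : (σ : ℂ) + ((y.im - τ : ℝ) : ℂ) * Complex.I = y - (a + τ * Complex.I) := by
      simp only [hσ]
      push_cast
      linear_combination Complex.re_add_im y
    rw [hmel _ (hre _), e2, smul_eq_mul, Complex.cpow_def_of_ne_zero
      (by exact_mod_cast (Real.exp_pos s).ne'), ← Complex.ofReal_log (Real.exp_pos s).le,
      Real.log_exp, mul_left_comm, ← Complex.exp_add, mul_comm]
    congr 2
    ring
  rw [e1] at hinv
  simp only [hf] at hinv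
  rw [Complex.real_smul] at hinv
  push_cast at hinv
  have e3 : Complex.exp (s * y) * Complex.exp (-(s * y)) = 1 := by
    rw [← Complex.exp_add, add_neg_cancel, Complex.exp_zero]
  rw [← hinv]
  generalize (∫ τ : ℝ, Complex.Gamma (y - (a + τ * Complex.I)) *
    Complex.exp (s * (a + τ * Complex.I))) = J
  have e4 : (2 * Real.pi : ℂ) * (1 / (2 * Real.pi)) = 1 := by field_simp
  linear_combination (-J * Complex.exp (s * y) * Complex.exp (-(s * y))) * e4 - J * e3

theorem tendsto_exp_neg_exp :
    Tendsto (fun s : ℝ => Complex.exp (-Complex.exp s)) atBot (𝓝 1) := by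
  have h1 : Tendsto (fun s : ℝ => ((Real.exp s : ℝ) : ℂ)) atBot (𝓝 0) := by
    have := (Complex.continuous_ofReal.tendsto 0).comp Real.tendsto_exp_atBot
    simpa [Function.comp_def] using this
  have := (Complex.continuous_exp.tendsto _).comp h1.neg
  simpa [Function.comp_def] using this

/-- The leading term, as `s → -∞`, of an inverse Mellin transform with a simple pole at `y`. -/
theorem tendsto_integral_Gamma_mul {y : ℂ} {a₀ a A : ℝ} (ha₀ : a₀ < a) (ha : a < y.re)
    {g : ℂ → ℂ} (hg : DifferentiableOn ℂ g {z | a₀ < z.re})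
    (hA : ∀ c ∈ Icc a₀ (y.re + 1), |c| ≤ A) (hgr : VertGrowth A 0 g) :
    Tendsto (fun s : ℝ => Complex.exp (-(s * y)) * ∫ τ : ℝ,
      Complex.exp (s * (a + τ * Complex.I)) * Complex.Gamma (y - (a + τ * Complex.I)) *
        g (a + τ * Complex.I)) atBot (𝓝 (2 * Real.pi * g y)) := by
  -- Write g(z) = g(y) + (z - y)h(z). The constant part is evaluated exactly by Mellin inversion. In
  -- the other part z - y cancels the pole of Γ(y - z) at y, so the line can be moved past y to Re y
  -- + 1/2.
  set h : ℂ → ℂ := dslope g y with hh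
  have hopen : IsOpen {z : ℂ | a₀ < z.re} := isOpen_lt continuous_const Complex.continuous_re
  have hhd : DifferentiableOn ℂ h {z | a₀ < z.re} :=
    (Complex.differentiableOn_dslope (hopen.mem_nhds (ha₀.trans ha))).2 hg
  set F : ℝ → ℂ → ℂ := fun s z => Complex.exp (s * z) * (Complex.Gamma (y + 1 - z) * h z) with hF
  have hFd : ∀ s, DifferentiableOn ℂ (F s) {z | a₀ < z.re ∧ z.re < y.re + 1} := by
    intro s
    refine DifferentiableOn.mul (by fun_prop) (DifferentiableOn.mul (fun z hz => ?_)
      (hhd.mono fun z hz => hz.1))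
    have h1 : DifferentiableAt ℂ Complex.Gamma (y + 1 - z) :=
      differentiableAt_Gamma_of_re_pos (by simpa using hz.2)
    have h2 : DifferentiableAt ℂ (fun z : ℂ => y + 1 - z) z := by fun_prop
    exact (h1.comp z h2).differentiableWithinAt
  have hFg : ∀ s, VertGrowth A (-(Real.pi / 2)) (F s) := by
    intro s
    have := (VertGrowth.exp_real A s).mul ((VertGrowth.gamma_sub A (y + 1)).mul (hgr.dslope y))
    rwa [add_zero, zero_add] at this
  have hneg : -(Real.pi / 2) < 0 := by linarith [Real.pi_pos]
  have haI : a ∈ Ioo a₀ (y.re + 1) := ⟨ha₀, by linarith⟩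
  have ha'I : y.re + 1 / 2 ∈ Ioo a₀ (y.re + 1) := ⟨by linarith, by linarith⟩
  have hGi : ∀ s : ℝ, Integrable fun τ : ℝ =>
      Complex.Gamma (y - (a + τ * Complex.I)) * Complex.exp (s * (a + τ * Complex.I)) := by
    intro s
    refine (integral_vertical_eq (a₀ := a₀) (b₀ := y.re) (A := A) (a := a)
      (F := fun z => Complex.Gamma (y - z) * Complex.exp (s * z)) (fun z hz => ?_)
      (fun c hc => hA c ⟨hc.1, by linarith [hc.2]⟩)
      ((VertGrowth.gamma_sub A y).mul (VertGrowth.exp_real A s)) (by linarith) ⟨ha₀, ha⟩).1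
    have h1 : DifferentiableAt ℂ Complex.Gamma (y - z) :=
      differentiableAt_Gamma_of_re_pos (by simpa using hz.2)
    have h2 : DifferentiableAt ℂ (fun z : ℂ => y - z) z := by fun_prop
    exact ((h1.comp z h2).mul (by fun_prop)).differentiableWithinAt
  have hsplit : ∀ s : ℝ, Complex.exp (-(s * y)) * ∫ τ : ℝ,
      Complex.exp (s * (a + τ * Complex.I)) * Complex.Gamma (y - (a + τ * Complex.I)) *
        g (a + τ * Complex.I) = 2 * Real.pi * g y * Complex.exp (-Complex.exp s) -
      Complex.exp (-(s * y)) * ∫ τ : ℝ, F s ((y.re + 1 / 2 : ℝ) + τ * Complex.I) := by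
    intro s
    rw [← (integral_vertical_eq (hFd s) hA (hFg s) hneg haI).2 _ ha'I]
    have e1 : ∀ τ : ℝ, Complex.exp (s * (a + τ * Complex.I)) *
        Complex.Gamma (y - (a + τ * Complex.I)) * g (a + τ * Complex.I) =
        g y * (Complex.Gamma (y - (a + τ * Complex.I)) * Complex.exp (s * (a + τ * Complex.I))) -
          F s (a + τ * Complex.I) := by
      intro τ
      set z : ℂ := a + τ * Complex.I with hz
      have hzy : y - z ≠ 0 := by
        intro h0
        have := congrArg Complex.re h0
        simp [hz] at this
        linarith
      have e2 : Complex.Gamma (y + 1 - z) = (y - z) * Complex.Gamma (y - z) := by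
        rw [← Complex.Gamma_add_one _ hzy]
        congr 1
        ring
      have e3 : (z - y) * h z = g z - g y := by
        simpa using sub_smul_dslope g y z
      simp only [hF]
      rw [e2]
      linear_combination (-(Complex.exp (s * z) * Complex.Gamma (y - z))) * e3
    simp only [e1]
    rw [integral_sub ((hGi s).const_mul _) (integral_vertical_eq (hFd s) hA (hFg s) hneg haI).1,
      integral_const_mul, integral_Gamma_mul_exp y ha s]
    have e3 : Complex.exp (-(s * y)) * Complex.exp (s * y) = 1 := by
      rw [← Complex.exp_add, neg_add_cancel, Complex.exp_zero]
    linear_combination (2 * Real.pi * g y * Complex.exp (-Complex.exp s)) * e3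
  simp only [hsplit]
  have hlim1 : Tendsto (fun s : ℝ => 2 * Real.pi * g y * Complex.exp (-Complex.exp s)) atBot
      (𝓝 (2 * Real.pi * g y)) := by
    simpa using tendsto_exp_neg_exp.const_mul (2 * Real.pi * g y)
  -- On the new line |e^{s(z - y)}| has size e^{s/2} up to a factor bounded in s for given τ, namely
  -- one not involving s in Re(z - y); after extracting e^{-sy} the remainder is O(e^{s/2}).
  have hlim2 : Tendsto (fun s : ℝ => Complex.exp (-(s * y)) *
      ∫ τ : ℝ, F s ((y.re + 1 / 2 : ℝ) + τ * Complex.I)) atBot (𝓝 0) := by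
    have hb : Tendsto (fun s : ℝ => Real.exp (s * (1 / 2)) *
        ∫ τ : ℝ, ‖F 0 ((y.re + 1 / 2 : ℝ) + τ * Complex.I)‖) atBot (𝓝 0) := by
      have h1 : Tendsto (fun s : ℝ => Real.exp (s * (1 / 2))) atBot (𝓝 0) :=
        Real.tendsto_exp_atBot.comp (tendsto_id.atBot_mul_const (by norm_num))
      simpa using h1.mul_const _
    refine squeeze_zero_norm (fun s => ?_) hb
    have h2 : ∀ τ : ℝ, ‖F s ((y.re + 1 / 2 : ℝ) + τ * Complex.I)‖ =
        Real.exp (s * (y.re + 1 / 2)) * ‖F 0 ((y.re + 1 / 2 : ℝ) + τ * Complex.I)‖ := by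
      intro τ
      simp only [hF, norm_mul, Complex.norm_exp]
      simp
    rw [norm_mul, Complex.norm_exp]
    refine (mul_le_mul_of_nonneg_left (norm_integral_le_integral_norm _)
      (Real.exp_pos _).le).trans (le_of_eq ?_)
    simp only [h2]
    rw [integral_const_mul, ← mul_assoc, ← Real.exp_add]
    congr 2
    simp
    ring
  simpa using hlim1.sub hlim2

/-! ### The differential equation in s -/

theorem hasDerivAt_det {n : ℕ} {M : ℝ → Matrix (Fin n) (Fin n) ℂ} {M' : Matrix (Fin n) (Fin n) ℂ}
    {s : ℝ} (h : ∀ i j, HasDerivAt (fun s => M s i j) (M' i j) s) :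
    HasDerivAt (fun s => (M s).det) (∑ i, ((M s).updateRow i (M' i)).det) s := by
  have h1 : ∀ σ : Equiv.Perm (Fin n), HasDerivAt
      (fun s => ((Equiv.Perm.sign σ : ℤ) : ℂ) * ∏ i, (M s).transpose (σ i) i)
      (((Equiv.Perm.sign σ : ℤ) : ℂ) *
        ∑ i, (∏ j ∈ Finset.univ.erase i, (M s).transpose (σ j) j) • M'.transpose (σ i) i) s := fun σ =>
    (HasDerivAt.fun_finsetProd fun i _ => h i (σ i)).const_mul _
  have h2 := HasDerivAt.fun_sum (u := Finset.univ) fun σ _ => h1 σ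
  have e : (fun s => (M s).det) =
      fun s => ∑ σ : Equiv.Perm (Fin n), ((Equiv.Perm.sign σ : ℤ) : ℂ) * ∏ i, (M s).transpose (σ i) i := by
    ext s
    rw [← Matrix.det_transpose, Matrix.det_apply']
  rw [e]
  refine h2.congr_deriv ?_
  simp only [Finset.mul_sum]
  rw [Finset.sum_comm]
  refine Finset.sum_congr rfl fun i _ => ?_
  rw [← Matrix.det_transpose, Matrix.det_apply']
  refine Finset.sum_congr rfl fun σ _ => ?_
  congr 1
  rw [← Finset.mul_prod_erase _ _ (Finset.mem_univ i), smul_eq_mul, mul_comm]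
  congr 1
  · simp [Matrix.transpose_apply]
  · refine Finset.prod_congr rfl fun j hj => ?_
    rw [Matrix.transpose_apply, Matrix.transpose_apply,
      Matrix.updateRow_ne (Finset.ne_of_mem_erase hj)]

section

variable {m : ℕ} {ℏ s a : ℝ} {y : Fin (m + 1) → ℂ} {x : Fin m → ℂ}

theorem separates_horizontalLine_mul (hℏ : 0 < ℏ) (hy : ∀ b, a < (y b).re)
    (hx : ∀ b, (x b).re < a) : Separates (horizontalLine (ℏ * a)) ℏ y x := by
  refine ⟨fun b k => liesAbove_of_forall_lt fun t => ?_,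
    fun b k => liesBelow_of_forall_lt fun t => ?_⟩
  · have e : (Complex.I * ℏ * (y b + k)).im = ℏ * ((y b).re + k) := by simp
    rw [horizontalLine_im, e]
    gcongr
    linarith [hy b, (k.cast_nonneg : (0 : ℝ) ≤ k)]
  · have e : (Complex.I * ℏ * (x b - k)).im = ℏ * ((x b).re - k) := by simp
    rw [horizontalLine_im, e]
    gcongr
    linarith [hx b, (k.cast_nonneg : (0 : ℝ) ≤ k)]

theorem separates_horizontalLine (hy : ∀ b, a < (y b).re) (hx : ∀ b, (x b).re < a) :
    Separates (horizontalLine a) 1 y x := by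
  simpa using separates_horizontalLine_mul one_pos hy hx

theorem barnesMoment_horizontalLine (a s : ℝ) (y : Fin (m + 1) → ℂ) (x : Fin m → ℂ)
    (p : Polynomial ℂ) (k : ℕ) :
    barnesMoment (horizontalLine a) 1 s y x p k =
      ∫ τ : ℝ, momentIntegrand s y x p k (a + τ * Complex.I) := by
  rw [barnesMoment, contourIntegral_horizontalLine]
  simp only [div_I_mul_one]
  exact integral_neg_eq_self (fun τ : ℝ => momentIntegrand s y x p k (a + τ * Complex.I)) volume

theorem integrable_vertical_momentIntegrand (hy : ∀ b, a < (y b).re) (hx : ∀ b, (x b).re < a)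
    (s : ℝ) (p : Polynomial ℂ) (k : Fin (m + 1)) :
    Integrable fun τ : ℝ => momentIntegrand s y x p k (a + τ * Complex.I) := by
  have h := integrable_momentIntegrand (isStripContour_horizontalLine a) one_pos
    (separates_horizontalLine hy hx) s p k
  simp only [(hasDerivAt_horizontalLine _ _).deriv, mul_one, horizontalLine, div_I_mul_one] at h
  simpa using h.comp_neg

theorem momentIntegrand_eq_exp_mul (s s₀ : ℝ) (y : Fin (m + 1) → ℂ) (x : Fin m → ℂ)
    (p : Polynomial ℂ) (k : ℕ) (z : ℂ) :
    momentIntegrand s y x p k z =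
      Complex.exp ((s - s₀ : ℝ) * z) * momentIntegrand s₀ y x p k z := by
  have : Complex.exp (s * z) = Complex.exp ((s - s₀ : ℝ) * z) * Complex.exp (s₀ * z) := by
    rw [← Complex.exp_add]
    congr 1
    push_cast
    ring
  rw [momentIntegrand, momentIntegrand, barnesWeight, barnesWeight, this]
  ring

theorem hasDerivAt_barnesMoment (hy : ∀ b, a < (y b).re) (hx : ∀ b, (x b).re < a)
    (s₀ : ℝ) (p : Polynomial ℂ) (k : Fin (m + 1)) :
    HasDerivAt (fun s => barnesMoment (horizontalLine a) 1 s y x p k)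
      (barnesMoment (horizontalLine a) 1 s₀ y x (Polynomial.X * p) k) s₀ := by
  simp only [barnesMoment_horizontalLine]
  have hX : ∀ (s : ℝ) (z : ℂ), momentIntegrand s y x (Polynomial.X * p) k z =
      z * momentIntegrand s y x p k z := by
    intro s z
    simp only [momentIntegrand, Polynomial.eval_mul, Polynomial.eval_X]
    ring
  refine (hasDerivAt_integral_of_dominated_loc_of_deriv_le (μ := volume)
    (F := fun s (τ : ℝ) => momentIntegrand s y x p k (a + τ * Complex.I))
    (F' := fun s (τ : ℝ) => momentIntegrand s y x (Polynomial.X * p) k (a + τ * Complex.I))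
    -- On the line Re z = a, for |s - s₀| < 1, the factor e^{(s - s₀)z} has modulus e^{(s - s₀)a} ≤
    -- e^{|a|}.
    (bound := fun (τ : ℝ) => Real.exp |a| *
      ‖momentIntegrand s₀ y x (Polynomial.X * p) k (a + τ * Complex.I)‖)
    (Metric.ball_mem_nhds s₀ one_pos)
    (Eventually.of_forall fun s =>
      (integrable_vertical_momentIntegrand hy hx s p k).aestronglyMeasurable)
    (integrable_vertical_momentIntegrand hy hx s₀ p k)
    (integrable_vertical_momentIntegrand hy hx s₀ _ k).aestronglyMeasurable
    (Eventually.of_forall fun τ s hs => ?_)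
    ((integrable_vertical_momentIntegrand hy hx s₀ _ k).norm.const_mul _)
    (Eventually.of_forall fun τ s hs => ?_)).2
  · rw [momentIntegrand_eq_exp_mul s s₀, norm_mul, Complex.norm_exp]
    refine mul_le_mul_of_nonneg_right (Real.exp_le_exp.2 ?_) (norm_nonneg _)
    have h1 : (((s - s₀ : ℝ) : ℂ) * (a + τ * Complex.I)).re = (s - s₀) * a := by simp
    rw [h1]
    refine (le_abs_self _).trans ?_
    rw [abs_mul]
    have : |s - s₀| < 1 := by simpa [Real.dist_eq] using hs
    exact mul_le_of_le_one_left (abs_nonneg a) this.le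
  · set z : ℂ := a + τ * Complex.I
    have e : (fun s : ℝ => momentIntegrand s y x p k z) = fun s : ℝ =>
        Complex.exp (s * z) * (p.eval z * trigExp (m + 1) k z *
          ((∏ b, Complex.Gamma (y b - z)) * ∏ b, Complex.Gamma (z - x b))) := by
      ext s
      rw [momentIntegrand, barnesWeight]
      ring
    change HasDerivAt (fun s : ℝ => momentIntegrand s y x p k z) _ s
    rw [e, hX]
    have h1 : HasDerivAt (fun s : ℝ => (s : ℂ) * z) (1 * z) s :=
      Complex.ofRealCLM.hasDerivAt.mul_const z
    refine (h1.cexp.mul_const _).congr_deriv ?_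
    rw [momentIntegrand, barnesWeight]
    ring

/-- `momentDet` of the monomials with the last one replaced by `p`. -/
noncomputable def lastMomentDet (γ : ℝ → ℂ) (ℏ s : ℝ) (y : Fin (m + 1) → ℂ) (x : Fin m → ℂ)
    (p : Polynomial ℂ) : ℂ :=
  momentDet γ ℏ s y x (Function.update (fun j => Polynomial.X ^ (j : ℕ)) (Fin.last m) p)

theorem lastMomentDet_eq (γ : ℝ → ℂ) (ℏ s : ℝ) (y : Fin (m + 1) → ℂ) (x : Fin m → ℂ)
    (p : Polynomial ℂ) : lastMomentDet γ ℏ s y x p =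
      ((Matrix.of fun j k : Fin (m + 1) =>
        barnesMoment γ ℏ s y x (Polynomial.X ^ (j : ℕ)) k).updateRow (Fin.last m)
          fun k => barnesMoment γ ℏ s y x p k).det := by
  rw [lastMomentDet, momentDet]
  congr 1
  ext j k
  rcases eq_or_ne j (Fin.last m) with rfl | h
  · simp
  · rw [Matrix.of_apply, Function.update_of_ne h, Matrix.updateRow_ne h, Matrix.of_apply]

theorem lastMomentDet_of_monic {γ : ℝ → ℂ} (hγ : IsStripContour γ) (hℏ : 0 < ℏ)
    (hsep : Separates γ ℏ y x) (s : ℝ) {p : Polynomial ℂ} (hp : p.Monic) (hd : p.natDegree = m) :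
    lastMomentDet γ ℏ s y x p = momentDet γ ℏ s y x fun j => Polynomial.X ^ (j : ℕ) := by
  refine momentDet_eq_of_monic hγ hℏ hsep s (fun j => ?_) (fun j => ?_) (fun j => by simp)
    fun j => Polynomial.monic_X_pow _
  · rcases eq_or_ne j (Fin.last m) with rfl | h
    · simpa using hd
    · simp [Function.update_of_ne h]
  · rcases eq_or_ne j (Fin.last m) with rfl | h
    · simpa using hp
    · simp [Function.update_of_ne h]

theorem lastMomentDet_add {γ : ℝ → ℂ} (hγ : IsStripContour γ) (hℏ : 0 < ℏ)
    (hsep : Separates γ ℏ y x) (s : ℝ) (p q : Polynomial ℂ) :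
    lastMomentDet γ ℏ s y x (p + q) = lastMomentDet γ ℏ s y x p + lastMomentDet γ ℏ s y x q := by
  simp only [lastMomentDet_eq]
  rw [← Matrix.det_updateRow_add]
  congr 2
  ext k
  exact barnesMoment_add hγ hℏ hsep s p q k

theorem lastMomentDet_C_mul (γ : ℝ → ℂ) (ℏ s : ℝ) (y : Fin (m + 1) → ℂ) (x : Fin m → ℂ) (c : ℂ)
    (p : Polynomial ℂ) :
    lastMomentDet γ ℏ s y x (Polynomial.C c * p) = c * lastMomentDet γ ℏ s y x p := by
  simp only [lastMomentDet_eq]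
  rw [← Matrix.det_updateRow_smul]
  congr 2
  ext k
  exact barnesMoment_C_mul γ ℏ s y x c p k

/-- Modulo degrees below m, which repeat earlier rows, X^{m+1} is Y + (∑ y_b) X^m; contiguity turns
the row of Y into -e^s times a row for a monic polynomial of degree m. -/
theorem lastMomentDet_X_pow {γ : ℝ → ℂ} (hγ : IsStripContour γ) (hℏ : 0 < ℏ)
    (hsep : Separates γ ℏ y x) (s : ℝ) :
    lastMomentDet γ ℏ s y x (Polynomial.X ^ (m + 1)) =
      (∑ b, y b - Complex.exp s) * momentDet γ ℏ s y x fun j => Polynomial.X ^ (j : ℕ) := by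
  set D := momentDet γ ℏ s y x fun j => Polynomial.X ^ (j : ℕ) with hD
  set Y : Polynomial ℂ := ∏ b, (Polynomial.X - Polynomial.C (y b)) with hY
  set Q : Polynomial ℂ := ∏ b, (Polynomial.X - Polynomial.C (x b)) with hQ
  set S : ℂ := ∑ b, y b with hS
  -- Subtracting S - 1 rather than S times X^m leaves q monic of degree m, so
  -- `lastMomentDet_of_monic` disposes of all lower terms at once.
  set q : Polynomial ℂ := Polynomial.X ^ (m + 1) - Y - Polynomial.C (S - 1) * Polynomial.X ^ m
    with hq
  have hYm : Y.Monic := Polynomial.monic_prod_of_monic _ _ fun c _ => Polynomial.monic_X_sub_C _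
  have hYd : Y.natDegree = m + 1 := by
    rw [hY, Polynomial.natDegree_prod_of_monic _ _ fun c _ => Polynomial.monic_X_sub_C _]
    simp
  have hQm : Q.Monic := Polynomial.monic_prod_of_monic _ _ fun c _ => Polynomial.monic_X_sub_C _
  have hQd : Q.natDegree = m := by
    rw [hQ, Polynomial.natDegree_prod_of_monic _ _ fun c _ => Polynomial.monic_X_sub_C _]
    simp
  have hYc : Y.coeff m = -S := by
    have := Polynomial.prod_X_sub_C_coeff_card_pred (Finset.univ : Finset (Fin (m + 1))) y
      (by simp)
    simpa using this
  have hqm : q.coeff m = 1 := by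
    simp only [hq, Polynomial.coeff_sub, Polynomial.coeff_C_mul, Polynomial.coeff_X_pow, hYc]
    simp
  have hqd : q.natDegree ≤ m := by
    rw [Polynomial.natDegree_le_iff_coeff_eq_zero]
    intro i hi
    rcases eq_or_lt_of_le (Nat.succ_le_of_lt hi) with h | h
    · have hYi : Y.coeff i = 1 := by
        rw [← h, Nat.succ_eq_add_one, ← hYd]
        exact hYm
      simp only [hq, Polynomial.coeff_sub, Polynomial.coeff_C_mul, Polynomial.coeff_X_pow, hYi]
      rw [if_pos h.symm, if_neg hi.ne']
      ring
    · have hYi : Y.coeff i = 0 := Polynomial.coeff_eq_zero_of_natDegree_lt (by omega)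
      simp only [hq, Polynomial.coeff_sub, Polynomial.coeff_C_mul, Polynomial.coeff_X_pow, hYi]
      rw [if_neg (by omega), if_neg hi.ne']
      ring
  have e1 : lastMomentDet γ ℏ s y x Y = -Complex.exp s * D := by
    rw [hD, ← lastMomentDet_of_monic hγ hℏ hsep s hQm hQd, lastMomentDet_eq, lastMomentDet_eq,
      ← Matrix.det_updateRow_smul]
    congr 2
    ext k
    exact barnesMoment_prod_X_sub hγ hℏ hsep s k
  have e2 : lastMomentDet γ ℏ s y x q = D :=
    lastMomentDet_of_monic hγ hℏ hsep s
      (Polynomial.monic_of_natDegree_le_of_coeff_eq_one m hqd hqm)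
      (Polynomial.natDegree_eq_of_le_of_coeff_ne_zero hqd (by rw [hqm]; exact one_ne_zero))
  have e3 : lastMomentDet γ ℏ s y x (Polynomial.X ^ m) = D :=
    lastMomentDet_of_monic hγ hℏ hsep s (Polynomial.monic_X_pow m) (by simp)
  have e4 : Polynomial.X ^ (m + 1) = Y + (q + Polynomial.C (S - 1) * Polynomial.X ^ m) := by
    rw [hq]
    ring
  rw [e4, lastMomentDet_add hγ hℏ hsep, lastMomentDet_add hγ hℏ hsep, lastMomentDet_C_mul, e1, e2,
    e3]
  ring

/-- Differentiation in s multiplies by z, turning the row of X^j into that of X^{j+1}. Except for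
the last row this duplicates the next one, so a single term survives. -/
theorem hasDerivAt_momentDet (hy : ∀ b, a < (y b).re) (hx : ∀ b, (x b).re < a) (s : ℝ) :
    HasDerivAt (fun s => momentDet (horizontalLine a) 1 s y x fun j => Polynomial.X ^ (j : ℕ))
      ((∑ b, y b - Complex.exp s) *
        momentDet (horizontalLine a) 1 s y x fun j => Polynomial.X ^ (j : ℕ)) s := by
  have hd := hasDerivAt_det (s := s)
    (M := fun s => Matrix.of fun j k : Fin (m + 1) =>
      barnesMoment (horizontalLine a) 1 s y x (Polynomial.X ^ (j : ℕ)) k)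
    (M' := Matrix.of fun j k : Fin (m + 1) =>
      barnesMoment (horizontalLine a) 1 s y x (Polynomial.X * Polynomial.X ^ (j : ℕ)) k)
    fun j k => hasDerivAt_barnesMoment hy hx s _ k
  refine hd.congr_deriv ?_
  rw [← lastMomentDet_X_pow (isStripContour_horizontalLine a) one_pos
    (separates_horizontalLine hy hx), lastMomentDet_eq, Fin.sum_univ_castSucc, Finset.sum_eq_zero,
    zero_add]
  · congr 2
    ext k
    simp [pow_succ']
  · intro i _
    refine Matrix.det_zero_of_row_eq (i := i.castSucc) (j := i.succ)
      (Fin.castSucc_lt_succ).ne ?_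
    rw [Matrix.updateRow_self, Matrix.updateRow_ne (Fin.castSucc_lt_succ).ne']
    ext k
    simp [pow_succ']

/-- The dependence of the determinant on `s`. -/
theorem momentDet_mul_exp_eq (hy : ∀ b, a < (y b).re) (hx : ∀ b, (x b).re < a) : ∃ K : ℂ, ∀ s : ℝ,
    (momentDet (horizontalLine a) 1 s y x fun j => Polynomial.X ^ (j : ℕ)) =
      K * (Complex.exp (s * ∑ b, y b) * Complex.exp (-Complex.exp s)) := by
  set D : ℝ → ℂ := fun s => momentDet (horizontalLine a) 1 s y x fun j => Polynomial.X ^ (j : ℕ)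
    with hD
  -- E is the integrating factor of the linear equation.
  set E : ℝ → ℂ := fun s => Complex.exp (-(s * ∑ b, y b)) * Complex.exp (Complex.exp s) with hE
  have hEd : ∀ s : ℝ, HasDerivAt E ((-(∑ b, y b) + Complex.exp s) * E s) s := by
    intro s
    have h0 : HasDerivAt (fun s : ℝ => (s : ℂ)) 1 s := Complex.ofRealCLM.hasDerivAt
    have h1 := (h0.mul_const (∑ b, y b)).fun_neg.cexp.fun_mul h0.cexp.cexp
    refine h1.congr_deriv ?_
    simp only [hE]
    ring
  have hconst : ∀ s t : ℝ, D s * E s = D t * E t := by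
    have hder : ∀ s : ℝ, HasDerivAt (fun s => D s * E s) 0 s := by
      intro s
      refine ((hasDerivAt_momentDet hy hx s).fun_mul (hEd s)).congr_deriv ?_
      ring
    exact is_const_of_deriv_eq_zero (fun s => (hder s).differentiableAt) fun s => (hder s).deriv
  refine ⟨D 0 * E 0, fun s => ?_⟩
  rw [hconst 0 s]
  simp only [hE]
  have e1 : Complex.exp (-(s * ∑ b, y b)) * Complex.exp (s * ∑ b, y b) = 1 := by
    rw [← Complex.exp_add, neg_add_cancel, Complex.exp_zero]
  have e2 : Complex.exp (Complex.exp s) * Complex.exp (-Complex.exp s) = 1 := by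
    rw [← Complex.exp_add, add_neg_cancel, Complex.exp_zero]
  change D s = _
  linear_combination (-D s * Complex.exp (Complex.exp s) * Complex.exp (-Complex.exp s)) * e1 -
    D s * e2

end

/-! ### The constant of integration, from s → -∞ -/

/-- A product of `m` shifted sines is a combination of the `m + 1` functions `trigExp`. -/
theorem exists_prod_sin_eq_sum {ι : Type*} {m : ℕ} (S : Finset ι) (hS : S.card = m) (y : ι → ℂ) :
    ∃ c : ℕ → ℂ, ∀ z, ∏ b ∈ S, Complex.sin (Real.pi * (y b - z)) / Real.pi =
      ∑ l : Fin (m + 1), c l * trigExp (m + 1) l z := by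
  have hpi : (Real.pi : ℂ) ≠ 0 := by exact_mod_cast Real.pi_ne_zero
  -- Up to the factor e^{-iπz}, each sine is linear in u = e^{2πiz}; the product of m of them is
  -- e^{-iπmz} times a polynomial of degree at most m in u.
  set q : ι → Polynomial ℂ := fun b =>
    Polynomial.C (Complex.I / (2 * Real.pi) * Complex.exp (-(Complex.I * Real.pi * y b))) *
      Polynomial.X + Polynomial.C (-(Complex.I / (2 * Real.pi)) *
        Complex.exp (Complex.I * Real.pi * y b)) with hq
  have hd : (∏ b ∈ S, q b).natDegree < m + 1 := by
    refine Nat.lt_succ_of_le ((Polynomial.natDegree_prod_le S q).trans ?_)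
    refine (Finset.sum_le_card_nsmul S _ 1 fun b _ => Polynomial.natDegree_linear_le).trans ?_
    simp [hS]
  refine ⟨(∏ b ∈ S, q b).coeff, fun z => ?_⟩
  set u : ℂ := Complex.exp (2 * Real.pi * Complex.I * z) with hu
  set e : ℂ := Complex.exp (-(Complex.I * Real.pi * z)) with he
  have h1 : ∀ b, Complex.sin (Real.pi * (y b - z)) / Real.pi = e * (q b).eval u := by
    intro b
    have e1 : e * (Complex.exp (-(Complex.I * Real.pi * y b)) * u) =
        Complex.exp (-(Real.pi * (y b - z)) * Complex.I) := by
      simp only [he, hu, ← Complex.exp_add]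
      congr 1
      ring
    have e2 : e * Complex.exp (Complex.I * Real.pi * y b) =
        Complex.exp (Real.pi * (y b - z) * Complex.I) := by
      simp only [he, ← Complex.exp_add]
      congr 1
      ring
    have e3 : e * (q b).eval u = Complex.I / (2 * Real.pi) *
        (e * (Complex.exp (-(Complex.I * Real.pi * y b)) * u) -
          e * Complex.exp (Complex.I * Real.pi * y b)) := by
      simp only [hq, Polynomial.eval_add, Polynomial.eval_mul, Polynomial.eval_C, Polynomial.eval_X]
      ring
    rw [e3, e1, e2, Complex.sin]
    field_simp
  simp only [h1, Finset.prod_mul_distrib, Finset.prod_const, hS]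
  rw [← Polynomial.eval_prod, Polynomial.eval_eq_sum_range' hd, Finset.mul_sum,
    ← Fin.sum_univ_eq_sum_range
      (fun l => e ^ m * ((∏ b ∈ S, q b).coeff l * u ^ l)) (m + 1)]
  refine Finset.sum_congr rfl fun l _ => ?_
  have h2 : trigExp (m + 1) l z = e ^ m * u ^ (l : ℕ) := by
    rw [trigExp, he, hu, ← Complex.exp_nat_mul, ← Complex.exp_nat_mul, ← Complex.exp_add]
    congr 1
    push_cast
    ring
  rw [h2]
  ring

theorem inv_Gamma_mul_Gamma_one_sub (u : ℂ) :
    (Complex.Gamma u)⁻¹ * (Complex.Gamma (1 - u))⁻¹ = Complex.sin (Real.pi * u) / Real.pi := by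
  rw [← mul_inv, Complex.Gamma_mul_Gamma_one_sub, inv_div]

/-- The sine cancels the poles of Γ and leaves the entire function 1/Γ(1 - u); this silences the
towers of poles at y_b, b ≠ k. -/
theorem Gamma_mul_sin {u : ℂ} (hu : 0 < u.re) :
    Complex.Gamma u * (Complex.sin (Real.pi * u) / Real.pi) = (Complex.Gamma (1 - u))⁻¹ := by
  rw [← inv_Gamma_mul_Gamma_one_sub, mul_inv_cancel_left₀ (Complex.Gamma_ne_zero_of_re_pos hu)]

theorem prod_prod_erase_eq_prod_offDiag {ι : Type*} [Fintype ι] [DecidableEq ι] (F : ι → ι → ℂ) :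
    ∏ k, ∏ b ∈ Finset.univ.erase k, F k b =
      ∏ p ∈ (Finset.univ : Finset ι).offDiag, F p.2 p.1 := by
  rw [Finset.prod_sigma']
  refine Finset.prod_bij' (fun p _ => (p.2, p.1)) (fun p _ => ⟨p.2, p.1⟩) ?_ ?_ ?_ ?_ ?_ <;>
    simp

section

variable {m : ℕ} {a : ℝ} {y : Fin (m + 1) → ℂ} {x : Fin m → ℂ}

/-- The leading behaviour of a moment that picks out a single tower of poles. -/
theorem tendsto_sum_barnesMoment (hy : ∀ b, a < (y b).re) (hx : ∀ b, (x b).re < a)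
    (p : Polynomial ℂ) (k : Fin (m + 1)) {c : ℕ → ℂ}
    (hc : ∀ z, ∏ b ∈ Finset.univ.erase k, Complex.sin (Real.pi * (y b - z)) / Real.pi =
      ∑ l : Fin (m + 1), c l * trigExp (m + 1) l z) :
    Tendsto (fun s : ℝ => Complex.exp (-(s * y k)) *
      ∑ l : Fin (m + 1), c l * barnesMoment (horizontalLine a) 1 s y x p l) atBot
      (𝓝 (2 * Real.pi * (p.eval (y k) * ((∏ b, Complex.Gamma (y k - x b)) *
        ∏ b ∈ Finset.univ.erase k, (Complex.Gamma (1 - (y b - y k)))⁻¹)))) := by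
  -- The cofactor of e^{sz} Γ(y_k - z) once the sines have acted: its only poles come from Γ(z -
  -- x_b), to the left of the line.
  set g : ℂ → ℂ := fun z => p.eval z * ((∏ b, Complex.Gamma (z - x b)) *
    ∏ b ∈ Finset.univ.erase k, (Complex.Gamma (1 - (y b - z)))⁻¹) with hg
  obtain ⟨a₀, hx₀, ha₀⟩ : ∃ a₀, (∀ b, (x b).re < a₀) ∧ a₀ < a := by
    have h1 : ∀ᶠ a₀ in 𝓝[<] a, ∀ b, (x b).re < a₀ :=
      eventually_all.2 fun b => nhdsWithin_le_nhds (lt_mem_nhds (hx b))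
    exact (h1.and self_mem_nhdsWithin).exists
  have hgd : DifferentiableOn ℂ g {z | a₀ < z.re} := by
    refine DifferentiableOn.mul p.differentiable.differentiableOn (DifferentiableOn.mul
      (DifferentiableOn.fun_finsetProd fun b _ z hz => ?_)
      (DifferentiableOn.fun_finsetProd fun b _ => ?_))
    · have h1 : DifferentiableAt ℂ Complex.Gamma (z - x b) :=
        differentiableAt_Gamma_of_re_pos (by
          rw [Complex.sub_re]
          linarith [hx₀ b, show a₀ < z.re from hz])
      have h2 : DifferentiableAt ℂ (fun z : ℂ => z - x b) z := by fun_prop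
      exact (h1.comp z h2).differentiableWithinAt
    · have h2 : Differentiable ℂ (fun z : ℂ => 1 - (y b - z)) := by fun_prop
      exact (Complex.differentiable_one_div_Gamma.comp h2).differentiableOn
  set A : ℝ := |a₀| + |(y k).re + 1| with hA
  have hgr : VertGrowth A 0 g := by
    have h1 := VertGrowth.prod Finset.univ fun b => VertGrowth.gamma_add A (-x b)
    have h2 := VertGrowth.prod (Finset.univ.erase k) fun b => VertGrowth.inv_gamma_add A (1 - y b)
    have h3 := (VertGrowth.polynomial A p).mul (h1.mul h2)
    -- The m factors Γ(z - x_b) and the m factors 1/Γ(1 - y_b + z) have opposite exponential rates,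
    -- so g grows only polynomially.
    have e : (0 : ℝ) + ((Finset.univ : Finset (Fin m)).card * (-(Real.pi / 2)) +
        (Finset.univ.erase k).card * (Real.pi / 2)) = 0 := by
      rw [Finset.card_erase_of_mem (Finset.mem_univ k)]
      simp
    rw [e] at h3
    have e' : ∀ b (z : ℂ), 1 - (y b - z) = z + (1 - y b) := fun b z => by ring
    simpa only [hg, e', sub_eq_add_neg (_ : ℂ) (x _)] using h3
  have h := tendsto_integral_Gamma_mul ha₀ (hy k) hgd (A := A) (fun c hc => ?_) hgr
  · refine h.congr fun s => ?_
    congr 1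
    simp only [barnesMoment_horizontalLine, ← integral_const_mul]
    rw [← integral_finsetSum _ fun l _ =>
      (integrable_vertical_momentIntegrand hy hx s p l).const_mul _]
    congr 1
    ext τ
    set z : ℂ := a + τ * Complex.I with hz
    have h1 : ∀ b, (Complex.Gamma (1 - (y b - z)))⁻¹ =
        Complex.Gamma (y b - z) * (Complex.sin (Real.pi * (y b - z)) / Real.pi) := fun b => by
      rw [Gamma_mul_sin]
      simpa [hz] using hy b
    have h2 : ∑ l : Fin (m + 1), c l * momentIntegrand s y x p l z =
        (∑ l : Fin (m + 1), c l * trigExp (m + 1) l z) * (p.eval z * barnesWeight s y x z) := by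
      rw [Finset.sum_mul]
      refine Finset.sum_congr rfl fun l _ => ?_
      rw [momentIntegrand]
      ring
    rw [h2, ← hc]
    simp only [hg, h1]
    rw [Finset.prod_mul_distrib, barnesWeight, ← Finset.mul_prod_erase _ _ (Finset.mem_univ k)]
    ring
  · refine (abs_le_max_abs_abs hc.1 hc.2).trans ?_
    exact max_le (by linarith [abs_nonneg ((y k).re + 1)]) (by linarith [abs_nonneg a₀])

/-- The evaluation of the determinant on a vertical line for generic parameters. -/
theorem momentDet_horizontalLine_of_sin_ne_zero (hy : ∀ b, a < (y b).re)
    (hx : ∀ b, (x b).re < a)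
    (hsin : ∀ k, ∀ b ≠ k, Complex.sin (Real.pi * (y b - y k)) ≠ 0) {κ : ℂ}
    (hκ : ∀ z : Fin (m + 1) → ℂ, sinVandermonde z =
      κ * (Matrix.of fun (k a : Fin (m + 1)) => trigExp (m + 1) k (z a)).det) (s : ℝ) :
    (κ * momentDet (horizontalLine a) 1 s y x fun j => Polynomial.X ^ (j : ℕ)) =
      (2 * Real.pi) ^ (m + 1) * (Complex.exp (s * ∑ b, y b) * Complex.exp (-Complex.exp s)) *
        ∏ b, ∏ c, Complex.Gamma (y b - x c) := by
  have hpi : (Real.pi : ℂ) ≠ 0 := by exact_mod_cast Real.pi_ne_zero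
  obtain ⟨K, hK⟩ := momentDet_mul_exp_eq hy hx
  choose c hc using fun k : Fin (m + 1) => exists_prod_sin_eq_sum (Finset.univ.erase k)
    (show (Finset.univ.erase k).card = m by simp) y
  set C : Matrix (Fin (m + 1)) (Fin (m + 1)) ℂ := Matrix.of fun k l => c k l with hC
  set ρ : Fin (m + 1) → ℂ := fun k => (∏ b, Complex.Gamma (y k - x b)) *
        ∏ b ∈ Finset.univ.erase k, (Complex.Gamma (1 - (y b - y k)))⁻¹ with hρ
  set P : ℂ := ∏ k, ∏ b ∈ Finset.univ.erase k, Complex.sin (Real.pi * (y b - y k)) / Real.pi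
    with hP
  set T : ℂ := (Matrix.of fun (k a : Fin (m + 1)) => trigExp (m + 1) k (y a)).det with hT
  have hlim1 : Tendsto (fun s : ℝ => (Matrix.of fun k j : Fin (m + 1) =>
      Complex.exp (-(s * y k)) * ∑ l : Fin (m + 1), c k l *
        barnesMoment (horizontalLine a) 1 s y x (Polynomial.X ^ (j : ℕ)) l).det) atBot
      (𝓝 (Matrix.of fun k j : Fin (m + 1) => 2 * Real.pi * (y k ^ (j : ℕ) * ρ k)).det) := by
    refine (continuous_id.matrix_det.tendsto _).comp
      (tendsto_pi_nhds.2 fun k => tendsto_pi_nhds.2 fun j => ?_)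
    have h := tendsto_sum_barnesMoment hy hx (Polynomial.X ^ (j : ℕ)) k (hc k)
    rwa [Polynomial.eval_pow, Polynomial.eval_X] at h
  have e1 : (Matrix.of fun k j : Fin (m + 1) => 2 * Real.pi * (y k ^ (j : ℕ) * ρ k)).det =
      (2 * Real.pi) ^ (m + 1) * ((∏ k, ρ k) * (Matrix.vandermonde y).det) := by
    have : (Matrix.of fun k j : Fin (m + 1) => 2 * Real.pi * (y k ^ (j : ℕ) * ρ k)) =
        Matrix.of fun k j => (2 * Real.pi * ρ k) * Matrix.vandermonde y k j := by
      ext k j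
      simp only [Matrix.of_apply, Matrix.vandermonde_apply]
      ring
    rw [this, Matrix.det_mul_column, Finset.prod_mul_distrib, Finset.prod_const]
    simp [mul_assoc]
  -- The row factors e^{-s y_k} exactly compensate e^{s∑y} in D, so K and det C are all that remains
  -- in the limit.
  have e2 : ∀ s : ℝ, (Matrix.of fun k j : Fin (m + 1) =>
      Complex.exp (-(s * y k)) * ∑ l : Fin (m + 1), c k l *
        barnesMoment (horizontalLine a) 1 s y x (Polynomial.X ^ (j : ℕ)) l).det =
      C.det * K * Complex.exp (-Complex.exp s) := by
    intro s
    have h1 : (Matrix.of fun k j : Fin (m + 1) =>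
      Complex.exp (-(s * y k)) * ∑ l : Fin (m + 1), c k l *
        barnesMoment (horizontalLine a) 1 s y x (Polynomial.X ^ (j : ℕ)) l) =
        Matrix.of fun k j => Complex.exp (-(s * y k)) * (C * (Matrix.of fun j l : Fin (m + 1) =>
          barnesMoment (horizontalLine a) 1 s y x (Polynomial.X ^ (j : ℕ)) l).transpose) k j := by
      ext k j
      simp [Matrix.mul_apply, hC]
    have h2 := hK s
    rw [momentDet] at h2
    rw [h1, Matrix.det_mul_column, Matrix.det_mul, Matrix.det_transpose, h2, ← Complex.exp_sum,
      Finset.sum_neg_distrib, ← Finset.mul_sum]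
    have h3 : Complex.exp (-(s * ∑ b, y b)) * Complex.exp (s * ∑ b, y b) = 1 := by
      rw [← Complex.exp_add, neg_add_cancel, Complex.exp_zero]
    linear_combination (C.det * K * Complex.exp (-Complex.exp s)) * h3
  have hlim2 : Tendsto (fun s : ℝ => C.det * K * Complex.exp (-Complex.exp s)) atBot
      (𝓝 (C.det * K)) := by
    simpa using tendsto_exp_neg_exp.const_mul (C.det * K)
  simp only [e2, e1] at hlim1
  have e3 := tendsto_nhds_unique hlim2 hlim1
  -- The k-th product of sines vanishes at z = y_b for every b ≠ k, so C times the matrix of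
  -- exponentials at y is diagonal.
  have e4 : C.det * T = P := by
    rw [hT, ← Matrix.det_mul, hP, ← Matrix.det_diagonal]
    congr 1
    ext k b
    rw [Matrix.mul_apply]
    simp only [hC, Matrix.of_apply]
    rw [← hc k (y b), Matrix.diagonal_apply]
    split_ifs with h
    · rw [h]
    · exact Finset.prod_eq_zero (Finset.mem_erase.2 ⟨Ne.symm h, Finset.mem_univ b⟩) (by simp)
  have e5 := inv_prod_offDiag_Gamma y
  rw [hκ y, ← hT] at e5
  -- Each 1/Γ(1 - u) from the residues pairs with a 1/Γ(u) from the Vandermonde and sine products at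
  -- y, and reflection gives the sines in P. Genericity makes P nonzero, so it can be cancelled.
  have e6 : (∏ k, ∏ b ∈ Finset.univ.erase k, (Complex.Gamma (1 - (y b - y k)))⁻¹) *
      (∏ p ∈ (Finset.univ : Finset (Fin (m + 1))).offDiag, Complex.Gamma (y p.1 - y p.2))⁻¹ =
      P := by
    rw [hP, prod_prod_erase_eq_prod_offDiag fun k b => (Complex.Gamma (1 - (y b - y k)))⁻¹,
      prod_prod_erase_eq_prod_offDiag fun k b => Complex.sin (Real.pi * (y b - y k)) / Real.pi,
      ← Finset.prod_inv_distrib, ← Finset.prod_mul_distrib]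
    refine Finset.prod_congr rfl fun p _ => ?_
    rw [← inv_Gamma_mul_Gamma_one_sub, mul_comm]
  have hP0 : P ≠ 0 := Finset.prod_ne_zero_iff.2 fun k _ => Finset.prod_ne_zero_iff.2 fun b hb =>
    div_ne_zero (hsin k b (Finset.ne_of_mem_erase hb)) hpi
  have e7 : κ * K = (2 * Real.pi) ^ (m + 1) * ∏ b, ∏ c, Complex.Gamma (y b - x c) := by
    refine mul_left_cancel₀ hP0 ?_
    simp only [hρ, Finset.prod_mul_distrib] at e3
    rw [e5] at e6
    rw [← e4]
    linear_combination (κ * T) * e3 + (2 * Real.pi) ^ (m + 1) *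
      (∏ b, ∏ c, Complex.Gamma (y b - x c)) * (e6 - e4)
  rw [hK]
  linear_combination (Complex.exp (s * ∑ b, y b) * Complex.exp (-Complex.exp s)) * e7

end

/-! ### Removing genericity by continuity in y -/

/-- A bound uniform in the real shift r, in terms of Γ on one line further right, provides the
dominating function for perturbed y_b. -/
theorem exists_norm_Gamma_add_le {u : ℝ} (hu : 0 < u) {M : ℝ} (hM : 0 < M) :
    ∃ C : ℝ, 0 ≤ C ∧ ∀ z : ℂ, z.re = u → ∀ r : ℝ, 0 ≤ r → r < M →
      ‖Complex.Gamma (z + r)‖ ≤ C * ‖Complex.Gamma (z + M)‖ := by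
  obtain ⟨K, hK⟩ := (isCompact_Icc (a := u) (b := u + M)).exists_bound_of_continuousOn
    (f := Real.Gamma) fun r hr => (Real.differentiableAt_Gamma fun n hn => by
      have := hu.trans_le hr.1
      rw [hn] at this
      linarith [(n.cast_nonneg : (0 : ℝ) ≤ n)]).continuousAt.continuousWithinAt
  have hG : 0 < Real.Gamma (u + M) := Real.Gamma_pos_of_pos (by linarith)
  have hK0 : 0 ≤ K := (norm_nonneg _).trans (hK u ⟨le_rfl, by linarith⟩)
  refine ⟨K / Real.Gamma (u + M), by positivity, fun z hz r hr hrM => ?_⟩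
  have hre : (z + r).re = u + r := by simp [hz]
  have e : ((u + M : ℝ) : ℂ) + (z + r).im * Complex.I = z + M := by
    apply Complex.ext <;> simp [hz]
  have h1 := norm_Gamma_le_of_lt (z := z + r) (M := u + M) (by rw [hre]; linarith)
    (by rw [hre]; linarith)
  rw [e, hre] at h1
  refine h1.trans ?_
  gcongr
  exact (le_abs_self _).trans (hK _ ⟨by linarith, by linarith⟩)

/-- If d is an integer, a nonzero displacement smaller than 1 leaves the integers; otherwise
continuity suffices. -/
theorem eventually_sin_ne_zero (d : ℂ) {c : ℝ} (hc : c ≠ 0) :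
    ∀ᶠ ε : ℝ in 𝓝[>] 0, Complex.sin (Real.pi * (d + (ε * c : ℝ))) ≠ 0 := by
  have hpi : (Real.pi : ℂ) ≠ 0 := by exact_mod_cast Real.pi_ne_zero
  by_cases h : Complex.sin (Real.pi * d) = 0
  · obtain ⟨k, hk⟩ := Complex.sin_eq_zero_iff.1 h
    have hd : d = k := mul_left_cancel₀ hpi (by rw [hk, mul_comm])
    have h1 : ∀ᶠ ε : ℝ in 𝓝[>] 0, |ε * c| < 1 := by
      have : ContinuousAt (fun ε : ℝ => |ε * c|) 0 := by fun_prop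
      refine nhdsWithin_le_nhds (this.eventually_lt_const ?_)
      simp
    filter_upwards [h1, self_mem_nhdsWithin] with ε hε hε0 h2
    obtain ⟨j, hj⟩ := Complex.sin_eq_zero_iff.1 h2
    have h3 : d + (ε * c : ℝ) = j := mul_left_cancel₀ hpi (by rw [hj, mul_comm])
    rw [hd] at h3
    have h4 : ε * c = ((j - k : ℤ) : ℝ) := by
      have : ((ε * c : ℝ) : ℂ) = ((j - k : ℤ) : ℂ) := by
        rw [Int.cast_sub]
        linear_combination h3
      exact_mod_cast this
    rw [h4, ← Int.cast_abs] at hε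
    have h5 : |j - k| < 1 := by exact_mod_cast hε
    rw [Int.abs_lt_one_iff] at h5
    rw [h5, Int.cast_zero] at h4
    exact mul_ne_zero (ne_of_gt hε0) hc h4
  · have h1 : ContinuousAt (fun ε : ℝ => Complex.sin (Real.pi * (d + (ε * c : ℝ)))) 0 := by
      fun_prop
    exact nhdsWithin_le_nhds (h1.eventually_ne (by simpa using h))

section

variable {m : ℕ} {a : ℝ} {y : Fin (m + 1) → ℂ} {x : Fin m → ℂ}

/-- The perturbation y_b + εb makes the parameters distinct modulo ℤ for small ε > 0, and a positive
ε keeps them to the right of the line. For ε < 1 all shifts stay below m + 1, the shift used in the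
majorant. -/
theorem tendsto_barnesMoment (hy : ∀ b, a < (y b).re) (hx : ∀ b, (x b).re < a) (s : ℝ)
    (p : Polynomial ℂ) (k : Fin (m + 1)) :
    Tendsto (fun ε : ℝ => barnesMoment (horizontalLine a) 1 s
      (fun b => y b + (ε * (b : ℕ) : ℝ)) x p k) (𝓝[>] 0)
      (𝓝 (barnesMoment (horizontalLine a) 1 s y x p k)) := by
  simp only [barnesMoment_horizontalLine]
  choose C hC0 hC using fun b => exists_norm_Gamma_add_le (sub_pos.2 (hy b))
    (show (0 : ℝ) < m + 1 by positivity)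
  have hre : ∀ (τ : ℝ) b, (y b - (a + τ * Complex.I)).re = (y b).re - a := fun τ b => by simp
  have hε : ∀ᶠ ε : ℝ in 𝓝[>] 0, 0 < ε ∧ ε < 1 := Ioo_mem_nhdsGT one_pos
  have hyε : ∀ ε : ℝ, 0 < ε → ∀ b : Fin (m + 1), a < (y b + (ε * (b : ℕ) : ℝ)).re := by
    intro ε h0 b
    rw [Complex.add_re, Complex.ofReal_re]
    have : 0 ≤ ε * (b : ℕ) := by positivity
    linarith [hy b]
  have hyM : ∀ b, a < (y b + (m + 1 : ℝ)).re := by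
    intro b
    rw [Complex.add_re, Complex.ofReal_re]
    linarith [hy b, (m.cast_nonneg : (0 : ℝ) ≤ m)]
  refine tendsto_integral_filter_of_dominated_convergence
    (fun τ : ℝ => (∏ b, C b) *
      ‖momentIntegrand s (fun b => y b + (m + 1 : ℝ)) x p k (a + τ * Complex.I)‖)
    (hε.mono fun ε h => (integrable_vertical_momentIntegrand (hyε ε h.1) hx s p
      k).aestronglyMeasurable)
    (hε.mono fun ε h => Eventually.of_forall fun τ => ?_)
    ((integrable_vertical_momentIntegrand hyM hx s p k).norm.const_mul _)
    (Eventually.of_forall fun τ => ?_)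
  · set z : ℂ := a + τ * Complex.I with hz
    have h1 : ∀ b : Fin (m + 1), ‖Complex.Gamma (y b + (ε * (b : ℕ) : ℝ) - z)‖ ≤
        C b * ‖Complex.Gamma (y b + (m + 1 : ℝ) - z)‖ := by
      intro b
      have hb : ((b : ℕ) : ℝ) ≤ m := by exact_mod_cast Nat.lt_succ_iff.1 b.2
      have h2 := hC b (y b - z) (hre τ b) (ε * (b : ℕ)) (by have := h.1; positivity)
        (by nlinarith [h.1, h.2, ((b : ℕ).cast_nonneg : (0 : ℝ) ≤ (b : ℕ))])
      convert! h2 using 3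
      · ring_nf
      · push_cast
        ring_nf
    have h3 : ∏ b : Fin (m + 1), ‖Complex.Gamma (y b + (ε * (b : ℕ) : ℝ) - z)‖ ≤
        (∏ b, C b) * ∏ b : Fin (m + 1), ‖Complex.Gamma (y b + (m + 1 : ℝ) - z)‖ := by
      rw [← Finset.prod_mul_distrib]
      exact Finset.prod_le_prod (fun b _ => norm_nonneg _) fun b _ => h1 b
    simp only [momentIntegrand, barnesWeight, norm_mul, norm_prod]
    calc _ = (‖p.eval z‖ * ‖trigExp (m + 1) k z‖ * ‖Complex.exp (s * z)‖ *
          ∏ b, ‖Complex.Gamma (z - x b)‖) *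
          ∏ b : Fin (m + 1), ‖Complex.Gamma (y b + (ε * (b : ℕ) : ℝ) - z)‖ := by ring
      _ ≤ (‖p.eval z‖ * ‖trigExp (m + 1) k z‖ * ‖Complex.exp (s * z)‖ *
          ∏ b, ‖Complex.Gamma (z - x b)‖) *
          ((∏ b, C b) * ∏ b : Fin (m + 1), ‖Complex.Gamma (y b + (m + 1 : ℝ) - z)‖) :=
        mul_le_mul_of_nonneg_left h3 (by positivity)
      _ = _ := by ring
  · set z : ℂ := a + τ * Complex.I with hz
    have h1 : ∀ b : Fin (m + 1), Tendsto (fun ε : ℝ =>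
        Complex.Gamma (y b + (ε * (b : ℕ) : ℝ) - z)) (𝓝[>] 0) (𝓝 (Complex.Gamma (y b - z))) := by
      intro b
      have h2 : Tendsto (fun ε : ℝ => y b + (ε * (b : ℕ) : ℝ) - z) (𝓝[>] 0) (𝓝 (y b - z)) := by
        have : Continuous fun ε : ℝ => y b + (ε * (b : ℕ) : ℝ) - z := by fun_prop
        simpa using (this.tendsto 0).mono_left (nhdsWithin_le_nhds (s := Ioi 0))
      refine (differentiableAt_Gamma_of_re_pos ?_).continuousAt.tendsto.comp h2
      rw [hre]
      linarith [hy b]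
    exact ((((tendsto_finsetProd _ fun b _ => h1 b).mul_const _).const_mul _).const_mul _)

/-- The evaluation of the determinant on a vertical line. -/
theorem momentDet_horizontalLine (hy : ∀ b, a < (y b).re) (hx : ∀ b, (x b).re < a) {κ : ℂ}
    (hκ : ∀ z : Fin (m + 1) → ℂ, sinVandermonde z =
      κ * (Matrix.of fun (k a : Fin (m + 1)) => trigExp (m + 1) k (z a)).det) (s : ℝ) :
    (κ * momentDet (horizontalLine a) 1 s y x fun j => Polynomial.X ^ (j : ℕ)) =
      (2 * Real.pi) ^ (m + 1) * (Complex.exp (s * ∑ b, y b) * Complex.exp (-Complex.exp s)) *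
        ∏ b, ∏ c, Complex.Gamma (y b - x c) := by
  have hpt : ∀ b : Fin (m + 1), Tendsto (fun ε : ℝ => y b + (ε * (b : ℕ) : ℝ)) (𝓝[>] 0)
      (𝓝 (y b)) := by
    intro b
    have : Continuous fun ε : ℝ => y b + (ε * (b : ℕ) : ℝ) := by fun_prop
    simpa using (this.tendsto 0).mono_left (nhdsWithin_le_nhds (s := Ioi 0))
  have hL : Tendsto (fun ε : ℝ => κ * momentDet (horizontalLine a) 1 s
      (fun b => y b + (ε * (b : ℕ) : ℝ)) x fun j => Polynomial.X ^ (j : ℕ)) (𝓝[>] 0)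
      (𝓝 (κ * momentDet (horizontalLine a) 1 s y x fun j => Polynomial.X ^ (j : ℕ))) := by
    refine Tendsto.const_mul _ ((continuous_id.matrix_det.tendsto _).comp
      (tendsto_pi_nhds.2 fun j => tendsto_pi_nhds.2 fun k => ?_))
    exact tendsto_barnesMoment hy hx s _ k
  have hR : Tendsto (fun ε : ℝ => (2 * Real.pi : ℂ) ^ (m + 1) *
      (Complex.exp (s * ∑ b : Fin (m + 1), (y b + (ε * (b : ℕ) : ℝ))) *
        Complex.exp (-Complex.exp s)) *
        ∏ b : Fin (m + 1), ∏ c, Complex.Gamma (y b + (ε * (b : ℕ) : ℝ) - x c)) (𝓝[>] 0)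
      (𝓝 ((2 * Real.pi) ^ (m + 1) * (Complex.exp (s * ∑ b, y b) * Complex.exp (-Complex.exp s)) *
        ∏ b, ∏ c, Complex.Gamma (y b - x c))) := by
    refine Tendsto.mul (Tendsto.const_mul _ (Tendsto.mul_const _
      ((Complex.continuous_exp.tendsto _).comp
        (Tendsto.const_mul _ (tendsto_finsetSum _ fun b _ => hpt b)))))
      (tendsto_finsetProd _ fun b _ => tendsto_finsetProd _ fun c _ => ?_)
    refine (differentiableAt_Gamma_of_re_pos ?_).continuousAt.tendsto.comp
      ((hpt b).sub_const (x c))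
    rw [Complex.sub_re]
    linarith [hy b, hx c]
  refine tendsto_nhds_unique (hL.congr' ?_) hR
  have hne : ∀ᶠ ε : ℝ in 𝓝[>] 0, ∀ k b : Fin (m + 1), b ≠ k → Complex.sin (Real.pi *
      ((y b - y k) + (ε * ((b : ℕ) - (k : ℕ)) : ℝ))) ≠ 0 := by
    refine eventually_all.2 fun k => eventually_all.2 fun b => ?_
    by_cases h : b = k
    · exact Eventually.of_forall fun _ h' => absurd h h'
    · refine (eventually_sin_ne_zero (y b - y k) (c := (b : ℕ) - (k : ℕ)) ?_).mono fun ε h _ => h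
      rw [sub_ne_zero]
      exact_mod_cast fun h' => h (Fin.ext h')
  filter_upwards [hne, self_mem_nhdsWithin] with ε h1 h0
  refine momentDet_horizontalLine_of_sin_ne_zero (fun b => ?_) hx (fun k b hb => ?_) hκ s
  · rw [Complex.add_re, Complex.ofReal_re]
    have : 0 ≤ ε * (b : ℕ) := mul_nonneg (le_of_lt h0) (Nat.cast_nonneg _)
    linarith [hy b]
  · convert! h1 k b hb using 3
    push_cast
    ring

end

/-! ### Arbitrary ℏ and arbitrary separating contours -/

section

variable {m : ℕ} {ℏ : ℝ} {y : Fin (m + 1) → ℂ} {x : Fin m → ℂ}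

theorem barnesMoment_horizontalLine_mul (hℏ : 0 < ℏ) (a s : ℝ) (y : Fin (m + 1) → ℂ)
    (x : Fin m → ℂ) (p : Polynomial ℂ) (k : ℕ) :
    barnesMoment (horizontalLine (ℏ * a)) ℏ s y x p k =
      ℏ * barnesMoment (horizontalLine a) 1 s y x p k := by
  rw [barnesMoment_horizontalLine,
    ← integral_neg_eq_self (fun τ : ℝ => momentIntegrand s y x p k (a + τ * Complex.I)) volume,
    barnesMoment, contourIntegral_horizontalLine]
  have h := Measure.integral_comp_div
    (fun τ : ℝ => momentIntegrand s y x p k (a + (-τ : ℝ) * Complex.I)) ℏ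
  rw [abs_of_pos hℏ, Complex.real_smul] at h
  rw [← h]
  congr 1
  ext t
  have hℏ' : (ℏ : ℂ) ≠ 0 := by exact_mod_cast hℏ.ne'
  have e : ((t : ℂ) + (ℏ * a : ℝ) * Complex.I) / (Complex.I * ℏ) =
      a + (-(t / ℏ) : ℝ) * Complex.I := by
    rw [div_eq_iff (I_mul_ne_zero hℏ)]
    push_cast
    field_simp
    linear_combination (t : ℂ) * Complex.I_sq
  rw [e]
  rfl

theorem momentDet_horizontalLine_mul (hℏ : 0 < ℏ) (a s : ℝ) (y : Fin (m + 1) → ℂ)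
    (x : Fin m → ℂ) (p : Fin (m + 1) → Polynomial ℂ) :
    momentDet (horizontalLine (ℏ * a)) ℏ s y x p =
      ℏ ^ (m + 1) * momentDet (horizontalLine a) 1 s y x p := by
  have h := Matrix.det_smul (Matrix.of fun j k : Fin (m + 1) =>
    barnesMoment (horizontalLine a) 1 s y x (p j) k) (ℏ : ℂ)
  rw [Fintype.card_fin] at h
  rw [momentDet, momentDet, ← h]
  congr 1
  ext j k
  exact barnesMoment_horizontalLine_mul hℏ a s y x (p j) k

theorem momentDet_eq_of_separates {γ γ' : ℝ → ℂ} (hγ : IsStripContour γ)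
    (hγ' : IsStripContour γ') (hℏ : 0 < ℏ) (hsep : Separates γ ℏ y x)
    (hsep' : Separates γ' ℏ y x) (s : ℝ) (p : Fin (m + 1) → Polynomial ℂ) :
    momentDet γ ℏ s y x p = momentDet γ' ℏ s y x p := by
  rw [momentDet, momentDet]
  congr 1
  ext j k
  exact barnesMoment_eq_of_separates hγ hγ' hℏ hsep hsep' s (p j) k

end

theorem prod_Gamma_update {m : ℕ} {y : Fin (m + 1) → ℂ} {x : Fin m → ℂ} {b : Fin m}
    (h : ∀ a, y a - x b ≠ 0) :
    ∏ a, ∏ c, Complex.Gamma (y a - Function.update x b (x b - 1) c) =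
      (∏ a, (y a - x b)) * ∏ a, ∏ c, Complex.Gamma (y a - x c) := by
  rw [← Finset.prod_mul_distrib]
  refine Finset.prod_congr rfl fun a _ => ?_
  rw [← Finset.mul_prod_erase _ _ (Finset.mem_univ b),
    ← Finset.mul_prod_erase _ (fun c => Complex.Gamma (y a - x c)) (Finset.mem_univ b),
    Function.update_self, ← mul_assoc, ← Complex.Gamma_add_one _ (h a)]
  congr 1
  · congr 1
    ring
  · refine Finset.prod_congr rfl fun c hc => ?_
    rw [Function.update_of_ne (Finset.ne_of_mem_erase hc)]

/-- The evaluation of the determinant on a separating contour, by descent to a horizontal line. -/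
theorem momentDet_eq_of_sum {m : ℕ} {ℏ : ℝ} {y : Fin (m + 1) → ℂ} {γ : ℝ → ℂ}
    (hγ : IsStripContour γ) (hℏ : 0 < ℏ) {κ : ℂ}
    (hκ : ∀ z : Fin (m + 1) → ℂ, sinVandermonde z =
      κ * (Matrix.of fun (k a : Fin (m + 1)) => trigExp (m + 1) k (z a)).det) (s : ℝ) {r : ℝ}
    (hr : ∀ a, r < (y a).re) (N : ℕ) : ∀ x : Fin m → ℂ, Separates γ ℏ y x →
    ∀ v : Fin m → ℕ, ∑ b, v b = N → (∀ b, (x b).re - v b < r) →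
    (κ * momentDet γ ℏ s y x fun j => Polynomial.X ^ (j : ℕ)) =
      (2 * Real.pi * ℏ) ^ (m + 1) *
        (Complex.exp (s * ∑ b, y b) * Complex.exp (-Complex.exp s)) *
        ∏ b, ∏ c, Complex.Gamma (y b - x c) := by
  -- v_b is the number of unit shifts planned for x_b, and N their total. At N = 0 all x_b lie to
  -- the left of r, so the horizontal line at height ℏr separates the poles and can replace γ.
  induction N with
  | zero =>
    intro x hsep v hv hx
    have hx' : ∀ b, (x b).re < r := fun b => by
      have := hx b
      rw [Finset.sum_eq_zero_iff.1 hv b (Finset.mem_univ b)] at this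
      simpa using this
    rw [momentDet_eq_of_separates hγ (isStripContour_horizontalLine _) hℏ hsep
      (separates_horizontalLine_mul hℏ hr hx'), momentDet_horizontalLine_mul hℏ, mul_left_comm,
      momentDet_horizontalLine hr hx' hκ]
    ring
  | succ N ih =>
    intro x hsep v hv hx
    obtain ⟨b, -, hb⟩ : ∃ b ∈ Finset.univ, v b ≠ 0 := by
      refine Finset.exists_ne_zero_of_sum_ne_zero ?_
      rw [hv]
      exact N.succ_ne_zero
    obtain ⟨u, hu⟩ := Nat.exists_eq_succ_of_ne_zero hb
    have hne := fun a => hsep.y_sub_x_ne_zero hγ a b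
    have h1 := ih _ (hsep.update b) (Function.update v b u) ?_ ?_
    · rw [prod_Gamma_update hne] at h1
      cases m with
      | zero => exact b.elim0
      | succ m =>
        rw [momentDet_update hγ hℏ hsep] at h1
        -- Both sides of the identity for the shifted x carry the factor ∏(y_a - x_b), nonzero
        -- because γ separates.
        refine mul_left_cancel₀ (Finset.prod_ne_zero_iff (s := Finset.univ).2 fun a _ => hne a) ?_
        linear_combination h1
    · have e := Finset.sum_update_of_mem (Finset.mem_univ b) v u
      have e' := Finset.add_sum_erase _ v (Finset.mem_univ b)
      rw [Finset.sdiff_singleton_eq_erase] at e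
      omega
    · intro c
      rcases eq_or_ne c b with rfl | h
      · have := hx c
        rw [hu] at this
        push_cast at this
        simp only [Function.update_self, Complex.sub_re, Complex.one_re]
        linarith
      · rw [Function.update_of_ne h, Function.update_of_ne h]
        exact hx c

theorem momentDet_eq {m : ℕ} {ℏ : ℝ} {y : Fin (m + 1) → ℂ} {x : Fin m → ℂ} {γ : ℝ → ℂ}
    (hγ : IsStripContour γ) (hℏ : 0 < ℏ) (hsep : Separates γ ℏ y x) {κ : ℂ}
    (hκ : ∀ z : Fin (m + 1) → ℂ, sinVandermonde z =
      κ * (Matrix.of fun (k a : Fin (m + 1)) => trigExp (m + 1) k (z a)).det) (s : ℝ) :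
    (κ * momentDet γ ℏ s y x fun j => Polynomial.X ^ (j : ℕ)) =
      (2 * Real.pi * ℏ) ^ (m + 1) *
        (Complex.exp (s * ∑ b, y b) * Complex.exp (-Complex.exp s)) *
        ∏ b, ∏ c, Complex.Gamma (y b - x c) := by
  -- The y_a stay fixed; it is enough to push the x_b to the left of a common lower bound r of the
  -- Re y_a.
  obtain ⟨r, hr⟩ : ∃ r : ℝ, ∀ a, r < (y a).re :=
    (eventually_all.2 fun a => eventually_lt_atBot (y a).re).exists
  choose v hv using fun b => exists_nat_gt ((x b).re - r)
  exact momentDet_eq_of_sum hγ hℏ hκ s hr _ x hsep v rfl fun b => by linarith [hv b]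

theorem integral_contourPullback_gammaIntegrand {m : ℕ} {ℏ : ℝ} (hℏ : 0 < ℏ) (s : ℝ)
    {y : Fin (m + 1) → ℂ} {x : Fin m → ℂ} {γ : ℝ → ℂ} (hγ : IsStripContour γ)
    (hy : ∀ (a : Fin (m + 1)) (k : ℕ), LiesAbove γ (y a + Complex.I * ℏ * k))
    (hx : ∀ (b : Fin m) (k : ℕ), LiesBelow γ (x b - Complex.I * ℏ * k)) :
    Integrable (contourPullback γ (gammaIntegrand ℏ s y x)) ∧
    (∫ t : Fin (m + 1) → ℝ, contourPullback γ (gammaIntegrand ℏ s y x) t) /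
        (2 * Real.pi * ℏ : ℂ) ^ (m + 1) =
      (m + 1).factorial * Complex.exp (s * (∑ a, y a) / (Complex.I * ℏ)) *
        Complex.exp (-Complex.exp s) *
        ∏ a, ∏ b, Complex.Gamma ((y a - x b) / (Complex.I * ℏ)) := by
  have h0 := I_mul_ne_zero hℏ
  have hpi : (Real.pi : ℂ) ≠ 0 := by exact_mod_cast Real.pi_ne_zero
  have hℏ' : (ℏ : ℂ) ≠ 0 := by exact_mod_cast hℏ.ne'
  have hsep : Separates γ ℏ (fun b => y b / (Complex.I * ℏ)) fun b => x b / (Complex.I * ℏ) := by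
    refine ⟨fun a k => ?_, fun b k => ?_⟩
    · rw [mul_add, mul_div_cancel₀ _ h0]
      exact hy a k
    · rw [mul_sub, mul_div_cancel₀ _ h0]
      exact hx b k
  obtain ⟨κ, -, hκ, h⟩ := integral_contourPullback (n := m + 1) (m := m)
  obtain ⟨h1, h2⟩ := h ℏ s y x γ (fun j => Polynomial.X ^ (j : ℕ)) (fun j => by simp)
    (fun j => Polynomial.monic_X_pow _) fun j k => integrable_momentIntegrand hγ hℏ hsep s _ k
  refine ⟨h1, ?_⟩
  have h3 := momentDet_eq hγ hℏ hsep hκ s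
  rw [momentDet] at h3
  rw [h2, mul_left_comm, h3, div_eq_iff (pow_ne_zero _ (mul_ne_zero (mul_ne_zero two_ne_zero hpi)
    hℏ')), ← Finset.sum_div, ← mul_div_assoc]
  simp only [sub_div]
  ring

theorem mainTheorem7 (n : ℕ) (hn : 1 ≤ n) (ℏ : ℝ) (hℏ : 0 < ℏ) (s : ℝ)
    (y : Fin n → ℂ) (x : Fin (n - 1) → ℂ) (γ : ℝ → ℂ) (hγ : IsStripContour γ)
    (hy : ∀ (a : Fin n) (k : ℕ), LiesAbove γ (y a + Complex.I * ℏ * k))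
    (hx : ∀ (b : Fin (n - 1)) (k : ℕ), LiesBelow γ (x b - Complex.I * ℏ * k)) :
    MeasureTheory.Integrable (contourPullback γ (gammaIntegrand ℏ s y x)) ∧
    (∫ t : Fin n → ℝ, contourPullback γ (gammaIntegrand ℏ s y x) t) /
        (2 * Real.pi * ℏ : ℂ) ^ n =
      n.factorial * Complex.exp (s * (∑ a, y a) / (Complex.I * ℏ)) *
        Complex.exp (-Complex.exp s) *
        ∏ a, ∏ b, Complex.Gamma ((y a - x b) / (Complex.I * ℏ)) := by
  -- With n = m + 1, the index type `Fin (n - 1)` is definitionally `Fin m`.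
  obtain ⟨m, rfl⟩ := Nat.exists_eq_add_of_le' hn
  exact integral_contourPullback_gammaIntegrand hℏ s hγ hy hx
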